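/- **Setting.** In the complex Hilbert space $L^2(0,\pi)$ let $L_0y=-y''$ with domain $\{y\in W_2^2(0,\pi):y(0)=y(\pi),\,y'(0)=y'(\pi)\}$; its eigenvalues are $z_k(0)=4k^2$ ($k\in\mathbb Z_+$) with eigenspaces $G_k=\operatorname{span}\{\cos 2kx,\sin 2kx\}$. For $\alpha\in\mathbb R$ and $v\in L^2(0,\pi)$ let $$L=L(\alpha,v)=L_0+\alpha\langle\cdot,v\rangle v$$ with the same domain, and let $v_k=E_kv$ be the orthogonal projection of $v$ onto $G_k$. For a point $z$, its multiplicity with respect to $L$ (or $L_0$) is $m_L(z)=\dim\operatorname{Ker}(L-z)$ (or $m_{L_0}(z)=\dim\operatorname{Ker}(L_0-z)$). Let $$P=\{z\in\sigma(L_0):m_L(z)<m_{L_0}(z)\},\qquad Z=\{z\in\sigma(L):m_L(z)>m_{L_0}(z)\};$$ these sets depend only on $\sigma(L)$ counted with multiplicities. Put $e(a,w)=1-w/a$ for $a\neq0$ and $e(0,w)=w$. With $f^*(\lambda)=\overline{f(\bar\lambda)}$ and $\Delta(0,\lambda)=2(1-\cos\lambda\pi)$, let $\Delta(\alpha,\lambda)$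 be the characteristic function of $L$, i.e. the function $$\Delta(\alpha,\lambda)=\Delta(0,\lambda)+2\alpha\Big\{\frac{W(\lambda)N(\lambda)}{\Delta(0,\lambda)}-F(\lambda)-F^*(\lambda)-G(\lambda)\Big\},$$ $$W(\lambda)=\int_0^\pi\frac{\sin\lambda x+\sin\lambda(\pi-x)}{\lambda}\overline{v(x)}\,dx,\qquad N(\lambda)=\int_0^\pi(\cos\lambda t-\cos\lambda(\pi-t))v(t)\,dt,$$ $$F(\lambda)=\int_0^\pi\frac{\sin\lambda(\pi-x)}{\lambda}\int_0^x\cos\lambda t\,v(t)\,dt\,\overline{v(x)}\,dx,\qquad G(\lambda)=\int_0^\pi\int_0^x\frac{\sin\lambda(x-t)}{\lambda}v(t)\,dt\,\overline{v(x)}\,dx,$$ extended by its limits to the even integers. **Theorem.** Let $\alpha\in\mathbb R$ and $v\in L^2(0,\pi)$. 1. If $\alpha\ne0$, then $P=\sigma(L_0)\setminus\sigma_0$ with $\sigma_0=\{z_k(0):v_k=0\}$, and $Z=\sigma_2$ is the set of zeros (outside $P$) of $Q(z)=1+\alpha\sum_{v_k\ne0}\dfrac{\|v_k\|^2}{z_k(0)-z}$.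 2. There is a real number $A\neq0$ such that the following holds; all the infinite products converge unconditionally. (a) For all $\lambda\in\mathbb C$, $$\Delta(\alpha,\lambda)=A\prod_{z\in\sigma(L)}e(z,\lambda^2)^{m_L(z)};$$ in particular $\Delta(\alpha,\lambda)=A\prod_k\bigl(1-\lambda^2/z_k(\alpha)\bigr)$ if $0\notin\sigma(L)$, where $z_k(\alpha)$ are the points of $\sigma(L)$ repeated according to multiplicity. (b) $A$ is obtained from $\sigma(L)$ by $$\frac1A=\lim_{y\to+\infty}\frac{\prod_{\mu\in Z}e(\mu,iy)}{\pi^2\prod_{s\in P}e(s,iy)}.$$ (c) If $z_p(0)\notin P$, then $\alpha\|v_p\|^2=0$. If $0=z_0(0)\in P$, then $\alpha\|v_0\|^2=-A/\pi^2$. If $p\ne0$ and $z_p(0)\in P$, then $$\alpha\|v_p\|^2=\frac{A}{\pi^2}\,z_p(0)\,\frac{\prod_{\mu\in Z}e(\mu,z_p(0))}{\prod_{s\in P,\ s\ne z_p(0)}e(s,z_p(0))}.$$ (d) Let $0\in P$ and $K=\{k\ge1:z_k(0)\in P\}$. If the points of $Z$ are enumerated by $K$ in any way, $Z=\{\mu_k\}_{k\in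 K}$ without repetitions (this is possible if $P$ is infinite), then for every $p\in K$ $$\alpha\|v_p\|^2=A\,\frac{\mu_p-z_p(0)}{\pi^2\mu_p}\prod_{k\in K,\ k\neq p}\frac{z_k(0)}{\mu_k}\Bigl(1-\frac{z_k(0)-\mu_k}{z_k(0)-z_p(0)}\Bigr).$$ 3. The numbers $\alpha\|v_p\|^2$, $p\in\mathbb Z_+$, are uniquely determined by the spectrum of $L$ counted with multiplicities: if $\sigma(L(\alpha,v))=\sigma(L(\alpha',v'))$ with equal multiplicities, then $\alpha\|v_p\|^2=\alpha'\|v'_p\|^2$ for all $p\in\mathbb Z_+$. -/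

import Mathlib

open MeasureTheory Filter Topology

noncomputable section

namespace NonlocalPeriodic

/-- The complex Hilbert space `L²(0, π)`. -/
abbrev L2 : Type := Lp ℂ 2 (volume.restrict (Set.Ioo (0 : ℝ) Real.pi))

/-- `f` is (the class of) a function `y ∈ W₂²(0, π)`, i.e. `y` and `y'` are absolutely continuous
on `[0, π]` and `y'' = h ∈ L²(0, π)`, subject to `y(0) = y(π)` and `y'(0) = y'(π)`. -/
def HasPeriodicSecondDeriv (f h : L2) : Prop :=
  ∃ y y' : ℝ → ℂ,
    (f =ᵐ[volume.restrict (Set.Ioo (0 : ℝ) Real.pi)] y) ∧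
    (∀ x ∈ Set.Icc (0 : ℝ) Real.pi, y x = y 0 + ∫ t in (0 : ℝ)..x, y' t) ∧
    (∀ x ∈ Set.Icc (0 : ℝ) Real.pi, y' x = y' 0 + ∫ t in (0 : ℝ)..x, h t) ∧
    y 0 = y Real.pi ∧ y' 0 = y' Real.pi

theorem intervalIntegrable_coe (h : L2) : IntervalIntegrable h volume 0 Real.pi := by
  rw [intervalIntegrable_iff_integrableOn_Ioo_of_le Real.pi_pos.le]
  exact (Lp.memLp h).integrable (by norm_num)

theorem intervalIntegrable_of_mem {g : ℝ → ℂ} (hg : IntervalIntegrable g volume 0 Real.pi)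
    {x : ℝ} (hx : x ∈ Set.Icc (0 : ℝ) Real.pi) : IntervalIntegrable g volume 0 x := by
  refine hg.mono_set ?_
  rw [Set.uIcc_of_le hx.1, Set.uIcc_of_le Real.pi_pos.le]
  exact Set.Icc_subset_Icc le_rfl hx.2

theorem continuousOn_of_eq_integral {y g : ℝ → ℂ} (hg : IntervalIntegrable g volume 0 Real.pi)
    (h : ∀ x ∈ Set.Icc (0 : ℝ) Real.pi, y x = y 0 + ∫ t in (0 : ℝ)..x, g t) :
    ContinuousOn y (Set.Icc (0 : ℝ) Real.pi) := by
  have h1 : ContinuousOn (fun x => y 0 + ∫ t in (0 : ℝ)..x, g t) (Set.Icc (0 : ℝ) Real.pi) := by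
    refine continuousOn_const.add ?_
    have := intervalIntegral.continuousOn_primitive_interval' hg
      (Set.left_mem_uIcc (a := (0 : ℝ)) (b := Real.pi))
    rwa [Set.uIcc_of_le Real.pi_pos.le] at this
  exact h1.congr h

/-- The graph `{(y, -y'')}` of the second derivative operator with periodic boundary conditions. -/
def graphL0 : Submodule ℂ (L2 × L2) where
  carrier := {p | HasPeriodicSecondDeriv p.1 (-p.2)}
  zero_mem' := by
    refine ⟨fun _ => 0, fun _ => 0, ?_, ?_, ?_, rfl, rfl⟩
    · exact Lp.coeFn_zero _ _ _
    · intro x _; simp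
    · intro x hx
      have h0 : (((-(0 : L2 × L2).2 : L2)) : ℝ → ℂ)
          =ᵐ[volume.restrict (Set.Ioo (0 : ℝ) Real.pi)] fun _ => 0 := by
        have := Lp.coeFn_zero ℂ 2 (volume.restrict (Set.Ioo (0 : ℝ) Real.pi))
        rw [Prod.snd_zero, neg_zero]
        exact this
      have : ∫ t in (0 : ℝ)..x, ((-(0 : L2 × L2).2 : L2) : ℝ → ℂ) t = 0 := by
        rw [intervalIntegral.integral_of_le hx.1, integral_Ioc_eq_integral_Ioo]
        refine integral_eq_zero_of_ae ?_
        exact ae_mono (Measure.restrict_mono (Set.Ioo_subset_Ioo le_rfl hx.2) le_rfl) h0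
      rw [this]; simp
  add_mem' := by
    rintro ⟨f, k⟩ ⟨g, l⟩ ⟨y, y', h1, h2, h3, h4, h5⟩ ⟨w, w', j1, j2, j3, j4, j5⟩
    have iy' : IntervalIntegrable y' volume 0 Real.pi :=
      ((continuousOn_of_eq_integral (intervalIntegrable_coe _) h3).mono
        (by rw [Set.uIcc_of_le Real.pi_pos.le])).intervalIntegrable
    have iw' : IntervalIntegrable w' volume 0 Real.pi :=
      ((continuousOn_of_eq_integral (intervalIntegrable_coe _) j3).mono
        (by rw [Set.uIcc_of_le Real.pi_pos.le])).intervalIntegrable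
    refine ⟨y + w, y' + w', ?_, ?_, ?_, ?_, ?_⟩
    · exact (Lp.coeFn_add f g).trans (h1.add j1)
    · intro x hx
      simp only [Pi.add_apply]
      rw [intervalIntegral.integral_add (intervalIntegrable_of_mem iy' hx)
        (intervalIntegrable_of_mem iw' hx), h2 x hx, j2 x hx]
      ring
    · intro x hx
      have hadd : ((-(k + l) : L2) : ℝ → ℂ)
          =ᵐ[volume.restrict (Set.Ioo (0 : ℝ) Real.pi)]
          fun t => (-k : L2) t + (-l : L2) t := by
        rw [neg_add]; exact Lp.coeFn_add _ _
      have : ∫ t in (0 : ℝ)..x, ((-(k + l) : L2) : ℝ → ℂ) t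
          = ∫ t in (0 : ℝ)..x, ((-k : L2) t + (-l : L2) t) := by
        rw [intervalIntegral.integral_of_le hx.1, intervalIntegral.integral_of_le hx.1,
          integral_Ioc_eq_integral_Ioo, integral_Ioc_eq_integral_Ioo]
        refine integral_congr_ae ?_
        exact ae_mono (Measure.restrict_mono (Set.Ioo_subset_Ioo le_rfl hx.2) le_rfl) hadd
      simp only [Pi.add_apply, Prod.mk_add_mk]
      rw [this, intervalIntegral.integral_add
        (intervalIntegrable_of_mem (intervalIntegrable_coe _) hx)
        (intervalIntegrable_of_mem (intervalIntegrable_coe _) hx), h3 x hx, j3 x hx]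
      ring
    · simp [h4, j4]
    · simp [h5, j5]
  smul_mem' := by
    rintro c ⟨f, k⟩ ⟨y, y', h1, h2, h3, h4, h5⟩
    refine ⟨c • y, c • y', ?_, ?_, ?_, ?_, ?_⟩
    · exact (Lp.coeFn_smul c f).trans (h1.const_smul c)
    · intro x hx
      simp only [Pi.smul_apply]
      rw [intervalIntegral.integral_smul, h2 x hx, smul_add]
    · intro x hx
      have hsm : ((-(c • k) : L2) : ℝ → ℂ)
          =ᵐ[volume.restrict (Set.Ioo (0 : ℝ) Real.pi)] fun t => c • (-k : L2) t := by
        rw [← smul_neg]; exact Lp.coeFn_smul _ _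
      have : ∫ t in (0 : ℝ)..x, ((-(c • k) : L2) : ℝ → ℂ) t
          = ∫ t in (0 : ℝ)..x, c • (-k : L2) t := by
        rw [intervalIntegral.integral_of_le hx.1, intervalIntegral.integral_of_le hx.1,
          integral_Ioc_eq_integral_Ioo, integral_Ioc_eq_integral_Ioo]
        refine integral_congr_ae ?_
        exact ae_mono (Measure.restrict_mono (Set.Ioo_subset_Ioo le_rfl hx.2) le_rfl) hsm
      simp only [Pi.smul_apply, Prod.smul_mk]
      rw [this, intervalIntegral.integral_smul, h3 x hx, smul_add]
    · simp [h4]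
    · simp [h5]

/-- The operator `L₀ y = -y''` in `L²(0, π)` with domain
`{y ∈ W₂²(0, π) : y(0) = y(π), y'(0) = y'(π)}`. -/
def L0 : L2 →ₗ.[ℂ] L2 := graphL0.toLinearPMap

/-- The second derivative is well defined, so `graphL0` really is the graph of `L0`. -/
theorem L0_graph : L0.graph = graphL0 := by
  refine Submodule.toLinearPMap_graph_eq _ ?_
  rintro ⟨f, k⟩ ⟨y, y', h1, h2, h3, -, -⟩ hf
  simp only at hf h1 h3 ⊢
  subst hf
  have hne : (0 : ℝ) ≠ Real.pi := Real.pi_pos.ne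
  have cy' := continuousOn_of_eq_integral (intervalIntegrable_coe _) h3
  have iy' : IntervalIntegrable y' volume 0 Real.pi :=
    (cy'.mono (by rw [Set.uIcc_of_le Real.pi_pos.le])).intervalIntegrable
  have cy := continuousOn_of_eq_integral iy' h2
  have key : ∀ {u g : ℝ → ℂ}, IntervalIntegrable g volume 0 Real.pi →
      (∀ x ∈ Set.Icc (0 : ℝ) Real.pi, u x = u 0 + ∫ t in (0 : ℝ)..x, g t) →
      (∀ x ∈ Set.Icc (0 : ℝ) Real.pi, u x = 0) →
      g =ᵐ[volume.restrict (Set.Ioo (0 : ℝ) Real.pi)] fun _ => 0 := by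
    intro u g hg hu hu0
    have h0 : ∀ x ∈ Set.Icc (0 : ℝ) Real.pi, ∫ t in (0 : ℝ)..x, g t = 0 := by
      intro x hx
      have := hu x hx
      rw [hu0 x hx, hu0 0 ⟨le_rfl, Real.pi_pos.le⟩, zero_add] at this
      exact this.symm
    have hae := IntervalIntegrable.ae_hasDerivAt_integral hg
    rw [EventuallyEq, ae_restrict_iff' measurableSet_Ioo]
    filter_upwards [hae] with x hx hxm
    have hx1 := hx (by rw [Set.uIcc_of_le Real.pi_pos.le]; exact Set.Ioo_subset_Icc_self hxm) 0
      (Set.left_mem_uIcc)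
    have hx2 : HasDerivAt (fun z => ∫ t in (0 : ℝ)..z, g t) 0 x := by
      refine (hasDerivAt_const x (0 : ℂ)).congr_of_eventuallyEq ?_
      filter_upwards [Ioo_mem_nhds hxm.1 hxm.2] with z hz
      exact h0 z (Set.Ioo_subset_Icc_self hz)
    exact hx1.unique hx2
  have toIcc : ∀ {u : ℝ → ℂ}, ContinuousOn u (Set.Icc (0 : ℝ) Real.pi) →
      u =ᵐ[volume.restrict (Set.Ioo (0 : ℝ) Real.pi)] (fun _ => 0) →
      ∀ x ∈ Set.Icc (0 : ℝ) Real.pi, u x = 0 := by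
    intro u cu hu
    refine Measure.eqOn_Icc_of_ae_eq volume hne ?_ cu continuousOn_const
    rwa [← Measure.restrict_congr_set Ioo_ae_eq_Icc]
  have y0 : ∀ x ∈ Set.Icc (0 : ℝ) Real.pi, y x = 0 :=
    toIcc cy (h1.symm.trans (Lp.coeFn_zero _ _ _))
  have y'0 := toIcc cy' (key iy' h2 y0)
  have hk := key (intervalIntegrable_coe _) h3 y'0
  have : (-k : L2) = 0 := (Lp.eq_zero_iff_ae_eq_zero).2 hk
  exact neg_eq_zero.1 this

/-- `L(α, v) = L₀ + α ⟨·, v⟩ v`, with the domain of `L₀`; here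
`⟨y, v⟩ = ∫₀^π y(t) conj (v(t)) dt`. -/
def opL (α : ℝ) (v : L2) : L2 →ₗ.[ℂ] L2 :=
  ((α : ℂ) • (InnerProductSpace.rankOne ℂ v v : L2 →L[ℂ] L2)).toLinearMap +ᵥ L0

theorem opL_apply (α : ℝ) (v : L2) (y : (opL α v).domain) :
    opL α v y = (α : ℂ) • (inner ℂ v (y : L2) • v) + L0 y := rfl

/-- `R` is a bounded everywhere defined inverse of `T - z`. -/
def IsResolventAt (T : L2 →ₗ.[ℂ] L2) (z : ℂ) (R : L2 →L[ℂ] L2) : Prop :=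
  (∀ f : L2, ∃ h : R f ∈ T.domain, T ⟨R f, h⟩ - z • R f = f) ∧
  (∀ y : T.domain, R (T y - z • (y : L2)) = y)

/-- The spectrum `σ(T)` of an unbounded operator. -/
def spec (T : L2 →ₗ.[ℂ] L2) : Set ℂ := {z | ¬ ∃ R : L2 →L[ℂ] L2, IsResolventAt T z R}

/-- The eigenspace `Ker (T - z)`. -/
def eigenspace (T : L2 →ₗ.[ℂ] L2) (z : ℂ) : Submodule ℂ L2 where
  carrier := {f | ∃ h : f ∈ T.domain, T ⟨f, h⟩ = z • f}
  zero_mem' := ⟨T.domain.zero_mem, by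
    have : (⟨0, T.domain.zero_mem⟩ : T.domain) = 0 := rfl
    rw [this, T.map_zero, smul_zero]⟩
  add_mem' := by
    rintro f g ⟨hf, ef⟩ ⟨hg, eg⟩
    refine ⟨T.domain.add_mem hf hg, ?_⟩
    have : (⟨f + g, T.domain.add_mem hf hg⟩ : T.domain) = ⟨f, hf⟩ + ⟨g, hg⟩ := rfl
    rw [this, T.map_add, ef, eg, smul_add]
  smul_mem' := by
    rintro c f ⟨hf, ef⟩
    refine ⟨T.domain.smul_mem c hf, ?_⟩
    have : (⟨c • f, T.domain.smul_mem c hf⟩ : T.domain) = c • ⟨f, hf⟩ := rfl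
    rw [this, T.map_smul, ef, smul_comm]

/-- The spectral multiplicity of `z`. -/
def mult (T : L2 →ₗ.[ℂ] L2) (z : ℂ) : ℕ := Module.finrank ℂ (eigenspace T z)

/-- Points of `σ(L₀)` whose multiplicity in `σ(T)` is smaller than in `σ(L₀)`. -/
def lowered (T : L2 →ₗ.[ℂ] L2) : Set ℂ := {z | z ∈ spec L0 ∧ mult T z < mult L0 z}

/-- Points of `σ(T)` whose multiplicity in `σ(T)` is larger than in `σ(L₀)`. -/
def raised (T : L2 →ₗ.[ℂ] L2) : Set ℂ := {z | z ∈ spec T ∧ mult L0 z < mult T z}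

/-- The eigenvalue `z_k(0) = 4k²` of `L₀`. -/
def z0 (k : ℕ) : ℂ := 4 * (k : ℂ) ^ 2

theorem memLp_of_continuous {f : ℝ → ℂ} (hf : Continuous f) :
    MemLp f 2 (volume.restrict (Set.Ioo (0 : ℝ) Real.pi)) := by
  obtain ⟨C, hC⟩ := (isCompact_Icc (a := (0 : ℝ)) (b := Real.pi)).exists_bound_of_continuousOn
    hf.continuousOn
  refine MemLp.of_bound hf.aestronglyMeasurable C ?_
  rw [ae_restrict_iff' measurableSet_Ioo]
  exact Eventually.of_forall fun x hx => hC x (Set.Ioo_subset_Icc_self hx)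

/-- `cos 2kx` as an element of `L²(0, π)`. -/
def cosE (k : ℕ) : L2 :=
  (memLp_of_continuous (f := fun x : ℝ => ((Real.cos (2 * k * x) : ℝ) : ℂ))
    (by fun_prop)).toLp

/-- `sin 2kx` as an element of `L²(0, π)`. -/
def sinE (k : ℕ) : L2 :=
  (memLp_of_continuous (f := fun x : ℝ => ((Real.sin (2 * k * x) : ℝ) : ℂ))
    (by fun_prop)).toLp

/-- `G_k = span {cos 2kx, sin 2kx}`; for `k = 0` these are the constants. -/
def G (k : ℕ) : Submodule ℂ L2 := Submodule.span ℂ {cosE k, sinE k}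

instance (k : ℕ) : FiniteDimensional ℂ (G k) :=
  FiniteDimensional.span_of_finite ℂ (Set.toFinite _)

/-- `v_k = E_k v`, the orthogonal projection of `v` onto `G_k`. -/
def proj (k : ℕ) (v : L2) : L2 := (G k).starProjection v

/-- `σ₀ = {z_k(0) : v_k = 0}`. -/
def sigma0 (v : L2) : Set ℂ := {z | ∃ k : ℕ, z = z0 k ∧ proj k v = 0}

/-- `Q(z) = 1 + α ∑ ‖v_k‖² / (z_k(0) - z)`, the sum being over those `k` with `v_k ≠ 0`. -/
def Q (α : ℝ) (v : L2) (z : ℂ) : ℂ :=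
  1 + (α : ℂ) * ∑' k : {k : ℕ // proj k v ≠ 0}, ((‖proj k v‖ ^ 2 : ℝ) : ℂ) / (z0 k - z)

/-- `σ₂`, the set of zeros of `Q`; the points of `σ(L₀) \ σ₀` are the singularities of `Q`. -/
def sigma2 (α : ℝ) (v : L2) : Set ℂ := {z | z ∉ spec L0 \ sigma0 v ∧ Q α v z = 0}

/-- `f*(λ) = conj (f (conj λ))`. -/
def starFun (f : ℂ → ℂ) (l : ℂ) : ℂ := (starRingEnd ℂ) (f ((starRingEnd ℂ) l))

/-- `Δ(0, λ) = 2 (1 - cos λπ)`. -/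
def Delta0 (l : ℂ) : ℂ := 2 * (1 - Complex.cos (l * Real.pi))

/-- `W(λ) = ∫₀^π (sin λx / λ) conj v(x) dx + ∫₀^π (sin λ(π - x) / λ) conj v(x) dx`. -/
def W (v : L2) (l : ℂ) : ℂ :=
  (∫ x in (0 : ℝ)..Real.pi, Complex.sin (l * x) / l * (starRingEnd ℂ) (v x)) +
  ∫ x in (0 : ℝ)..Real.pi, Complex.sin (l * (Real.pi - x)) / l * (starRingEnd ℂ) (v x)

/-- `N(λ) = ∫₀^π (cos λt - cos λ(π - t)) v(t) dt`. -/
def N (v : L2) (l : ℂ) : ℂ :=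
  ∫ t in (0 : ℝ)..Real.pi, (Complex.cos (l * t) - Complex.cos (l * (Real.pi - t))) * v t

/-- `F(λ) = ∫₀^π (sin λ(π - x) / λ) (∫₀^x cos λt v(t) dt) conj v(x) dx`. -/
def F (v : L2) (l : ℂ) : ℂ :=
  ∫ x in (0 : ℝ)..Real.pi, Complex.sin (l * (Real.pi - x)) / l *
    (∫ t in (0 : ℝ)..x, Complex.cos (l * t) * v t) * (starRingEnd ℂ) (v x)

/-- `G(λ) = ∫₀^π (∫₀^x (sin λ(x - t) / λ) v(t) dt) conj v(x) dx`. -/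
def Gint (v : L2) (l : ℂ) : ℂ :=
  ∫ x in (0 : ℝ)..Real.pi,
    (∫ t in (0 : ℝ)..x, Complex.sin (l * (x - t)) / l * v t) * (starRingEnd ℂ) (v x)

/-- The determinant `Δ(0,λ) + 2α (W N / Δ(0,λ) - F - F* - G)`, for `λ` with `Δ(0,λ) ≠ 0`. -/
def DeltaDet (α : ℝ) (v : L2) (l : ℂ) : ℂ :=
  Delta0 l + 2 * (α : ℂ) * (W v l * N v l / Delta0 l - F v l - starFun (F v) l - Gint v l)

/-- The characteristic function `Δ(α, λ)` of `L(α, v)`: the entire function which extends the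
determinant across its removable singularities (the even integers). -/
def Delta (α : ℝ) (v : L2) (l : ℂ) : ℂ := limUnder (𝓝[≠] l) (DeltaDet α v)

/-- The elementary factor with the simple zero `a`: `1 - w / a` if `a ≠ 0`, and `w` if `a = 0`. -/
def fac (a w : ℂ) : ℂ := if a = 0 then w else 1 - w / a

end NonlocalPeriodic

end

/-! In the orthonormal basis of exponentials `exp(2inx)/√π` the operator `L0` is multiplication by
`4n²`, so `L` is a rank-one perturbation of a diagonal operator and is governed by the scalar
function `Q(z) = 1 + α⟨(L0 - z)⁻¹v, v⟩`. A pole of `Q` lowers a multiplicity by one, since the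
eigenspace is cut by the orthogonal complement of `v`; a zero of `Q` off the poles raises it by one,
since one new eigenvector appears; elsewhere nothing changes (`mult_opL_of_isPole`,
`mult_opL_of_Q_eq_zero`, `mult_opL_of_Q_ne_zero`). Thus `P` is the set of poles of `Q` and `Z` the
set of its zeros.

Variation of parameters gives `Δ(α,λ) = Δ(0,λ) Q(λ²)` off the even integers (`DeltaDet_eq_mul_Q`).
Euler's sine product factors `Δ(0,λ)`, so what remains is to factor `Q`. Its coefficients `α‖v_k‖²`
all have the sign of `α`. If only finitely many poles are kept, the zeros interlace with the poles,
and each lies within `∑|c_k|` of its own pole. This bound does not depend on the truncation, so the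
zeros converge along an ultrafilter, and dominated convergence for products yields `Q(z) = ∏ (m_k -
z)/(s_k - z)` together with its residues (`exists_isSecularLimit`). As `∑ 1/|s_k|` converges and
`m_k - s_k` is bounded, the product splits into canonical products over `Z` and over `P`, up to a
real constant `C ≠ 0` (`exists_Q_eq_tprod`).

The theorem follows with `A = π²C`. Multiplication by the sine product expands `Δ(α,·)`
(`hasProd_Delta`), the limit `Q(iy) → 1` recovers `A` (`tendsto_canonical_quotient`), and the
residues of the factored `Q` are the formulas for `α‖v_p‖²`. These formulas involve only `P`, `Z`
and `A`, all determined by the spectrum with multiplicities, whence uniqueness. -/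

/-- A continuous real function with opposite signs at the ends of an interval has an interior
zero. -/
theorem exists_zero_of_mul_neg {f : ℝ → ℝ} (hf : Continuous f) {a b : ℝ} (hab : a < b)
    (h : f a * f b < 0) : ∃ x, a < x ∧ x < b ∧ f x = 0 := by
  have h0 : (0 : ℝ) ∈ Set.uIcc (f a) (f b) := by
    rcases mul_neg_iff.1 h with ⟨h1, h2⟩ | ⟨h1, h2⟩
    · exact Set.mem_uIcc.2 (Or.inr ⟨h2.le, h1.le⟩)
    · exact Set.mem_uIcc.2 (Or.inl ⟨h1.le, h2.le⟩)
  obtain ⟨x, hx, hx0⟩ := intermediate_value_uIcc hf.continuousOn h0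
  rw [Set.uIcc_of_le hab.le] at hx
  refine ⟨x, lt_of_le_of_ne hx.1 ?_, lt_of_le_of_ne hx.2 ?_, hx0⟩
  · rintro rfl
    simp [hx0] at h
  · rintro rfl
    simp [hx0] at h

theorem degree_prod_X_sub_C {ι : Type*} (S : Finset ι) (s : ι → ℝ) :
    (∏ t ∈ S, (Polynomial.X - Polynomial.C (s t))).degree = (S.card : WithBot ℕ) := by
  rw [Polynomial.degree_prod]
  simp

/-! ### The secular equation with finitely many poles -/

section Secular

variable {ι : Type*} [DecidableEq ι]

/-- The numerator of the rational function `1 + ∑ c i / (s i - z)`, up to sign. -/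
noncomputable def secularPoly (S : Finset ι) (s c : ι → ℝ) : Polynomial ℝ :=
  ∏ t ∈ S, (Polynomial.X - Polynomial.C (s t)) -
    ∑ i ∈ S, Polynomial.C (c i) * ∏ t ∈ S.erase i, (Polynomial.X - Polynomial.C (s t))

theorem eval_secularPoly (S : Finset ι) (s c : ι → ℝ) (x : ℝ) :
    (secularPoly S s c).eval x =
      ∏ t ∈ S, (x - s t) - ∑ i ∈ S, c i * ∏ t ∈ S.erase i, (x - s t) := by
  simp [secularPoly, Polynomial.eval_prod, Polynomial.eval_finsetSum]

theorem aeval_secularPoly (S : Finset ι) (s c : ι → ℝ) (z : ℂ) :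
    Polynomial.aeval z (secularPoly S s c) =
      ∏ t ∈ S, (z - s t) - ∑ i ∈ S, c i * ∏ t ∈ S.erase i, (z - s t) := by
  simp [secularPoly, map_prod, map_sum]

theorem eval_secularPoly_pole (S : Finset ι) (s c : ι → ℝ) {i : ι} (hi : i ∈ S) :
    (secularPoly S s c).eval (s i) = - (c i * ∏ t ∈ S.erase i, (s i - s t)) := by
  rw [eval_secularPoly, Finset.prod_eq_zero hi (sub_self _), zero_sub,
    Finset.sum_eq_single_of_mem i hi]
  intro j _ hji
  rw [Finset.prod_eq_zero (Finset.mem_erase.2 ⟨hji.symm, hi⟩) (sub_self _), mul_zero]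

theorem eval_secularPoly_eq_mul (S : Finset ι) (s c : ι → ℝ) {x : ℝ} (hx : ∀ i ∈ S, x ≠ s i) :
    (secularPoly S s c).eval x = (∏ t ∈ S, (x - s t)) * (1 - ∑ i ∈ S, c i / (x - s i)) := by
  rw [eval_secularPoly, mul_sub, mul_one, Finset.mul_sum]
  congr 1
  refine Finset.sum_congr rfl fun i hi => ?_
  rw [← Finset.mul_prod_erase S _ hi]
  have := sub_ne_zero.2 (hx i hi)
  field_simp

/-- With all `c i` positive, the values at consecutive poles alternate in sign, so the intermediate
value theorem puts a root strictly between a pole and the next one; the last pole is paired with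
infinity. -/
theorem exists_root_secularPoly (S : Finset ι) (s c : ι → ℝ) (hs : Function.Injective s)
    (hc : ∀ i ∈ S, 0 < c i) {i : ι} (hi : i ∈ S) :
    ∃ x, s i < x ∧ (∀ t ∈ S, s i < s t → x < s t) ∧ (secularPoly S s c).eval x = 0 := by
  have hcont : Continuous fun x => (secularPoly S s c).eval x := by fun_prop
  by_cases hT : (S.filter fun t => s i < s t).Nonempty
  · obtain ⟨j, hj, hjmin⟩ := Finset.exists_min_image _ s hT
    obtain ⟨hjS, hij⟩ := Finset.mem_filter.1 hj
    have hne : j ≠ i := by rintro rfl; exact lt_irrefl _ hij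
    -- `s j` is the pole next to `s i`, so any third pole lies on the same side of both. The sign
    -- change comes only from the pair `s i - s j` and `s j - s i`.
    have hprod : 0 < ∏ t ∈ (S.erase i).erase j, (s i - s t) * (s j - s t) := by
      refine Finset.prod_pos fun t ht => ?_
      simp only [Finset.mem_erase] at ht
      have h1 : s t ≠ s i := fun h => ht.2.1 (hs h)
      have h2 : s t ≠ s j := fun h => ht.1 (hs h)
      rcases lt_or_gt_of_ne h1 with h | h
      · exact mul_pos (by linarith) (by linarith)
      · have := hjmin t (Finset.mem_filter.2 ⟨ht.2.2, h⟩)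
        have h3 : s j < s t := lt_of_le_of_ne this h2.symm
        exact mul_pos_of_neg_of_neg (by linarith) (by linarith)
    have hlt : (secularPoly S s c).eval (s i) * (secularPoly S s c).eval (s j) < 0 := by
      rw [eval_secularPoly_pole S s c hi, eval_secularPoly_pole S s c hjS,
        ← Finset.mul_prod_erase (S.erase i) _ (Finset.mem_erase.2 ⟨hne, hjS⟩),
        ← Finset.mul_prod_erase (S.erase j) _ (Finset.mem_erase.2 ⟨hne.symm, hi⟩),
        Finset.erase_right_comm (a := j)]
      have hpos : 0 < c i * c j * ((s j - s i) * (s j - s i)) *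
          ∏ t ∈ (S.erase i).erase j, (s i - s t) * (s j - s t) := by
        have : 0 < s j - s i := by linarith
        have := hc i hi
        have := hc j hjS
        positivity
      rw [Finset.prod_mul_distrib] at hpos
      linarith
    obtain ⟨x, h1, h2, h3⟩ := exists_zero_of_mul_neg hcont hij hlt
    exact ⟨x, h1, fun t ht hit => h2.trans_le (hjmin t (Finset.mem_filter.2 ⟨ht, hit⟩)), h3⟩
  · have hmax : ∀ t ∈ S, s t ≤ s i := by
      intro t ht
      by_contra h
      exact hT ⟨t, Finset.mem_filter.2 ⟨ht, not_le.1 h⟩⟩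
    -- There is no pole further right, so the opposite sign is found far out, where the rational
    -- function tends to 1.
    have hlim : Tendsto (fun x : ℝ => 1 - ∑ i ∈ S, c i / (x - s i)) atTop (𝓝 (1 - ∑ i ∈ S, 0)) := by
      refine tendsto_const_nhds.sub (tendsto_finsetSum _ fun k _ => ?_)
      exact tendsto_const_nhds.div_atTop (tendsto_atTop_add_const_right _ (-s k) tendsto_id)
    have hev := (hlim.eventually (lt_mem_nhds (a := 0) (by simp))).and (eventually_gt_atTop (s i))
    obtain ⟨x, hx0, hx⟩ := hev.exists
    have hxne : ∀ t ∈ S, x ≠ s t := fun t ht => ((hmax t ht).trans_lt hx).ne'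
    have hlt : (secularPoly S s c).eval (s i) * (secularPoly S s c).eval x < 0 := by
      rw [eval_secularPoly_pole S s c hi, eval_secularPoly_eq_mul S s c hxne,
        ← Finset.mul_prod_erase S _ hi]
      have hp1 : 0 < ∏ t ∈ S.erase i, (s i - s t) := by
        refine Finset.prod_pos fun t ht => ?_
        have h := Finset.mem_erase.1 ht
        have := lt_of_le_of_ne (hmax t h.2) fun h' => h.1 (hs h')
        linarith
      have hp2 : 0 < ∏ t ∈ S.erase i, (x - s t) := by
        refine Finset.prod_pos fun t ht => ?_
        have := hmax t (Finset.mem_erase.1 ht).2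
        linarith
      have hci := hc i hi
      have hxi : 0 < x - s i := by linarith
      have : 0 < c i * (∏ t ∈ S.erase i, (s i - s t)) * ((x - s i) *
          (∏ t ∈ S.erase i, (x - s t)) * (1 - ∑ i ∈ S, c i / (x - s i))) := by positivity
      linarith
    obtain ⟨y, h1, h2, h3⟩ := exists_zero_of_mul_neg hcont hx hlt
    exact ⟨y, h1, fun t ht hit => absurd (hmax t ht) (not_le.2 hit), h3⟩

/-- Both sides are monic of degree `S.card` and vanish at the `S.card` distinct points `m i`. -/
theorem secularPoly_eq_prod (S : Finset ι) (s c m : ι → ℝ) (hm : Set.InjOn m S)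
    (hroot : ∀ i ∈ S, (secularPoly S s c).eval (m i) = 0) :
    secularPoly S s c = ∏ t ∈ S, (Polynomial.X - Polynomial.C (m t)) := by
  refine Polynomial.eq_of_degree_sub_lt_of_eval_index_eq S hm ?_ ?_
  · rcases S.eq_empty_or_nonempty with rfl | hS
    · simp [secularPoly]
    have h1 : (∏ t ∈ S, (Polynomial.X - Polynomial.C (s t)) -
        ∏ t ∈ S, (Polynomial.X - Polynomial.C (m t))).degree < (S.card : WithBot ℕ) := by
      rw [← degree_prod_X_sub_C S s]
      refine Polynomial.degree_sub_lt_left ?_ ?_ ?_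
      · rw [degree_prod_X_sub_C, degree_prod_X_sub_C]
      · exact (Polynomial.monic_prod_of_monic _ _ fun i _ => Polynomial.monic_X_sub_C _).ne_zero
      · rw [(Polynomial.monic_prod_of_monic _ _ fun i _ => Polynomial.monic_X_sub_C _).leadingCoeff,
          (Polynomial.monic_prod_of_monic _ _ fun i _ => Polynomial.monic_X_sub_C _).leadingCoeff]
    have h2 : (∑ i ∈ S, Polynomial.C (c i) *
        ∏ t ∈ S.erase i, (Polynomial.X - Polynomial.C (s t))).degree < (S.card : WithBot ℕ) := by
      rw [← Polynomial.mem_degreeLT]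
      refine Submodule.sum_mem _ fun i hi => ?_
      rw [← Polynomial.smul_eq_C_mul]
      refine Submodule.smul_mem _ _ ?_
      rw [Polynomial.mem_degreeLT, degree_prod_X_sub_C]
      exact_mod_cast Finset.card_erase_lt_of_mem hi
    have : secularPoly S s c - ∏ t ∈ S, (Polynomial.X - Polynomial.C (m t)) =
        (∏ t ∈ S, (Polynomial.X - Polynomial.C (s t)) -
          ∏ t ∈ S, (Polynomial.X - Polynomial.C (m t))) - ∑ i ∈ S, Polynomial.C (c i) *
          ∏ t ∈ S.erase i, (Polynomial.X - Polynomial.C (s t)) := by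
      rw [secularPoly]; ring
    rw [this]
    exact (Polynomial.degree_sub_le _ _).trans_lt (max_lt h1 h2)
  · intro i hi
    rw [hroot i hi, Polynomial.eval_prod]
    exact (Finset.prod_eq_zero hi (by simp)).symm

/-- The numbers `m i` are the zeros of `1 + ∑ c i / (s i - z)`, attached to the poles `s i`. -/
structure IsSecularShift (S : Finset ι) (s c m : ι → ℝ) : Prop where
  separated : ∀ i ∈ S, ∀ j ∈ S, s i < s j →
    (m i ≤ s j ∧ s j ≤ m j) ∨ (m i ≤ s i ∧ s i ≤ m j)
  abs_sub_le : ∀ i ∈ S, |m i - s i| ≤ ∑ t ∈ S, |c t|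
  eq_prod : ∀ z : ℂ, (∀ i ∈ S, z ≠ s i) →
    1 + ∑ i ∈ S, (c i : ℂ) / (s i - z) = ∏ i ∈ S, ((m i - z) / (s i - z))
  residue : ∀ p ∈ S, (c p : ℂ) = (m p - s p) * ∏ i ∈ S.erase p, (((m i : ℂ) - s p) / (s i - s p))

theorem exists_isSecularShift_of_pos (S : Finset ι) (s c : ι → ℝ) (hs : Function.Injective s)
    (hc : ∀ i ∈ S, 0 < c i) : ∃ m, IsSecularShift S s c m := by
  choose! m hm1 hm2 hm3 using fun i (hi : i ∈ S) => exists_root_secularPoly S s c hs hc hi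
  have hinj : Set.InjOn m S := by
    intro i hi j hj hij
    by_contra hne
    rcases lt_or_gt_of_ne (fun h => hne (hs h)) with h | h
    · have := hm2 i hi j hj h
      have := hm1 j hj
      linarith
    · have := hm2 j hj i hi h
      have := hm1 i hi
      linarith
  have hpoly := secularPoly_eq_prod S s c m hinj hm3
  have hae : ∀ z : ℂ, ∏ t ∈ S, (z - s t) - ∑ i ∈ S, c i * ∏ t ∈ S.erase i, (z - s t) =
      ∏ t ∈ S, (z - m t) := by
    intro z
    rw [← aeval_secularPoly, hpoly]
    simp [map_prod]
  have hmne : ∀ i ∈ S, ∀ t ∈ S, m i ≠ s t := by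
    intro i hi t ht h
    rcases lt_or_ge (s i) (s t) with h' | h'
    · exact (hm2 i hi t ht h').ne h
    · exact (h'.trans_lt (hm1 i hi)).ne' h
  -- At the root, `1 = ∑ c t / (m i - s t)`. Poles beyond `s i` lie beyond `m i` and contribute
  -- nonpositive terms; the other denominators are at least `m i - s i`.
  have hsub : ∀ i ∈ S, m i - s i ≤ ∑ t ∈ S, |c t| := by
    intro i hi
    have h0 := hm3 i hi
    rw [eval_secularPoly_eq_mul S s c (hmne i hi)] at h0
    have h1 : ∏ t ∈ S, (m i - s t) ≠ 0 :=
      Finset.prod_ne_zero_iff.2 fun t ht => sub_ne_zero.2 (hmne i hi t ht)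
    have h2 : 1 = ∑ t ∈ S, c t / (m i - s t) := by
      have := (mul_eq_zero.1 h0).resolve_left h1
      linarith
    have hpos : 0 < m i - s i := by have := hm1 i hi; linarith
    have h3 : ∑ t ∈ S, c t / (m i - s t) ≤ ∑ t ∈ S, |c t| / (m i - s i) := by
      refine Finset.sum_le_sum fun t ht => ?_
      rcases lt_or_ge (s i) (s t) with h | h
      · have h4 := hm2 i hi t ht h
        have h5 : c t / (m i - s t) ≤ 0 :=
          div_nonpos_of_nonneg_of_nonpos (hc t ht).le (by linarith)
        exact h5.trans (by positivity)
      · rw [abs_of_pos (hc t ht)]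
        exact div_le_div_of_nonneg_left (hc t ht).le hpos (by linarith)
    rw [← h2, ← Finset.sum_div, le_div_iff₀ hpos, one_mul] at h3
    exact h3
  refine ⟨m, ?_, ?_, ?_, ?_⟩
  · exact fun i hi j hj h => Or.inl ⟨(hm2 i hi j hj h).le, (hm1 j hj).le⟩
  · intro i hi
    rw [abs_of_pos (by have := hm1 i hi; linarith)]
    exact hsub i hi
  · intro z hz
    have h1 : ∏ t ∈ S, (s t - z) ≠ 0 :=
      Finset.prod_ne_zero_iff.2 fun t ht => sub_ne_zero.2 (hz t ht).symm
    have h2 : ∏ t ∈ S, (z - s t) ≠ 0 :=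
      Finset.prod_ne_zero_iff.2 fun t ht => sub_ne_zero.2 (hz t ht)
    have h3 : ∏ i ∈ S, ((m i - z) / (s i - z)) = ∏ i ∈ S, ((z - m i) / (z - s i)) :=
      Finset.prod_congr rfl fun i _ => by rw [← neg_sub z, ← neg_sub z (s i : ℂ), neg_div_neg_eq]
    rw [h3, Finset.prod_div_distrib, eq_div_iff h2, ← hae z, add_mul, one_mul, sub_eq_add_neg,
      Finset.sum_mul, ← Finset.sum_neg_distrib]
    congr 1
    refine Finset.sum_congr rfl fun i hi => ?_
    rw [← Finset.mul_prod_erase S _ hi]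
    have h4 := sub_ne_zero.2 (hz i hi).symm
    field_simp
    ring
  · intro p hp
    -- At a pole only one summand of the numerator survives, which expresses `c p` through the
    -- roots.
    have h := hae (s p)
    rw [Finset.prod_eq_zero hp (sub_self _), zero_sub, Finset.sum_eq_single_of_mem p hp] at h
    · rw [← Finset.mul_prod_erase S (fun t => (s p : ℂ) - m t) hp] at h
      have h1 : ∏ t ∈ S.erase p, ((s p : ℂ) - s t) ≠ 0 := by
        refine Finset.prod_ne_zero_iff.2 fun t ht => sub_ne_zero.2 ?_
        exact_mod_cast fun h => (Finset.mem_erase.1 ht).1 (hs h).symm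
      have h3 : ∏ i ∈ S.erase p, (((m i : ℂ) - s p) / (s i - s p)) =
          ∏ i ∈ S.erase p, (((s p : ℂ) - m i) / (s p - s i)) :=
        Finset.prod_congr rfl fun i _ => by
          rw [← neg_sub (s p : ℂ) (m i), ← neg_sub (s p : ℂ) (s i : ℂ), neg_div_neg_eq]
      rw [h3, Finset.prod_div_distrib, ← mul_div_assoc, eq_div_iff h1]
      linear_combination -h
    · intro j _ hjp
      rw [Finset.prod_eq_zero (Finset.mem_erase.2 ⟨hjp.symm, hp⟩) (sub_self _), mul_zero]

/-- The substitution `z ↦ -z` exchanges positive and negative `c`. It also swaps the two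
alternatives of `separated`, which is why that field is a disjunction. -/
theorem IsSecularShift.reflect {S : Finset ι} {s c m : ι → ℝ}
    (h : IsSecularShift S (fun i => -s i) (fun i => -c i) m) :
    IsSecularShift S s c fun i => -m i := by
  refine ⟨?_, ?_, ?_, ?_⟩
  · intro i hi j hj hij
    rcases h.separated j hj i hi (by linarith) with h' | h'
    · exact Or.inr ⟨by linarith, by linarith⟩
    · exact Or.inl ⟨by linarith, by linarith⟩
  · intro i hi
    have := h.abs_sub_le i hi
    rw [abs_sub_comm] at this
    simp only [abs_neg] at this
    rwa [show -m i - s i = -s i - m i by ring]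
  · intro z hz
    have := h.eq_prod (-z) fun i hi hzi => hz i hi (by
      push_cast at hzi
      exact neg_injective hzi)
    have e1 : ∀ i, ((-c i : ℝ) : ℂ) / (((-s i : ℝ) : ℂ) - -z) = c i / (s i - z) := by
      intro i
      push_cast
      rw [← neg_div_neg_eq]
      congr 1 <;> ring
    have e2 : ∀ i, ((m i : ℂ) - -z) / (((-s i : ℝ) : ℂ) - -z) =
        (((-m i : ℝ) : ℂ) - z) / (s i - z) := by
      intro i
      push_cast
      rw [← neg_div_neg_eq]
      congr 1 <;> ring
    simpa only [e1, e2] using this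
  · intro p hp
    have := h.residue p hp
    have e2 : ∀ i, ((m i : ℂ) - ((-s p : ℝ) : ℂ)) / (((-s i : ℝ) : ℂ) - ((-s p : ℝ) : ℂ)) =
        (((-m i : ℝ) : ℂ) - s p) / (s i - s p) := by
      intro i
      push_cast
      rw [← neg_div_neg_eq]
      congr 1 <;> ring
    simp only [e2] at this
    push_cast at this ⊢
    linear_combination -this

theorem exists_isSecularShift (S : Finset ι) (s c : ι → ℝ) (hs : Function.Injective s)
    (hc : (∀ i, 0 < c i) ∨ ∀ i, c i < 0) : ∃ m, IsSecularShift S s c m := by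
  rcases hc with hc | hc
  · exact exists_isSecularShift_of_pos S s c hs fun i _ => hc i
  · obtain ⟨m, hm⟩ := exists_isSecularShift_of_pos S (fun i => -s i) (fun i => -c i)
      (fun i j h => hs (neg_injective h)) fun i _ => neg_pos.2 (hc i)
    exact ⟨_, hm.reflect⟩

end Secular

/-! ### Passage to infinitely many poles -/

section SecularLimit

variable {ι : Type*}

/-- The summability forces `|s k| → ∞`, so a bounded displacement eventually costs at most half of
`|s k|`. -/
theorem summable_norm_inv_of_norm_sub_le {s : ι → ℝ} (hs : Function.Injective s)
    (hsum : Summable fun k => |s k|⁻¹) {a : ι → ℂ} {M : ℝ} (h : ∀ k, ‖a k - s k‖ ≤ M) :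
    Summable fun k => ‖(a k)⁻¹‖ := by
  refine Summable.of_norm_bounded_eventually (hsum.mul_left 2) ?_
  have h0 : ∀ᶠ k in cofinite, s k ≠ 0 := by
    have : {k | ¬ s k ≠ 0}.Finite := by
      refine Set.Subsingleton.finite fun i hi j hj => hs ?_
      simp only [ne_eq, not_not, Set.mem_ofPred_eq] at hi hj
      rw [hi, hj]
    exact this
  have hM : (0 : ℝ) < (2 * (|M| + 1))⁻¹ := by positivity
  filter_upwards [h0, hsum.tendsto_cofinite_zero.eventually (gt_mem_nhds hM)] with k hk hk2
  have hpos : 0 < |s k| := abs_pos.2 hk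
  have h1 : 2 * (|M| + 1) < |s k| := by
    rwa [inv_lt_inv₀ hpos (by positivity)] at hk2
  have h2 : |s k| / 2 ≤ ‖a k‖ := by
    have h3 : ‖(s k : ℂ)‖ - ‖a k‖ ≤ ‖a k - s k‖ := by
      rw [norm_sub_rev]; exact norm_sub_norm_le _ _
    rw [Complex.norm_real, Real.norm_eq_abs] at h3
    have := h k
    have := le_abs_self M
    linarith
  rw [norm_norm, norm_inv]
  calc ‖a k‖⁻¹ ≤ (|s k| / 2)⁻¹ := inv_anti₀ (by positivity) h2
    _ = 2 * |s k|⁻¹ := by rw [inv_div, div_eq_mul_inv]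

theorem summable_norm_inv_sub {s : ι → ℝ} (hs : Function.Injective s)
    (hsum : Summable fun k => |s k|⁻¹) (z : ℂ) : Summable fun k => ‖((s k : ℂ) - z)⁻¹‖ :=
  summable_norm_inv_of_norm_sub_le hs hsum (M := ‖z‖) fun k => by simp

/-- The zeros `m` and the poles `s` of `1 + ∑ c k / (s k - z)`, matched so that the function is
the product of the factors `(m k - z) / (s k - z)`. -/
structure IsSecularLimit (s c m : ι → ℝ) : Prop where
  injective : Function.Injective m
  ne_pole : ∀ k p, m k ≠ s p
  bounded : ∃ M, ∀ k, |m k - s k| ≤ M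
  eq_tprod : ∀ z : ℂ, (∀ k, z ≠ s k) →
    1 + ∑' k, (c k : ℂ) / (s k - z) = ∏' k, (((m k : ℂ) - z) / (s k - z))
  residue : ∀ p, (c p : ℂ) =
    (m p - s p) * ∏' k : {k // k ≠ p}, (((m k : ℂ) - s p) / (s k - s p))

-- Each factor is `1 + (x - s k)/(s k - z)`, and its deviation from 1 is dominated by the summable
-- `M ‖(s k - z)⁻¹‖`; factors outside `T a` or `J` are replaced by 1. Taking `J` to be everything
-- gives the product for the function, and `J = {k | k ≠ p}` gives the residue at `s p`.
open Classical in
theorem tendsto_prod_filter_div {α : Type*} {U : Filter α} {s : ι → ℝ}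
    (hs : Function.Injective s) (hsum : Summable fun k => |s k|⁻¹) {T : α → Finset ι}
    (hT : ∀ k, ∀ᶠ a in U, k ∈ T a) {x : α → ι → ℝ} {m : ι → ℝ} {M : ℝ}
    (hM : ∀ a, ∀ k ∈ T a, |x a k - s k| ≤ M) (hM0 : 0 ≤ M)
    (hx : ∀ k, Tendsto (fun a => x a k) U (𝓝 (m k))) (z : ℂ) (J : Set ι)
    (hJ : ∀ k ∈ J, z ≠ s k) :
    Tendsto (fun a => ∏ k ∈ T a with k ∈ J, (((x a k : ℂ) - z) / (s k - z))) U
      (𝓝 (∏' k : J, (((m k : ℂ) - z) / (s k - z)))) := by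
  have key := tendsto_tprod_one_add_of_dominated_convergence (𝓕 := U)
    (f := fun a k => if k ∈ T a ∧ k ∈ J then ((x a k : ℂ) - s k) / (s k - z) else 0)
    (g := fun k => if k ∈ J then ((m k : ℂ) - s k) / (s k - z) else 0)
    ((summable_norm_inv_sub hs hsum z).mul_left M) ?_ ?_
  · have hone : ∀ (y : ℝ) k, k ∈ J →
        1 + ((y : ℂ) - s k) / (s k - z) = (y - z) / (s k - z) := by
      intro y k hk
      have := sub_ne_zero.2 (hJ k hk).symm
      field_simp
      ring
    have e1 : ∏' k : J, (((m k : ℂ) - z) / (s k - z)) =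
        ∏' k, (1 + if k ∈ J then ((m k : ℂ) - s k) / (s k - z) else 0) := by
      rw [tprod_subtype J fun k => ((m k : ℂ) - z) / (s k - z)]
      refine tprod_congr fun k => ?_
      by_cases hk : k ∈ J
      · rw [Set.mulIndicator_of_mem hk, if_pos hk, hone _ _ hk]
      · rw [Set.mulIndicator_of_notMem hk, if_neg hk, add_zero]
    rw [e1]
    refine key.congr fun a => ?_
    rw [tprod_eq_prod (s := (T a).filter fun k => k ∈ J)]
    · refine Finset.prod_congr rfl fun k hk => ?_
      have hk' := Finset.mem_filter.1 hk
      rw [if_pos hk', hone _ _ hk'.2]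
    · intro k hk
      rw [if_neg fun h => hk (Finset.mem_filter.2 h), add_zero]
  · intro k
    by_cases hk : k ∈ J
    · simp only [hk, and_true, if_true]
      have h1 : Tendsto (fun a => ((x a k : ℂ) - s k) / (s k - z)) U
          (𝓝 (((m k : ℂ) - s k) / (s k - z))) :=
        (((Complex.continuous_ofReal.tendsto _).comp (hx k)).sub_const _).div_const _
      refine h1.congr' ?_
      filter_upwards [hT k] with a ha
      rw [if_pos ha]
    · simp only [hk, and_false, if_false]
      exact tendsto_const_nhds
  · refine Eventually.of_forall fun a k => ?_
    split_ifs with h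
    · rw [div_eq_mul_inv, norm_mul]
      refine mul_le_mul_of_nonneg_right ?_ (norm_nonneg _)
      rw [← Complex.ofReal_sub, Complex.norm_real]
      exact hM a k h.1
    · rw [norm_zero]
      positivity

theorem exists_isSecularLimit {s c : ι → ℝ} (hs : Function.Injective s)
    (hsum : Summable fun k => |s k|⁻¹) (hc : (∀ k, 0 < c k) ∨ ∀ k, c k < 0)
    (hcs : Summable c) : ∃ m, IsSecularLimit s c m := by
  classical
  choose x hx using fun S : Finset ι => exists_isSecularShift S s c hs hc
  have hca : Summable fun k => |c k| := hcs.abs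
  set M := ∑' k, |c k| with hMdef
  have hM0 : 0 ≤ M := tsum_nonneg fun _ => abs_nonneg _
  have hM : ∀ S, ∀ k ∈ S, |x S k - s k| ≤ M := fun S k hk =>
    ((hx S).abs_sub_le k hk).trans (hca.sum_le_tsum S fun _ _ => abs_nonneg _)
  -- An ultrafilter finer than `atTop` picks the limits of all the zeros at once, with no diagonal
  -- subsequence, and it decides the disjunction in `separated`. Values `x S k` with `k ∉ S` are
  -- arbitrary, but each `k` eventually belongs to `S`.
  set U : Ultrafilter (Finset ι) := Ultrafilter.of atTop
  have hU : (U : Filter (Finset ι)) ≤ atTop := Ultrafilter.of_le _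
  have hT : ∀ k, ∀ᶠ S in (U : Filter (Finset ι)), k ∈ S := by
    intro k
    refine hU ?_
    filter_upwards [eventually_ge_atTop {k}] with S hS
    exact hS (Finset.mem_singleton_self k)
  have hlim : ∀ k, ∃ y, Tendsto (fun S => x S k) U (𝓝 y) := by
    intro k
    obtain ⟨y, -, hy⟩ := (isCompact_Icc (a := s k - M) (b := s k + M)).ultrafilter_le_nhds
      (U.map fun S => x S k) (by
        rw [le_principal_iff]
        refine Filter.mem_map.2 ?_
        filter_upwards [hT k] with S hS
        have := abs_le.1 (hM S k hS)
        exact ⟨by linarith, by linarith⟩)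
    exact ⟨y, hy⟩
  choose m hm using hlim
  have hbd : ∀ k, |m k - s k| ≤ M := fun k =>
    le_of_tendsto ((hm k).sub_const _).abs (by
      filter_upwards [hT k] with S hS using hM S k hS)
  have hres : ∀ p, (c p : ℂ) =
      (m p - s p) * ∏' k : {k // k ≠ p}, (((m k : ℂ) - s p) / (s k - s p)) := by
    intro p
    have h1 := tendsto_prod_filter_div hs hsum hT hM hM0 hm (s p) {k | k ≠ p}
      fun k hk h => hk (hs (by exact_mod_cast h.symm))
    have h2 : Tendsto (fun S => (x S p : ℂ) - s p) U (𝓝 ((m p : ℂ) - s p)) :=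
      ((Complex.continuous_ofReal.tendsto _).comp (hm p)).sub_const _
    refine tendsto_nhds_unique (tendsto_const_nhds.congr' ?_) (h2.mul h1)
    filter_upwards [hT p] with S hS
    rw [(hx S).residue p hS]
    congr 2
    ext k
    simp [and_comm]
  -- A limiting zero at `s p` would annihilate the residue formula at `p`, whereas `c p ≠ 0`.
  have hne : ∀ k p, m k ≠ s p := by
    intro k p h
    have h0 : (c p : ℂ) ≠ 0 := by
      rcases hc with hc | hc
      · exact_mod_cast (hc p).ne'
      · exact_mod_cast (hc p).ne
    apply h0
    rw [hres p]
    by_cases hkp : k = p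
    · subst hkp
      rw [h, sub_self, zero_mul]
    · rw [tprod_of_exists_eq_zero ⟨⟨k, hkp⟩, by simp [h]⟩, mul_zero]
  refine ⟨m, ?_, hne, ⟨M, hbd⟩, ?_, hres⟩
  -- Only weak inequalities pass to the limit; since no zero is a pole, the separating pole makes
  -- them strict.
  · have hlt : ∀ i j, s i < s j → m i < m j := by
      intro i j hij
      have h : ∀ᶠ S in (U : Filter (Finset ι)),
          (x S i ≤ s j ∧ s j ≤ x S j) ∨ (x S i ≤ s i ∧ s i ≤ x S j) := by
        filter_upwards [hT i, hT j] with S hi hj using (hx S).separated i hi j hj hij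
      rcases Ultrafilter.eventually_or.1 h with h | h
      · have h1 := le_of_tendsto (hm i) (h.mono fun _ h => h.1)
        have h2 := ge_of_tendsto (hm j) (h.mono fun _ h => h.2)
        exact (lt_of_le_of_ne h1 (hne _ _)).trans_le h2
      · have h1 := le_of_tendsto (hm i) (h.mono fun _ h => h.1)
        have h2 := ge_of_tendsto (hm j) (h.mono fun _ h => h.2)
        exact (lt_of_le_of_ne h1 (hne _ _)).trans_le h2
    intro i j hij
    by_contra h
    rcases lt_or_gt_of_ne fun h' => h (hs h') with h' | h'
    · exact (hlt i j h').ne hij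
    · exact (hlt j i h').ne' hij
  · intro z hz
    have h1 := tendsto_prod_filter_div hs hsum hT hM hM0 hm z Set.univ fun k _ => hz k
    rw [tprod_univ fun k => ((m k : ℂ) - z) / (s k - z)] at h1
    have hcz : Summable fun k => (c k : ℂ) / (s k - z) := by
      refine Summable.of_norm_bounded ((summable_norm_inv_sub hs hsum z).mul_left M) fun k => ?_
      rw [div_eq_mul_inv, norm_mul, Complex.norm_real]
      exact mul_le_mul_of_nonneg_right (hca.le_tsum k fun _ _ => abs_nonneg _) (norm_nonneg _)
    have h2 : Tendsto (fun S : Finset ι => 1 + ∑ k ∈ S, (c k : ℂ) / (s k - z)) U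
        (𝓝 (1 + ∑' k, (c k : ℂ) / (s k - z))) :=
      (Tendsto.mono_left hcz.hasSum hU).const_add 1
    refine tendsto_nhds_unique h2 (h1.congr fun S => ?_)
    rw [(hx S).eq_prod z fun i _ => hz i]
    simp

end SecularLimit

noncomputable section

namespace NonlocalPeriodic

/-! ### Integration by parts for absolutely continuous functions -/

/-- Integration by parts for two indefinite integrals. -/
theorem integral_mul_primitive_add {a b : ℝ → ℂ} {X : ℝ} (hX : 0 ≤ X)
    (ha : IntervalIntegrable a volume 0 X) (hb : IntervalIntegrable b volume 0 X) :
    (∫ x in (0 : ℝ)..X, a x * ∫ t in (0 : ℝ)..x, b t) +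
      (∫ x in (0 : ℝ)..X, (∫ t in (0 : ℝ)..x, a t) * b x) =
      (∫ x in (0 : ℝ)..X, a x) * ∫ x in (0 : ℝ)..X, b x := by
  -- By Fubini the two integrals are those of `a(x) b(t)` over the triangles `t ≤ x` and `x < t`,
  -- which together fill the square.
  rw [intervalIntegrable_iff_integrableOn_Ioc_of_le hX] at ha hb
  set μ := volume.restrict (Set.Ioc (0 : ℝ) X) with hμ
  have hprod : Integrable (fun p : ℝ × ℝ => a p.1 * b p.2) (μ.prod μ) := ha.mul_prod hb
  have hm1 : MeasurableSet {p : ℝ × ℝ | p.2 ≤ p.1} := measurableSet_le measurable_snd measurable_fst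
  have hm2 : MeasurableSet {p : ℝ × ℝ | p.1 < p.2} := measurableSet_lt measurable_fst measurable_snd
  have h1 : Integrable ({p : ℝ × ℝ | p.2 ≤ p.1}.indicator fun p => a p.1 * b p.2) (μ.prod μ) :=
    hprod.indicator hm1
  have h2 : Integrable ({p : ℝ × ℝ | p.1 < p.2}.indicator fun p => a p.1 * b p.2) (μ.prod μ) :=
    hprod.indicator hm2
  have e1 : (∫ x in (0 : ℝ)..X, a x * ∫ t in (0 : ℝ)..x, b t) =
      ∫ p, {p : ℝ × ℝ | p.2 ≤ p.1}.indicator (fun p => a p.1 * b p.2) p ∂(μ.prod μ) := by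
    rw [integral_prod _ h1, intervalIntegral.integral_of_le hX]
    refine setIntegral_congr_fun measurableSet_Ioc fun x hx => ?_
    rw [intervalIntegral.integral_of_le hx.1.le, ← integral_const_mul]
    have : ∀ t, {p : ℝ × ℝ | p.2 ≤ p.1}.indicator (fun p => a p.1 * b p.2) (x, t) =
        (Set.Iic x).indicator (fun t => a x * b t) t := by
      intro t
      simp [Set.indicator_apply]
    simp_rw [this]
    rw [integral_indicator measurableSet_Iic, hμ, Measure.restrict_restrict measurableSet_Iic]
    congr 2
    ext t
    simp only [Set.mem_Ioc, Set.mem_inter_iff, Set.mem_Iic]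
    constructor
    · exact fun h => ⟨h.2, h.1, h.2.trans hx.2⟩
    · exact fun h => ⟨h.2.1, h.1⟩
  have e2 : (∫ x in (0 : ℝ)..X, (∫ t in (0 : ℝ)..x, a t) * b x) =
      ∫ p, {p : ℝ × ℝ | p.1 < p.2}.indicator (fun p => a p.1 * b p.2) p ∂(μ.prod μ) := by
    rw [integral_prod_symm _ h2, intervalIntegral.integral_of_le hX]
    refine setIntegral_congr_fun measurableSet_Ioc fun x hx => ?_
    rw [intervalIntegral.integral_of_le hx.1.le, integral_Ioc_eq_integral_Ioo,
      ← integral_mul_const]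
    have : ∀ t, {p : ℝ × ℝ | p.1 < p.2}.indicator (fun p => a p.1 * b p.2) (t, x) =
        (Set.Iio x).indicator (fun t => a t * b x) t := by
      intro t
      simp [Set.indicator_apply]
    simp_rw [this]
    rw [integral_indicator measurableSet_Iio, hμ, Measure.restrict_restrict measurableSet_Iio]
    congr 2
    ext t
    simp only [Set.mem_Ioc, Set.mem_inter_iff, Set.mem_Iio, Set.mem_Ioo]
    constructor
    · exact fun h => ⟨h.2, h.1, h.2.le.trans hx.2⟩
    · exact fun h => ⟨h.2.1, h.1⟩
  rw [e1, e2, ← integral_add h1 h2, intervalIntegral.integral_of_le hX,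
    intervalIntegral.integral_of_le hX, ← integral_prod_mul]
  refine integral_congr_ae (Eventually.of_forall fun p => ?_)
  simp only [Set.indicator_apply, Set.mem_ofPred_eq]
  by_cases h : p.2 ≤ p.1
  · rw [if_pos h, if_neg (not_lt.2 h), add_zero]
  · rw [if_neg h, if_pos (not_le.1 h), zero_add]

theorem IntervalIntegrable.continuous_mul {e g : ℝ → ℂ} {X : ℝ} (he : Continuous e)
    (hg : IntervalIntegrable g volume 0 X) :
    IntervalIntegrable (fun x => e x * g x) volume 0 X :=
  hg.continuousOn_mul he.continuousOn

/-- The product of an indefinite integral and a continuously differentiable function is an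
indefinite integral. -/
theorem mul_eq_add_integral {e e' Y g : ℝ → ℂ} (he : ∀ x, HasDerivAt e (e' x) x)
    (he' : Continuous e') (hg : IntervalIntegrable g volume 0 Real.pi)
    (hY : ∀ x ∈ Set.Icc (0 : ℝ) Real.pi, Y x = Y 0 + ∫ t in (0 : ℝ)..x, g t) :
    ∀ x ∈ Set.Icc (0 : ℝ) Real.pi,
      e x * Y x = e 0 * Y 0 + ∫ t in (0 : ℝ)..x, (e' t * Y t + e t * g t) := by
  intro x hx
  have hgx := intervalIntegrable_of_mem hg hx
  have hcY := continuousOn_of_eq_integral hg hY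
  have hce : Continuous e := continuous_iff_continuousAt.2 fun x => (he x).continuousAt
  have hint : ∀ t, ∫ u in (0 : ℝ)..t, e' u = e t - e 0 := fun t =>
    intervalIntegral.integral_eq_sub_of_hasDerivAt (fun u _ => he u) (he'.intervalIntegrable _ _)
  have hY2 : IntervalIntegrable (fun t => e' t * Y t) volume 0 x := by
    refine ContinuousOn.intervalIntegrable ?_
    rw [Set.uIcc_of_le hx.1]
    exact he'.continuousOn.mul (hcY.mono (Set.Icc_subset_Icc le_rfl hx.2))
  have hp : IntervalIntegrable (fun t => e' t * ∫ u in (0 : ℝ)..t, g u) volume 0 x := by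
    refine ContinuousOn.intervalIntegrable ?_
    have := intervalIntegral.continuousOn_primitive_interval' hgx
      (Set.left_mem_uIcc (a := (0 : ℝ)) (b := x))
    exact he'.continuousOn.mul this
  have key := integral_mul_primitive_add hx.1 (he'.intervalIntegrable 0 x) hgx
  simp only [hint] at key
  have e1 : ∫ t in (0 : ℝ)..x, e' t * Y t =
      (e x - e 0) * Y 0 + ∫ t in (0 : ℝ)..x, e' t * ∫ u in (0 : ℝ)..t, g u := by
    rw [← hint x, ← intervalIntegral.integral_mul_const,
      ← intervalIntegral.integral_add ((he'.intervalIntegrable _ _).mul_const _) hp]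
    refine intervalIntegral.integral_congr fun t ht => ?_
    rw [Set.uIcc_of_le hx.1] at ht
    rw [hY t ⟨ht.1, ht.2.trans hx.2⟩]
    ring
  have e2 : ∫ t in (0 : ℝ)..x, (e t - e 0) * g t =
      (∫ t in (0 : ℝ)..x, e t * g t) - e 0 * ∫ t in (0 : ℝ)..x, g t := by
    rw [← intervalIntegral.integral_const_mul, ← intervalIntegral.integral_sub
      (IntervalIntegrable.continuous_mul hce hgx) (hgx.const_mul _)]
    refine intervalIntegral.integral_congr fun t _ => ?_
    ring
  rw [intervalIntegral.integral_add hY2 (IntervalIntegrable.continuous_mul hce hgx), hY x hx, e1]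
  rw [e2] at key
  linear_combination -key

theorem memLp_of_continuousOn {f : ℝ → ℂ} (hf : ContinuousOn f (Set.Icc (0 : ℝ) Real.pi)) :
    MemLp f 2 (volume.restrict (Set.Ioo (0 : ℝ) Real.pi)) := by
  obtain ⟨C, hC⟩ := (isCompact_Icc (a := (0 : ℝ)) (b := Real.pi)).exists_bound_of_continuousOn hf
  refine MemLp.of_bound ((hf.mono Set.Ioo_subset_Icc_self).aestronglyMeasurable measurableSet_Ioo)
    C ?_
  rw [ae_restrict_iff' measurableSet_Ioo]
  exact Eventually.of_forall fun x hx => hC x (Set.Ioo_subset_Icc_self hx)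

theorem integral_congr_Ioo {f g : ℝ → ℂ}
    (h : f =ᵐ[volume.restrict (Set.Ioo (0 : ℝ) Real.pi)] g) :
    ∫ x in (0 : ℝ)..Real.pi, f x = ∫ x in (0 : ℝ)..Real.pi, g x := by
  rw [intervalIntegral.integral_of_le Real.pi_pos.le, intervalIntegral.integral_of_le
    Real.pi_pos.le, integral_Ioc_eq_integral_Ioo, integral_Ioc_eq_integral_Ioo]
  exact integral_congr_ae h

theorem inner_eq_integral (f g : L2) :
    inner ℂ f g = ∫ x in (0 : ℝ)..Real.pi, (starRingEnd ℂ) (f x) * g x := by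
  rw [L2.inner_def, intervalIntegral.integral_of_le Real.pi_pos.le, integral_Ioc_eq_integral_Ioo]
  refine integral_congr_ae (Eventually.of_forall fun x => ?_)
  simp [RCLike.inner_apply, mul_comm]

/-! ### The Fourier basis of `L²(0, π)` -/

/-- The exponential `exp (2inx) / √π`. -/
def expFun (n : ℤ) (x : ℝ) : ℂ :=
  Complex.exp (2 * Complex.I * n * x) / (Real.sqrt Real.pi : ℂ)

theorem continuous_expFun (n : ℤ) : Continuous (expFun n) := by
  unfold expFun
  fun_prop

/-- The normalised exponential as an element of `L²(0, π)`. -/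
def expE (n : ℤ) : L2 := (memLp_of_continuous (continuous_expFun n)).toLp

theorem coeFn_expE (n : ℤ) : expE n =ᵐ[volume.restrict (Set.Ioo (0 : ℝ) Real.pi)] expFun n :=
  MemLp.coeFn_toLp _

theorem conj_expFun (n : ℤ) (x : ℝ) : (starRingEnd ℂ) (expFun n x) = expFun (-n) x := by
  unfold expFun
  rw [map_div₀, ← Complex.exp_conj, Complex.conj_ofReal]
  simp [Complex.conj_ofNat]

theorem inner_expE_left (n : ℤ) (f : L2) :
    inner ℂ (expE n) f = ∫ x in (0 : ℝ)..Real.pi, expFun (-n) x * f x := by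
  rw [inner_eq_integral]
  refine integral_congr_Ioo ?_
  filter_upwards [coeFn_expE n] with x hx
  rw [hx, conj_expFun]

theorem sqrt_pi_ne_zero : (Real.sqrt Real.pi : ℂ) ≠ 0 := by
  exact_mod_cast (Real.sqrt_pos.2 Real.pi_pos).ne'

theorem sqrt_pi_mul_self : (Real.sqrt Real.pi : ℂ) * Real.sqrt Real.pi = Real.pi := by
  exact_mod_cast Real.mul_self_sqrt Real.pi_pos.le

theorem pi_ne_zero' : (Real.pi : ℂ) ≠ 0 := by exact_mod_cast Real.pi_ne_zero

theorem exp_two_int_pi (n : ℤ) : Complex.exp (2 * Complex.I * n * Real.pi) = 1 := by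
  rw [Complex.exp_eq_one_iff]
  exact ⟨n, by ring⟩

theorem hasDerivAt_expFun (n : ℤ) (x : ℝ) :
    HasDerivAt (expFun n) (2 * Complex.I * n * expFun n x) x := by
  unfold expFun
  have h1 : HasDerivAt (fun x : ℝ => 2 * Complex.I * n * (x : ℂ)) (2 * Complex.I * n) x := by
    simpa using (Complex.ofRealCLM.hasDerivAt (x := x)).const_mul (2 * Complex.I * (n : ℂ))
  convert! (h1.cexp.div_const (Real.sqrt Real.pi : ℂ)) using 1
  ring

theorem expFun_zero_arg (n : ℤ) : expFun n 0 = 1 / (Real.sqrt Real.pi : ℂ) := by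
  simp [expFun]

theorem expFun_pi (n : ℤ) : expFun n Real.pi = 1 / (Real.sqrt Real.pi : ℂ) := by
  simp [expFun, exp_two_int_pi]

theorem integral_expFun (n : ℤ) (hn : n ≠ 0) : ∫ x in (0 : ℝ)..Real.pi, expFun n x = 0 := by
  have h : ∫ x in (0 : ℝ)..Real.pi, 2 * Complex.I * n * expFun n x = 0 := by
    rw [intervalIntegral.integral_eq_sub_of_hasDerivAt (fun x _ => hasDerivAt_expFun n x)
      ((continuous_const.mul (continuous_expFun n)).intervalIntegrable _ _), expFun_pi,
      expFun_zero_arg, sub_self]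
  rw [intervalIntegral.integral_const_mul] at h
  refine (mul_eq_zero.1 h).resolve_left ?_
  simp [hn]

theorem expFun_mul (m n : ℤ) (x : ℝ) :
    expFun m x * expFun n x = expFun (m + n) x / (Real.sqrt Real.pi : ℂ) := by
  unfold expFun
  rw [div_mul_div_comm, ← Complex.exp_add, div_div]
  congr 2
  push_cast
  ring

theorem orthonormal_expE : Orthonormal ℂ expE := by
  rw [orthonormal_iff_ite]
  intro m n
  rw [inner_expE_left]
  have : ∫ x in (0 : ℝ)..Real.pi, expFun (-m) x * expE n x =
      ∫ x in (0 : ℝ)..Real.pi, expFun (-m + n) x / (Real.sqrt Real.pi : ℂ) := by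
    refine integral_congr_Ioo ?_
    filter_upwards [coeFn_expE n] with x hx
    rw [hx, expFun_mul]
  rw [this, intervalIntegral.integral_div]
  split_ifs with h
  · subst h
    simp only [neg_add_cancel, expFun, Int.cast_zero, mul_zero, zero_mul, Complex.exp_zero,
      intervalIntegral.integral_const, sub_zero, Complex.real_smul]
    rw [mul_one_div, div_div, sqrt_pi_mul_self, div_self pi_ne_zero']
  · rw [integral_expFun _ (by omega), zero_div]

theorem memLp_Ioc (f : L2) : MemLp f 2 (volume.restrict (Set.Ioc (0 : ℝ) Real.pi)) := by
  rw [← Measure.restrict_congr_set Ioo_ae_eq_Ioc]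
  exact Lp.memLp f

/-- These inner products are Fourier coefficients on `[0, π]` up to a constant factor, so Parseval's
identity gives `∫ |f|² = 0`. -/
theorem eq_zero_of_inner_expE (f : L2) (h : ∀ n, inner ℂ (expE n) f = 0) : f = 0 := by
  have hco : ∀ n, fourierCoeffOn Real.pi_pos f n = 0 := by
    intro n
    rw [fourierCoeffOn_eq_integral]
    have h1 : ∫ x in (0 : ℝ)..Real.pi, (fourier (-n) (x : AddCircle (Real.pi - 0))) • f x =
        ∫ x in (0 : ℝ)..Real.pi, (Real.sqrt Real.pi : ℂ) * (expFun (-n) x * f x) := by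
      refine intervalIntegral.integral_congr fun x _ => ?_
      simp only [fourier_coe_apply, smul_eq_mul, expFun, sub_zero]
      have : 2 * (Real.pi : ℂ) * Complex.I * ((-n : ℤ) : ℂ) * x / Real.pi =
          2 * Complex.I * ((-n : ℤ) : ℂ) * x := by
        field_simp [pi_ne_zero']
      rw [this]
      field_simp [sqrt_pi_ne_zero]
    rw [h1, intervalIntegral.integral_const_mul, ← inner_expE_left, h n, mul_zero, smul_zero]
  have h2 := hasSum_sq_fourierCoeffOn Real.pi_pos (memLp_Ioc f)
  simp only [hco, norm_zero, ne_eq, OfNat.ofNat_ne_zero, not_false_eq_true, zero_pow] at h2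
  have h3 := h2.unique hasSum_zero
  rw [smul_eq_zero] at h3
  have h4 : ∫ x in (0 : ℝ)..Real.pi, ‖f x‖ ^ 2 = 0 :=
    h3.resolve_left (by simp [Real.pi_ne_zero])
  have h5 : inner ℂ f f = 0 := by
    rw [inner_eq_integral]
    have : ∀ x, (starRingEnd ℂ) (f x) * f x = ((‖f x‖ ^ 2 : ℝ) : ℂ) := by
      intro x
      rw [mul_comm, Complex.mul_conj, Complex.normSq_eq_norm_sq]
    simp_rw [this]
    rw [intervalIntegral.integral_ofReal, h4, Complex.ofReal_zero]
  exact inner_self_eq_zero.1 h5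

/-- The exponentials form a Hilbert basis of `L²(0, π)`. -/
def expBasis : HilbertBasis ℤ ℂ L2 :=
  HilbertBasis.mkOfOrthogonalEqBot orthonormal_expE (by
    rw [Submodule.eq_bot_iff]
    intro f hf
    refine eq_zero_of_inner_expE f fun n => ?_
    exact (Submodule.mem_orthogonal _ _).1 hf _ (Submodule.subset_span ⟨n, rfl⟩))

theorem expBasis_apply (n : ℤ) : expBasis n = expE n := by
  rw [expBasis, HilbertBasis.coe_mkOfOrthogonalEqBot]

theorem ext_inner_expE {f g : L2} (h : ∀ n, inner ℂ (expE n) f = inner ℂ (expE n) g) : f = g := by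
  rw [← sub_eq_zero]
  refine eq_zero_of_inner_expE _ fun n => ?_
  rw [inner_sub_right, h n, sub_self]

/-! ### `L0` in Fourier coordinates -/

theorem integral_expFun_mul_deriv {Y g : ℝ → ℂ} (hg : IntervalIntegrable g volume 0 Real.pi)
    (hY : ∀ x ∈ Set.Icc (0 : ℝ) Real.pi, Y x = Y 0 + ∫ t in (0 : ℝ)..x, g t)
    (hper : Y 0 = Y Real.pi) (n : ℤ) :
    ∫ x in (0 : ℝ)..Real.pi, expFun n x * g x =
      -(2 * Complex.I * n) * ∫ x in (0 : ℝ)..Real.pi, expFun n x * Y x := by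
  have h := mul_eq_add_integral (hasDerivAt_expFun n)
    (continuous_const.mul (continuous_expFun n)) hg hY Real.pi ⟨Real.pi_pos.le, le_rfl⟩
  have hcY := continuousOn_of_eq_integral hg hY
  rw [expFun_pi, expFun_zero_arg, hper, left_eq_add, intervalIntegral.integral_add] at h
  · simp only [mul_assoc] at h
    simp only [intervalIntegral.integral_const_mul] at h
    linear_combination h
  · refine ContinuousOn.intervalIntegrable ?_
    rw [Set.uIcc_of_le Real.pi_pos.le]
    exact (continuous_const.mul (continuous_expFun n)).continuousOn.mul hcY
  · exact IntervalIntegrable.continuous_mul (continuous_expFun n) hg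

theorem inner_expE_of_hasPeriodicSecondDeriv {f h : L2} (H : HasPeriodicSecondDeriv f h) (n : ℤ) :
    inner ℂ (expE n) h = -(4 * (n : ℂ) ^ 2) * inner ℂ (expE n) f := by
  obtain ⟨y, y', hfy, hy, hy', hp, hp'⟩ := H
  have iy' : IntervalIntegrable y' volume 0 Real.pi :=
    ((continuousOn_of_eq_integral (intervalIntegrable_coe _) hy').mono
      (by rw [Set.uIcc_of_le Real.pi_pos.le])).intervalIntegrable
  have h1 := integral_expFun_mul_deriv (intervalIntegrable_coe h) hy' hp' (-n)
  have h2 := integral_expFun_mul_deriv iy' hy hp (-n)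
  have h3 : inner ℂ (expE n) f = ∫ x in (0 : ℝ)..Real.pi, expFun (-n) x * y x := by
    rw [inner_expE_left]
    refine integral_congr_Ioo ?_
    filter_upwards [hfy] with x hx
    rw [hx]
  rw [inner_expE_left, h1, h2, h3]
  push_cast
  linear_combination (4 * (n : ℂ) ^ 2 * ∫ x in (0 : ℝ)..Real.pi, expFun (-n) x * y x) *
    Complex.I_mul_I

theorem expFun_zero (x : ℝ) : expFun 0 x = 1 / (Real.sqrt Real.pi : ℂ) := by
  simp [expFun]

/-- Integrating `h` twice, with suitable constants, produces a periodic function with the Fourier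
coefficients of `f`: the nonzero modes agree because `-4n²` can be cancelled, and the zero mode is
adjusted by hand. -/
theorem hasPeriodicSecondDeriv_of_inner_expE {f h : L2}
    (H : ∀ n : ℤ, inner ℂ (expE n) h = -(4 * (n : ℂ) ^ 2) * inner ℂ (expE n) f) :
    HasPeriodicSecondDeriv f h := by
  have hπ := Real.pi_pos.le
  have hpimem : Real.pi ∈ Set.Icc (0 : ℝ) Real.pi := ⟨hπ, le_rfl⟩
  have hh0 : ∫ x in (0 : ℝ)..Real.pi, h x = 0 := by
    have := H 0
    rw [inner_expE_left] at this
    simp only [neg_zero, expFun_zero, intervalIntegral.integral_const_mul, Int.cast_zero, ne_eq,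
      OfNat.ofNat_ne_zero, not_false_eq_true, zero_pow, mul_zero, zero_mul] at this
    exact (mul_eq_zero.1 this).resolve_left (one_div_ne_zero sqrt_pi_ne_zero)
  set Y1 : ℝ → ℂ := fun x => ∫ t in (0 : ℝ)..x, h t with hY1
  have cY1 : ContinuousOn Y1 (Set.Icc (0 : ℝ) Real.pi) :=
    continuousOn_of_eq_integral (intervalIntegrable_coe h) fun x _ => by simp [hY1]
  have iY1 : IntervalIntegrable Y1 volume 0 Real.pi :=
    (cY1.mono (by rw [Set.uIcc_of_le hπ])).intervalIntegrable
  -- This constant gives `y'` mean zero, which is the condition `y(0) = y(π)`. The condition on `y'`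
  -- is the vanishing mean `hh0` of `h`.
  set c : ℂ := -(∫ x in (0 : ℝ)..Real.pi, Y1 x) / Real.pi with hc
  set y' : ℝ → ℂ := fun x => c + Y1 x with hy'
  have iy' : IntervalIntegrable y' volume 0 Real.pi := intervalIntegrable_const.add iY1
  have hint : ∫ x in (0 : ℝ)..Real.pi, y' x = 0 := by
    rw [hy', intervalIntegral.integral_add intervalIntegrable_const iY1,
      intervalIntegral.integral_const, hc]
    simp only [sub_zero, Complex.real_smul]
    field_simp [pi_ne_zero']
    ring
  set Y0 : ℝ → ℂ := fun x => ∫ t in (0 : ℝ)..x, y' t with hY0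
  have cY0 : ContinuousOn Y0 (Set.Icc (0 : ℝ) Real.pi) :=
    continuousOn_of_eq_integral iy' fun x _ => by simp [hY0]
  have iY0 : IntervalIntegrable Y0 volume 0 Real.pi :=
    (cY0.mono (by rw [Set.uIcc_of_le hπ])).intervalIntegrable
  -- The second constant matches the mean of `y` with that of `f`.
  set d : ℂ := ((∫ x in (0 : ℝ)..Real.pi, f x) - ∫ x in (0 : ℝ)..Real.pi, Y0 x) / Real.pi with hd
  set y : ℝ → ℂ := fun x => d + Y0 x with hy
  have cy : ContinuousOn y (Set.Icc (0 : ℝ) Real.pi) := continuousOn_const.add cY0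
  set g : L2 := (memLp_of_continuousOn cy).toLp with hg
  have hgy : g =ᵐ[volume.restrict (Set.Ioo (0 : ℝ) Real.pi)] y := MemLp.coeFn_toLp _
  have hG : HasPeriodicSecondDeriv g h := by
    refine ⟨y, y', hgy, fun x _ => ?_, fun x _ => ?_, ?_, ?_⟩
    · simp [hy, hY0]
    · simp [hy', hY1]
    · simp [hy, hY0, hint]
    · simp [hy', hY1, hh0]
  have hfg : f = g := by
    refine ext_inner_expE fun n => ?_
    by_cases hn : n = 0
    · subst hn
      have e : ∫ x in (0 : ℝ)..Real.pi, g x = ∫ x in (0 : ℝ)..Real.pi, f x := by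
        rw [integral_congr_Ioo hgy, hy,
          intervalIntegral.integral_add intervalIntegrable_const iY0,
          intervalIntegral.integral_const, hd]
        simp only [sub_zero, Complex.real_smul]
        field_simp [pi_ne_zero']
        ring
      rw [inner_expE_left, inner_expE_left]
      simp only [neg_zero, expFun_zero, intervalIntegral.integral_const_mul, e]
    · have h1 := H n
      rw [inner_expE_of_hasPeriodicSecondDeriv hG n] at h1
      have : -(4 * (n : ℂ) ^ 2) ≠ 0 := by simp [hn]
      exact (mul_left_cancel₀ this h1).symm
  rw [hfg]
  exact hG

theorem mem_graphL0_iff (f h : L2) : (f, h) ∈ graphL0 ↔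
    ∀ n : ℤ, inner ℂ (expE n) h = 4 * (n : ℂ) ^ 2 * inner ℂ (expE n) f := by
  change HasPeriodicSecondDeriv f (-h) ↔ _
  constructor
  · intro H n
    have := inner_expE_of_hasPeriodicSecondDeriv H n
    rw [inner_neg_right] at this
    linear_combination -this
  · intro H
    refine hasPeriodicSecondDeriv_of_inner_expE fun n => ?_
    rw [inner_neg_right, H n, neg_mul]

theorem exists_L0_eq_iff (f h : L2) :
    (∃ hf : f ∈ L0.domain, L0 ⟨f, hf⟩ = h) ↔ (f, h) ∈ graphL0 := by
  rw [← L0_graph, LinearPMap.mem_graph_iff]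
  constructor
  · rintro ⟨hf, e⟩
    exact ⟨⟨f, hf⟩, rfl, e⟩
  · rintro ⟨⟨y, hy⟩, e1, e2⟩
    simp only at e1 e2
    subst e1
    exact ⟨hy, e2⟩

theorem mem_eigenspace_opL_iff (α : ℝ) (v : L2) (z : ℂ) (f : L2) :
    f ∈ eigenspace (opL α v) z ↔ ∀ n : ℤ, (4 * (n : ℂ) ^ 2 - z) * inner ℂ (expE n) f +
      α * inner ℂ v f * inner ℂ (expE n) v = 0 := by
  have h1 : f ∈ eigenspace (opL α v) z ↔ ∃ hf : f ∈ L0.domain,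
      L0 ⟨f, hf⟩ = z • f - (α : ℂ) • (inner ℂ v f • v) := by
    refine exists_congr fun hf => ?_
    rw [opL_apply, eq_sub_iff_add_eq, add_comm]
    rfl
  rw [h1, exists_L0_eq_iff, mem_graphL0_iff]
  refine forall_congr' fun n => ?_
  rw [inner_sub_right, inner_smul_right, inner_smul_right, inner_smul_right]
  constructor
  · intro h
    linear_combination -h
  · intro h
    linear_combination -h

theorem mem_eigenspace_L0_iff (z : ℂ) (f : L2) :
    f ∈ eigenspace L0 z ↔ ∀ n : ℤ, (4 * (n : ℂ) ^ 2 - z) * inner ℂ (expE n) f = 0 := by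
  have h1 : f ∈ eigenspace L0 z ↔ ∃ hf : f ∈ L0.domain, L0 ⟨f, hf⟩ = z • f := Iff.rfl
  rw [h1, exists_L0_eq_iff, mem_graphL0_iff]
  refine forall_congr' fun n => ?_
  rw [inner_smul_right, sub_mul, sub_eq_zero, eq_comm]

/-- A bounded sequence acts as a multiplier on `ℓ²`, and the Fourier isometry transports it to
`L²(0, π)`. -/
theorem exists_diagonal (a : ℤ → ℂ) {C : ℝ} (ha : ∀ n, ‖a n‖ ≤ C) :
    ∃ R : L2 →L[ℂ] L2, ∀ f n, inner ℂ (expE n) (R f) = a n * inner ℂ (expE n) f := by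
  have hC : 0 ≤ C := (norm_nonneg _).trans (ha 0)
  have hle : ∀ (u : lp (fun _ : ℤ => ℂ) 2) n, ‖a n * u n‖ ≤ ‖((C : ℂ) • u) n‖ := by
    intro u n
    rw [lp.coeFn_smul, Pi.smul_apply, norm_mul, norm_smul, Complex.norm_real, Real.norm_eq_abs,
      abs_of_nonneg hC]
    exact mul_le_mul_of_nonneg_right (ha n) (norm_nonneg _)
  have hmem : ∀ u : lp (fun _ : ℤ => ℂ) 2, Memℓp (fun n => a n * u n) 2 := fun u =>
    (lp.memℓp ((C : ℂ) • u)).mono' (hle u)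
  let D : lp (fun _ : ℤ => ℂ) 2 →ₗ[ℂ] lp (fun _ : ℤ => ℂ) 2 :=
    { toFun := fun u => ⟨fun n => a n * u n, hmem u⟩
      map_add' := fun u w => by
        ext n
        exact mul_add (a n) (u n) (w n)
      map_smul' := fun c u => by
        ext n
        simp [mul_left_comm] }
  have hD : ∀ u n, D u n = a n * u n := fun _ _ => rfl
  let D' : lp (fun _ : ℤ => ℂ) 2 →L[ℂ] lp (fun _ : ℤ => ℂ) 2 :=
    D.mkContinuous C fun u => by
      have h1 : ‖D u‖ ≤ ‖(C : ℂ) • u‖ := lp.norm_mono (by norm_num) (hle u)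
      rwa [norm_smul, Complex.norm_real, Real.norm_eq_abs, abs_of_nonneg hC] at h1
  refine ⟨(expBasis.repr.symm.toContinuousLinearEquiv : _ →L[ℂ] L2) ∘L D' ∘L
    (expBasis.repr.toContinuousLinearEquiv : L2 →L[ℂ] _), fun f n => ?_⟩
  rw [← expBasis_apply, ← expBasis.repr_apply_apply, ← expBasis.repr_apply_apply, ← hD]
  simp [D']

/-! ### Eigenvalues, multiplicities and spectrum of `L0` -/

theorem z0_eq_ofReal (k : ℕ) : z0 k = ((4 * (k : ℝ) ^ 2 : ℝ) : ℂ) := by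
  simp [z0]

theorem z0_natAbs (n : ℤ) : z0 n.natAbs = 4 * (n : ℂ) ^ 2 := by
  rw [z0]
  have h : ((n.natAbs : ℤ) : ℂ) ^ 2 = (n : ℂ) ^ 2 := by exact_mod_cast Int.natAbs_sq n
  rw [← h, Int.cast_natCast]

theorem four_sq_injective : Function.Injective fun k : ℕ => 4 * (k : ℝ) ^ 2 := by
  intro i j h
  simp only [mul_eq_mul_left_iff, OfNat.ofNat_ne_zero, or_false] at h
  rw [sq_eq_sq₀ (Nat.cast_nonneg _) (Nat.cast_nonneg _)] at h
  exact_mod_cast h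

theorem z0_injective : Function.Injective z0 := by
  intro i j h
  rw [z0_eq_ofReal, z0_eq_ofReal, Complex.ofReal_inj] at h
  exact four_sq_injective h

theorem summable_inv_four_sq : Summable fun k : ℕ => |4 * (k : ℝ) ^ 2|⁻¹ := by
  have h : Summable fun k : ℕ => (1 / 4 : ℝ) * ((k : ℝ) ^ 2)⁻¹ :=
    (Real.summable_nat_pow_inv.2 one_lt_two).mul_left _
  refine h.congr fun k => ?_
  rw [abs_of_nonneg (by positivity), mul_inv]
  norm_num

theorem summable_norm_inv_z0_sub (z : ℂ) : Summable fun k : ℕ => ‖(z0 k - z)⁻¹‖ := by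
  have := summable_norm_inv_sub four_sq_injective summable_inv_four_sq z
  simpa only [← z0_eq_ofReal] using this

theorem norm_inv_z0_sub_le (z : ℂ) (k : ℕ) :
    ‖(z0 k - z)⁻¹‖ ≤ ∑' k : ℕ, ‖(z0 k - z)⁻¹‖ :=
  (summable_norm_inv_z0_sub z).le_tsum k fun _ _ => norm_nonneg _

/-- The reduced resolvent of `L₀`: the inverse of `L₀ - z` off the eigenspace of `z`. -/
theorem exists_reducedResolvent (z : ℂ) : ∃ R : L2 →L[ℂ] L2, ∀ f (n : ℤ),
    inner ℂ (expE n) (R f) = (4 * (n : ℂ) ^ 2 - z)⁻¹ * inner ℂ (expE n) f :=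
  exists_diagonal _ fun n => by
    rw [← z0_natAbs]
    exact norm_inv_z0_sub_le z n.natAbs

theorem mem_spec_of_mult_ne_zero {T : L2 →ₗ.[ℂ] L2} {z : ℂ} (h : mult T z ≠ 0) : z ∈ spec T := by
  rintro ⟨R, -, hR⟩
  apply h
  have : eigenspace T z = ⊥ := by
    rw [Submodule.eq_bot_iff]
    rintro f ⟨hf, e⟩
    have := hR ⟨f, hf⟩
    rw [e, sub_self, map_zero] at this
    exact this.symm
  rw [mult, this, finrank_bot]

theorem inner_expE_expE (m n : ℤ) : inner ℂ (expE m) (expE n) = if m = n then (1 : ℂ) else 0 :=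
  orthonormal_iff_ite.1 orthonormal_expE m n

theorem expE_mem_eigenspace {n : ℤ} {z : ℂ} (h : 4 * (n : ℂ) ^ 2 = z) :
    expE n ∈ eigenspace L0 z := by
  rw [mem_eigenspace_L0_iff]
  intro m
  rw [inner_expE_expE]
  split_ifs with hmn
  · rw [hmn, h, sub_self, zero_mul]
  · rw [mul_zero]

/-- As a finset, `{k, -k}` collapses to one element for `k = 0`, so the same description covers the
simple eigenvalue 0 and the double ones. -/
theorem four_sq_eq_z0_iff (n : ℤ) (k : ℕ) :
    4 * (n : ℂ) ^ 2 = z0 k ↔ n ∈ ({(k : ℤ), -(k : ℤ)} : Finset ℤ) := by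
  rw [← z0_natAbs, z0_injective.eq_iff]
  simp only [Finset.mem_insert, Finset.mem_singleton]
  omega

theorem eigenspace_L0_z0 (k : ℕ) : eigenspace L0 (z0 k) =
    Submodule.span ℂ (Set.range fun n : ({(k : ℤ), -(k : ℤ)} : Finset ℤ) => expE n) := by
  apply le_antisymm
  · intro f hf
    rw [mem_eigenspace_L0_iff] at hf
    have hsum : f = ∑ n ∈ ({(k : ℤ), -(k : ℤ)} : Finset ℤ), inner ℂ (expE n) f • expE n := by
      refine ext_inner_expE fun m => ?_
      rw [inner_sum]
      simp only [inner_smul_right, inner_expE_expE, mul_ite, mul_one, mul_zero]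
      rw [Finset.sum_ite_eq]
      split_ifs with hm
      · rfl
      · refine (mul_eq_zero.1 (hf m)).resolve_left (sub_ne_zero.2 ?_)
        rwa [Ne, four_sq_eq_z0_iff]
    rw [hsum]
    exact Submodule.sum_mem _ fun n hn => Submodule.smul_mem _ _ (Submodule.subset_span ⟨⟨n, hn⟩, rfl⟩)
  · rw [Submodule.span_le]
    rintro _ ⟨⟨n, hn⟩, rfl⟩
    exact expE_mem_eigenspace ((four_sq_eq_z0_iff n k).2 hn)

theorem mult_L0_z0 (k : ℕ) : mult L0 (z0 k) = if k = 0 then 1 else 2 := by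
  rw [mult, eigenspace_L0_z0, finrank_span_eq_card]
  · rw [Fintype.card_coe]
    split_ifs with h
    · subst h; rfl
    · rw [Finset.card_pair]
      omega
  · exact orthonormal_expE.linearIndependent.comp _ Subtype.val_injective

theorem eigenspace_L0_eq_bot {z : ℂ} (hz : ∀ k, z ≠ z0 k) : eigenspace L0 z = ⊥ := by
  rw [Submodule.eq_bot_iff]
  intro f hf
  rw [mem_eigenspace_L0_iff] at hf
  refine eq_zero_of_inner_expE f fun n => (mul_eq_zero.1 (hf n)).resolve_left ?_
  rw [← z0_natAbs]
  exact sub_ne_zero.2 (hz _).symm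

theorem mult_L0_eq_zero {z : ℂ} (hz : ∀ k, z ≠ z0 k) : mult L0 z = 0 := by
  rw [mult, eigenspace_L0_eq_bot hz, finrank_bot]

instance finiteDimensional_eigenspace_L0 (z : ℂ) : FiniteDimensional ℂ (eigenspace L0 z) := by
  by_cases hz : ∃ k, z = z0 k
  · obtain ⟨k, rfl⟩ := hz
    rw [eigenspace_L0_z0]
    exact FiniteDimensional.span_of_finite ℂ (Set.finite_range _)
  · rw [eigenspace_L0_eq_bot (not_exists.1 hz)]
    infer_instance

theorem spec_L0 : spec L0 = Set.range z0 := by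
  apply Set.Subset.antisymm
  · intro z hz
    by_contra hne
    apply hz
    have hne' : ∀ n : ℤ, 4 * (n : ℂ) ^ 2 - z ≠ 0 := fun n h =>
      hne ⟨n.natAbs, by rw [z0_natAbs]; exact sub_eq_zero.1 h⟩
    obtain ⟨R, hR⟩ := exists_reducedResolvent z
    refine ⟨R, fun f => ?_, fun y => ?_⟩
    · have hg : (R f, f + z • R f) ∈ graphL0 := by
        rw [mem_graphL0_iff]
        intro n
        rw [inner_add_right, inner_smul_right, hR]
        field_simp [hne' n]
        ring
      obtain ⟨hd, e⟩ := (exists_L0_eq_iff _ _).2 hg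
      exact ⟨hd, by rw [e, add_sub_cancel_right]⟩
    · have hy := (mem_graphL0_iff _ _).1 ((exists_L0_eq_iff (y : L2) (L0 y)).1 ⟨y.2, rfl⟩)
      refine ext_inner_expE fun n => ?_
      rw [hR, inner_sub_right, inner_smul_right, hy n]
      field_simp [hne' n]
  · rintro _ ⟨k, rfl⟩
    refine mem_spec_of_mult_ne_zero ?_
    rw [mult_L0_z0]
    split_ifs <;> norm_num

/-! ### The projections onto `G k` and the function `Q` -/

theorem cos_eq_exp (x : ℝ) (k : ℕ) : ((Real.cos (2 * k * x) : ℝ) : ℂ) =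
    (Real.sqrt Real.pi : ℂ) / 2 * expFun k x + (Real.sqrt Real.pi : ℂ) / 2 * expFun (-k) x := by
  have e : ∀ a b : ℂ, (Real.sqrt Real.pi : ℂ) / 2 * (a / (Real.sqrt Real.pi : ℂ)) +
      (Real.sqrt Real.pi : ℂ) / 2 * (b / (Real.sqrt Real.pi : ℂ)) = (a + b) / 2 := by
    intro a b
    field_simp [sqrt_pi_ne_zero]
  rw [expFun, expFun, e, Complex.ofReal_cos, Complex.cos]
  push_cast
  congr 3 <;> ring_nf

theorem sin_eq_exp (x : ℝ) (k : ℕ) : ((Real.sin (2 * k * x) : ℝ) : ℂ) =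
    -(Real.sqrt Real.pi * Complex.I : ℂ) / 2 * expFun k x +
      (Real.sqrt Real.pi * Complex.I : ℂ) / 2 * expFun (-k) x := by
  have e : ∀ a b : ℂ, -(Real.sqrt Real.pi * Complex.I : ℂ) / 2 * (a / (Real.sqrt Real.pi : ℂ)) +
      (Real.sqrt Real.pi * Complex.I : ℂ) / 2 * (b / (Real.sqrt Real.pi : ℂ)) =
      (b - a) * Complex.I / 2 := by
    intro a b
    field_simp [sqrt_pi_ne_zero]
    ring
  rw [expFun, expFun, e, Complex.ofReal_sin, Complex.sin]
  push_cast
  congr 4 <;> ring_nf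

theorem toLp_eq_add_smul {f : ℝ → ℂ} (hf : Continuous f) {a b : ℂ} {m n : ℤ}
    (h : ∀ x, f x = a * expFun m x + b * expFun n x) :
    (memLp_of_continuous hf).toLp = a • expE m + b • expE n := by
  refine Lp.ext ?_
  filter_upwards [MemLp.coeFn_toLp (memLp_of_continuous hf), coeFn_expE m, coeFn_expE n,
    Lp.coeFn_add (a • expE m) (b • expE n), Lp.coeFn_smul a (expE m),
    Lp.coeFn_smul b (expE n)] with x h1 h2 h3 h4 h5 h6
  rw [h1, h4, Pi.add_apply, h5, h6, Pi.smul_apply, Pi.smul_apply, h2, h3, h, smul_eq_mul,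
    smul_eq_mul]

theorem cosE_eq (k : ℕ) : cosE k =
    ((Real.sqrt Real.pi : ℂ) / 2) • expE k + ((Real.sqrt Real.pi : ℂ) / 2) • expE (-k) :=
  toLp_eq_add_smul (by fun_prop) fun x => cos_eq_exp x k

theorem sinE_eq (k : ℕ) : sinE k = (-(Real.sqrt Real.pi * Complex.I : ℂ) / 2) • expE k +
    ((Real.sqrt Real.pi * Complex.I : ℂ) / 2) • expE (-k) :=
  toLp_eq_add_smul (by fun_prop) fun x => sin_eq_exp x k

theorem expE_mem_G {k : ℕ} {n : ℤ} (hn : n ∈ ({(k : ℤ), -(k : ℤ)} : Finset ℤ)) :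
    expE n ∈ G k := by
  have hc : cosE k ∈ G k := Submodule.subset_span (by simp)
  have hs : sinE k ∈ G k := Submodule.subset_span (by simp)
  simp only [Finset.mem_insert, Finset.mem_singleton] at hn
  have hI := Complex.I_ne_zero
  rcases hn with rfl | rfl
  · have : expE k = ((Real.sqrt Real.pi : ℂ)⁻¹) • cosE k +
        (Complex.I * (Real.sqrt Real.pi : ℂ)⁻¹) • sinE k := by
      rw [cosE_eq, sinE_eq]
      simp only [smul_add, smul_smul]
      have h1 : (Real.sqrt Real.pi : ℂ)⁻¹ * ((Real.sqrt Real.pi : ℂ) / 2) = 1 / 2 := by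
        field_simp [sqrt_pi_ne_zero]
      have h2 : Complex.I * (Real.sqrt Real.pi : ℂ)⁻¹ *
          (-(Real.sqrt Real.pi * Complex.I : ℂ) / 2) = 1 / 2 := by
        field_simp [sqrt_pi_ne_zero]
        simp
      have h3 : Complex.I * (Real.sqrt Real.pi : ℂ)⁻¹ *
          ((Real.sqrt Real.pi * Complex.I : ℂ) / 2) = -(1 / 2) := by
        field_simp [sqrt_pi_ne_zero]
        simp
      rw [h1, h2, h3]
      module
    rw [this]
    exact (G k).add_mem ((G k).smul_mem _ hc) ((G k).smul_mem _ hs)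
  · have : expE (-k) = ((Real.sqrt Real.pi : ℂ)⁻¹) • cosE k -
        (Complex.I * (Real.sqrt Real.pi : ℂ)⁻¹) • sinE k := by
      rw [cosE_eq, sinE_eq]
      simp only [smul_add, smul_smul]
      have h1 : (Real.sqrt Real.pi : ℂ)⁻¹ * ((Real.sqrt Real.pi : ℂ) / 2) = 1 / 2 := by
        field_simp [sqrt_pi_ne_zero]
      have h2 : Complex.I * (Real.sqrt Real.pi : ℂ)⁻¹ *
          (-(Real.sqrt Real.pi * Complex.I : ℂ) / 2) = 1 / 2 := by
        field_simp [sqrt_pi_ne_zero]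
        simp
      have h3 : Complex.I * (Real.sqrt Real.pi : ℂ)⁻¹ *
          ((Real.sqrt Real.pi * Complex.I : ℂ) / 2) = -(1 / 2) := by
        field_simp [sqrt_pi_ne_zero]
        simp
      rw [h1, h2, h3]
      module
    rw [this]
    exact (G k).sub_mem ((G k).smul_mem _ hc) ((G k).smul_mem _ hs)

theorem inner_expE_sum (s : Finset ℤ) (a : ℤ → ℂ) (m : ℤ) :
    inner ℂ (expE m) (∑ n ∈ s, a n • expE n) = if m ∈ s then a m else 0 := by
  rw [inner_sum]
  simp only [inner_smul_right, inner_expE_expE, mul_ite, mul_one, mul_zero]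
  rw [Finset.sum_ite_eq]

theorem proj_eq_sum (k : ℕ) (v : L2) : proj k v =
    ∑ n ∈ ({(k : ℤ), -(k : ℤ)} : Finset ℤ), inner ℂ (expE n) v • expE n := by
  set s : Finset ℤ := {(k : ℤ), -(k : ℤ)} with hs
  refine Submodule.eq_starProjection_of_mem_of_inner_eq_zero ?_ ?_
  · exact Submodule.sum_mem _ fun n hn => Submodule.smul_mem _ _ (expE_mem_G hn)
  · intro w hw
    rw [← inner_conj_symm, map_eq_zero]
    have hz : ∀ m ∈ s, inner ℂ (expE m) (v - ∑ n ∈ s, inner ℂ (expE n) v • expE n) = 0 := by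
      intro m hm
      rw [inner_sub_right, inner_expE_sum, if_pos hm, sub_self]
    have h1 := hz k (by simp [hs])
    have h2 := hz (-k) (by simp [hs])
    refine Submodule.span_induction ?_ (by simp) ?_ ?_ hw
    · rintro x (rfl | rfl)
      · rw [cosE_eq, inner_add_left, inner_smul_left, inner_smul_left, h1, h2]
        simp
      · rw [sinE_eq, inner_add_left, inner_smul_left, inner_smul_left, h1, h2]
        simp
    · intro x y _ _ hx hy
      rw [inner_add_left, hx, hy, add_zero]
    · intro a x _ hx
      rw [inner_smul_left, hx, mul_zero]

theorem inner_mul_inner_expE (v : L2) (n : ℤ) :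
    inner ℂ v (expE n) * inner ℂ (expE n) v = ((‖inner ℂ (expE n) v‖ ^ 2 : ℝ) : ℂ) := by
  rw [← inner_conj_symm, mul_comm, Complex.mul_conj, Complex.normSq_eq_norm_sq]

theorem norm_proj_sq (k : ℕ) (v : L2) : ‖proj k v‖ ^ 2 =
    ∑ n ∈ ({(k : ℤ), -(k : ℤ)} : Finset ℤ), ‖inner ℂ (expE n) v‖ ^ 2 := by
  have h : inner ℂ (proj k v) (proj k v) = ((∑ n ∈ ({(k : ℤ), -(k : ℤ)} : Finset ℤ),
      ‖inner ℂ (expE n) v‖ ^ 2 : ℝ) : ℂ) := by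
    nth_rewrite 1 [proj_eq_sum]
    rw [sum_inner, Complex.ofReal_sum]
    refine Finset.sum_congr rfl fun n hn => ?_
    rw [inner_smul_left, proj_eq_sum, inner_expE_sum, if_pos hn, inner_conj_symm,
      inner_mul_inner_expE]
  have h2 : ((‖proj k v‖ ^ 2 : ℝ) : ℂ) = inner ℂ (proj k v) (proj k v) := by
    rw [inner_self_eq_norm_sq_to_K, Complex.ofReal_pow]
    rfl
  exact Complex.ofReal_injective (h2.trans h)

theorem norm_proj_sq_ne_zero_iff (k : ℕ) (v : L2) : ‖proj k v‖ ^ 2 ≠ 0 ↔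
    ∃ n : ℤ, 4 * (n : ℂ) ^ 2 = z0 k ∧ inner ℂ (expE n) v ≠ 0 := by
  rw [norm_proj_sq, Ne, Finset.sum_eq_zero_iff_of_nonneg fun _ _ => by positivity]
  push Not
  refine exists_congr fun n => ?_
  rw [four_sq_eq_z0_iff]
  simp

/-- Folds a sum over all modes into one over eigenvalues, by grouping `n` with `-n`. -/
theorem hasSum_norm_proj_sq_mul {v : L2} {φ : ℕ → ℂ} {a : ℂ}
    (h : HasSum (fun n : ℤ => ((‖inner ℂ (expE n) v‖ ^ 2 : ℝ) : ℂ) * φ n.natAbs) a) :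
    HasSum (fun k : ℕ => ((‖proj k v‖ ^ 2 : ℝ) : ℂ) * φ k) a := by
  -- Pairing `n` with `-n` counts the mode 0 twice; one copy is subtracted.
  have h1 := h.nat_add_neg.sub (hasSum_ite_eq 0 (((‖inner ℂ (expE 0) v‖ ^ 2 : ℝ) : ℂ) * φ 0))
  simp only [Int.natAbs_zero, add_sub_cancel_right] at h1
  refine h1.congr_fun fun k => ?_
  rw [norm_proj_sq]
  split_ifs with hk
  · subst hk
    simp
  · rw [Finset.sum_pair (by omega)]
    simp only [Int.natAbs_natCast, Int.natAbs_neg]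
    push_cast
    ring

theorem summable_norm_proj_sq (v : L2) : Summable fun k : ℕ => ‖proj k v‖ ^ 2 := by
  have h := expBasis.hasSum_inner_mul_inner v v
  simp only [expBasis_apply, inner_mul_inner_expE] at h
  have h1 := (hasSum_norm_proj_sq_mul (φ := fun _ => 1) (by simpa using h)).summable
  simp only [mul_one] at h1
  exact_mod_cast h1

theorem hasSum_inner_reducedResolvent {v w : L2} {z : ℂ}
    (hw : ∀ n : ℤ, inner ℂ (expE n) w = (4 * (n : ℂ) ^ 2 - z)⁻¹ * inner ℂ (expE n) v) :
    HasSum (fun k : ℕ => ((‖proj k v‖ ^ 2 : ℝ) : ℂ) / (z0 k - z)) (inner ℂ v w) := by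
  have h := expBasis.hasSum_inner_mul_inner v w
  simp only [expBasis_apply, hw, mul_left_comm _ (_ - z)⁻¹, inner_mul_inner_expE] at h
  refine hasSum_norm_proj_sq_mul (φ := fun k => (z0 k - z)⁻¹) ?_
  refine h.congr_fun fun n => ?_
  rw [z0_natAbs, mul_comm]

theorem Q_eq_tsum (α : ℝ) (v : L2) (z : ℂ) :
    Q α v z = 1 + α * ∑' k : ℕ, ((‖proj k v‖ ^ 2 : ℝ) : ℂ) / (z0 k - z) := by
  rw [Q]
  congr 2
  refine tsum_subtype_eq_of_support_subset (s := {k | proj k v ≠ 0})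
    (f := fun k => ((‖proj k v‖ ^ 2 : ℝ) : ℂ) / (z0 k - z)) ?_
  intro k hk hk0
  apply hk
  simp [hk0]

/-- This holds at every `z`, including eigenvalues of `L0`: there both the sum for `Q` and the
reduced resolvent drop the singular terms, since division by zero gives 0. -/
theorem Q_eq_one_add_inner {α : ℝ} {v w : L2} {z : ℂ}
    (hw : ∀ n : ℤ, inner ℂ (expE n) w = (4 * (n : ℂ) ^ 2 - z)⁻¹ * inner ℂ (expE n) v) :
    Q α v z = 1 + α * inner ℂ v w := by
  rw [Q_eq_tsum, (hasSum_inner_reducedResolvent hw).tsum_eq]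

/-! ### Multiplicities under the rank-one perturbation -/

/-- The poles of `Q`. -/
def IsPole (α : ℝ) (v : L2) (z : ℂ) : Prop := ∃ k, z = z0 k ∧ α * ‖proj k v‖ ^ 2 ≠ 0

theorem isPole_iff (α : ℝ) (v : L2) (z : ℂ) :
    IsPole α v z ↔ ∃ n : ℤ, 4 * (n : ℂ) ^ 2 = z ∧ (α : ℂ) * inner ℂ (expE n) v ≠ 0 := by
  constructor
  · rintro ⟨k, rfl, hk⟩
    obtain ⟨n, hn, hv⟩ := (norm_proj_sq_ne_zero_iff k v).1 (right_ne_zero_of_mul hk)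
    exact ⟨n, hn, mul_ne_zero (Complex.ofReal_ne_zero.2 (left_ne_zero_of_mul hk)) hv⟩
  · rintro ⟨n, hn, hv⟩
    refine ⟨n.natAbs, by rw [z0_natAbs, hn], mul_ne_zero ?_ ?_⟩
    · exact Complex.ofReal_ne_zero.1 (left_ne_zero_of_mul hv)
    · exact (norm_proj_sq_ne_zero_iff _ v).2 ⟨n, (z0_natAbs n).symm, right_ne_zero_of_mul hv⟩

/-- At a pole, some coordinate `n` with `4n² = z` has `α⟨e_n, v⟩ ≠ 0`; that coordinate of the
eigenvalue equation forces `⟨v, f⟩ = 0`. So the new eigenspace is the kernel of `f ↦ ⟨v, f⟩` on the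
old one, and this functional is nonzero there. -/
theorem mult_opL_of_isPole {α : ℝ} {v : L2} {z : ℂ} (h : IsPole α v z) :
    mult (opL α v) z + 1 = mult L0 z := by
  obtain ⟨n, hn, hv⟩ := (isPole_iff α v z).1 h
  let φ : eigenspace L0 z →ₗ[ℂ] ℂ := (innerSL ℂ v).toLinearMap ∘ₗ (eigenspace L0 z).subtype
  have hφ : ∀ f, φ f = inner ℂ v (f : L2) := fun _ => rfl
  have hE : eigenspace (opL α v) z = (LinearMap.ker φ).map (eigenspace L0 z).subtype := by
    ext f
    rw [Submodule.mem_map]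
    constructor
    · intro hf
      rw [mem_eigenspace_opL_iff] at hf
      have h0 : inner ℂ v f = 0 := by
        have := hf n
        rw [hn, sub_self, zero_mul, zero_add, mul_right_comm] at this
        exact (mul_eq_zero.1 this).resolve_left hv
      have hf0 : f ∈ eigenspace L0 z := by
        rw [mem_eigenspace_L0_iff]
        intro m
        have := hf m
        rwa [h0, mul_zero, zero_mul, add_zero] at this
      exact ⟨⟨f, hf0⟩, LinearMap.mem_ker.2 h0, rfl⟩
    · rintro ⟨⟨g, hg⟩, hg0, rfl⟩
      rw [LinearMap.mem_ker, hφ] at hg0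
      simp only [Submodule.subtype_apply] at hg0 ⊢
      rw [mem_eigenspace_L0_iff] at hg
      rw [mem_eigenspace_opL_iff]
      intro m
      rw [hg m, hg0, mul_zero, zero_mul, add_zero]
  have hrange : LinearMap.range φ = ⊤ := by
    rw [LinearMap.range_eq_top]
    refine LinearMap.surjective_of_ne_zero fun h0 => hv ?_
    have : φ ⟨expE n, expE_mem_eigenspace hn⟩ = 0 := by rw [h0]; rfl
    rw [hφ, ← inner_conj_symm, map_eq_zero] at this
    rw [this, mul_zero]
  have := φ.finrank_range_add_finrank_ker
  rw [hrange, finrank_top, Module.finrank_self] at this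
  rw [mult, mult, hE, Submodule.finrank_map_subtype_eq, ← this, add_comm]

theorem mul_inner_eq_zero_of_mem_eigenspace {α : ℝ} {v : L2} {z : ℂ} (h : ¬ IsPole α v z) {g : L2}
    (hg : g ∈ eigenspace L0 z) : (α : ℂ) * inner ℂ v g = 0 := by
  have h1 := (expBasis.hasSum_inner_mul_inner v g).mul_left (α : ℂ)
  rw [mem_eigenspace_L0_iff] at hg
  refine h1.unique ((hasSum_zero (α := ℂ) (β := ℤ)).congr_fun fun n => ?_)
  rw [expBasis_apply]
  rcases mul_eq_zero.1 (hg n) with hn | hn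
  · have : (α : ℂ) * inner ℂ (expE n) v = 0 := by
      by_contra hne
      exact h ((isPole_iff α v z).2 ⟨n, sub_eq_zero.1 hn, hne⟩)
    rcases mul_eq_zero.1 this with h2 | h2
    · rw [h2, zero_mul]
    · rw [← inner_conj_symm, h2, map_zero, zero_mul, mul_zero]
  · rw [hn, mul_zero, mul_zero]

/-- With `w = αR v`, where `R` is the reduced resolvent, one has `(L0 - z)w = αv`, since off the
poles `αv` has no component in `Ker(L0 - z)`. Hence `(L - z)f = (L0 - z)(f + ⟨v, f⟩w)` on the
domain. -/
theorem exists_reducedResolvent_apply {α : ℝ} {v : L2} {z : ℂ} (h : ¬ IsPole α v z) :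
    ∃ w : L2, Q α v z = 1 + inner ℂ v w ∧
      ∀ f, f ∈ eigenspace (opL α v) z ↔ f + inner ℂ v f • w ∈ eigenspace L0 z := by
  obtain ⟨R, hR⟩ := exists_reducedResolvent z
  refine ⟨(α : ℂ) • R v, ?_, fun f => ?_⟩
  · rw [Q_eq_one_add_inner (hR v), inner_smul_right]
  · rw [mem_eigenspace_opL_iff, mem_eigenspace_L0_iff]
    refine forall_congr' fun n => ?_
    rw [inner_add_right, inner_smul_right, inner_smul_right, hR]
    have : (4 * (n : ℂ) ^ 2 - z) * ((α : ℂ) * ((4 * (n : ℂ) ^ 2 - z)⁻¹ * inner ℂ (expE n) v)) =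
        α * inner ℂ (expE n) v := by
      by_cases hn : 4 * (n : ℂ) ^ 2 - z = 0
      · rw [hn, zero_mul]
        by_contra hne
        exact h ((isPole_iff α v z).2 ⟨n, sub_eq_zero.1 hn, fun h0 => hne h0.symm⟩)
      · field_simp
    rw [mul_add, mul_left_comm, this]
    ring_nf

theorem mult_opL_of_Q_ne_zero {α : ℝ} {v : L2} {z : ℂ} (h : ¬ IsPole α v z) (hQ : Q α v z ≠ 0) :
    mult (opL α v) z = mult L0 z := by
  obtain ⟨w, hw, hE⟩ := exists_reducedResolvent_apply h
  have : eigenspace (opL α v) z = eigenspace L0 z := by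
    have key : ∀ f, (α : ℂ) * inner ℂ v f = 0 →
        (f ∈ eigenspace (opL α v) z ↔ f ∈ eigenspace L0 z) := by
      intro f hf
      rw [mem_eigenspace_opL_iff, mem_eigenspace_L0_iff]
      simp only [hf, zero_mul, add_zero]
    ext f
    constructor
    · intro hf
      refine (key f ?_).1 hf
      have h1 := mul_inner_eq_zero_of_mem_eigenspace h ((hE f).1 hf)
      rw [inner_add_right, inner_smul_right] at h1
      -- Pairing `f + ⟨v, f⟩w` with `αv`, which is orthogonal to `Ker(L0 - z)`.
      have h2 : ((α : ℂ) * inner ℂ v f) * Q α v z = 0 := by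
        rw [hw]
        linear_combination h1
      exact (mul_eq_zero.1 h2).resolve_right hQ
    · intro hf
      exact (key f (mul_inner_eq_zero_of_mem_eigenspace h hf)).2 hf
  rw [mult, mult, this]

/-- `Q(z) = 0` means `⟨v, w⟩ = -1`, so `w` itself solves the eigenvalue equation. It lies outside
`Ker(L0 - z)`, which is orthogonal to `v`, and spans the only new direction. -/
theorem mult_opL_of_Q_eq_zero {α : ℝ} {v : L2} {z : ℂ} (h : ¬ IsPole α v z) (hQ : Q α v z = 0) :
    mult (opL α v) z = mult L0 z + 1 := by
  obtain ⟨w, hw, hE⟩ := exists_reducedResolvent_apply h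
  have hvw : inner ℂ v w = -1 := by
    rw [hQ] at hw
    linear_combination -hw
  have hα : (α : ℂ) ≠ 0 := by
    intro h0
    simp [Q, h0] at hQ
  have h0 : ∀ g ∈ eigenspace L0 z, inner ℂ v g = 0 := fun g hg =>
    (mul_eq_zero.1 (mul_inner_eq_zero_of_mem_eigenspace h hg)).resolve_left hα
  have hwE : w ∉ eigenspace L0 z := by
    intro hmem
    have := h0 w hmem
    rw [hvw] at this
    norm_num at this
  have hw0 : w ≠ 0 := by
    rintro rfl
    exact hwE (Submodule.zero_mem _)
  have hsup : eigenspace (opL α v) z = eigenspace L0 z ⊔ Submodule.span ℂ {w} := by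
    apply le_antisymm
    · intro f hf
      have h1 := (hE f).1 hf
      have : f = (f + inner ℂ v f • w) + (-inner ℂ v f) • w := by module
      rw [this]
      exact Submodule.add_mem_sup h1
        (Submodule.smul_mem _ _ (Submodule.mem_span_singleton_self w))
    · refine sup_le (fun g hg => ?_) ?_
      · rw [hE, h0 g hg, zero_smul, add_zero]
        exact hg
      · rw [Submodule.span_singleton_le_iff_mem, hE, hvw, neg_one_smul, add_neg_cancel]
        exact Submodule.zero_mem _
  have hinf : eigenspace L0 z ⊓ Submodule.span ℂ {w} = ⊥ := by
    rw [← disjoint_iff]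
    exact (Submodule.disjoint_span_singleton' hw0).2 hwE
  have hfin := Submodule.finrank_sup_add_finrank_inf_eq (eigenspace L0 z) (Submodule.span ℂ {w})
  rw [hinf, finrank_bot, add_zero, finrank_span_singleton hw0] at hfin
  rw [mult, mult, hsup, hfin]

/-! ### The characteristic function as `Δ(0, λ) Q(λ²)` -/

theorem hasDerivAt_cos_mul (l : ℂ) (x : ℝ) :
    HasDerivAt (fun x : ℝ => Complex.cos (l * x)) (-l * Complex.sin (l * x)) x := by
  convert! ((hasDerivAt_id (x : ℂ)).const_mul l).ccos.comp_ofReal using 1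
  simp [mul_comm]

theorem hasDerivAt_sin_mul (l : ℂ) (x : ℝ) :
    HasDerivAt (fun x : ℝ => Complex.sin (l * x)) (l * Complex.cos (l * x)) x := by
  convert! ((hasDerivAt_id (x : ℂ)).const_mul l).csin.comp_ofReal using 1
  simp [mul_comm]

theorem continuous_cos_mul (l : ℂ) : Continuous fun x : ℝ => Complex.cos (l * x) := by fun_prop

theorem continuous_sin_mul (l : ℂ) : Continuous fun x : ℝ => Complex.sin (l * x) := by fun_prop

theorem intervalIntegrable_conj {f : ℝ → ℂ} {a b : ℝ} (hf : IntervalIntegrable f volume a b) :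
    IntervalIntegrable (fun x => (starRingEnd ℂ) (f x)) volume a b :=
  ⟨(Complex.conjCLE : ℂ →L[ℝ] ℂ).integrable_comp hf.1,
    (Complex.conjCLE : ℂ →L[ℝ] ℂ).integrable_comp hf.2⟩

/-- Variation of parameters for `-y'' - l² y = g` with the periodic boundary conditions. -/
theorem hasPeriodicSecondDeriv_variation {l : ℂ} (hl : l ≠ 0) (v u h : L2) {a b : ℂ}
    {y : ℝ → ℂ}
    (hy : ∀ x, y x =
      Complex.cos (l * x) * (a + ∫ t in (0 : ℝ)..x, l⁻¹ * (Complex.sin (l * t) * v t)) +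
      Complex.sin (l * x) * (b + ∫ t in (0 : ℝ)..x, -l⁻¹ * (Complex.cos (l * t) * v t)))
    (hu : u =ᵐ[volume.restrict (Set.Ioo (0 : ℝ) Real.pi)] y)
    (hh : h = -(v + (l ^ 2) • u)) (hper : y Real.pi = a)
    (hper' : -l * Complex.sin (l * Real.pi) *
        (a + ∫ t in (0 : ℝ)..Real.pi, l⁻¹ * (Complex.sin (l * t) * v t)) +
      l * Complex.cos (l * Real.pi) *
        (b + ∫ t in (0 : ℝ)..Real.pi, -l⁻¹ * (Complex.cos (l * t) * v t)) = l * b) :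
    HasPeriodicSecondDeriv u h := by
  have iv := intervalIntegrable_coe v
  set gA : ℝ → ℂ := fun t => l⁻¹ * (Complex.sin (l * t) * v t) with hgA
  set gB : ℝ → ℂ := fun t => -l⁻¹ * (Complex.cos (l * t) * v t) with hgB
  have iA : IntervalIntegrable gA volume 0 Real.pi :=
    (IntervalIntegrable.continuous_mul (continuous_sin_mul l) iv).const_mul _
  have iB : IntervalIntegrable gB volume 0 Real.pi :=
    (IntervalIntegrable.continuous_mul (continuous_cos_mul l) iv).const_mul _
  set A : ℝ → ℂ := fun x => a + ∫ t in (0 : ℝ)..x, gA t with hA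
  set B : ℝ → ℂ := fun x => b + ∫ t in (0 : ℝ)..x, gB t with hB
  have hA0 : A 0 = a := by simp [hA]
  have hB0 : B 0 = b := by simp [hB]
  have hAi : ∀ x ∈ Set.Icc (0 : ℝ) Real.pi, A x = A 0 + ∫ t in (0 : ℝ)..x, gA t := fun x _ => by
    rw [hA0]
  have hBi : ∀ x ∈ Set.Icc (0 : ℝ) Real.pi, B x = B 0 + ∫ t in (0 : ℝ)..x, gB t := fun x _ => by
    rw [hB0]
  have cA := continuousOn_of_eq_integral iA hAi
  have cB := continuousOn_of_eq_integral iB hBi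
  have hyAB : ∀ x, y x = Complex.cos (l * x) * A x + Complex.sin (l * x) * B x := hy
  set y' : ℝ → ℂ := fun x => -l * Complex.sin (l * x) * A x + l * Complex.cos (l * x) * B x
    with hy'
  have ii : ∀ {e Y g : ℝ → ℂ} {e' : ℝ → ℂ}, Continuous e → Continuous e' →
      ContinuousOn Y (Set.Icc (0 : ℝ) Real.pi) → IntervalIntegrable g volume 0 Real.pi →
      ∀ x ∈ Set.Icc (0 : ℝ) Real.pi,
        IntervalIntegrable (fun t => e' t * Y t + e t * g t) volume 0 x := by
    intro e Y g e' ce ce' cY ig x hx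
    refine (ContinuousOn.intervalIntegrable ?_).add
      (IntervalIntegrable.continuous_mul ce (intervalIntegrable_of_mem ig hx))
    rw [Set.uIcc_of_le hx.1]
    exact ce'.continuousOn.mul (cY.mono (Set.Icc_subset_Icc le_rfl hx.2))
  have cc := continuous_cos_mul l
  have cs := continuous_sin_mul l
  have cc' : Continuous fun x : ℝ => l * Complex.cos (l * x) := by fun_prop
  have cs' : Continuous fun x : ℝ => -l * Complex.sin (l * x) := by fun_prop
  refine ⟨y, y', hu, ?_, ?_, ?_, ?_⟩
  · intro x hx
    have h1 := mul_eq_add_integral (hasDerivAt_cos_mul l) cs' iA hAi x hx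
    have h2 := mul_eq_add_integral (hasDerivAt_sin_mul l) cc' iB hBi x hx
    rw [hyAB x, hyAB 0, h1, h2, add_add_add_comm, ← intervalIntegral.integral_add
      (ii cc cs' cA iA x hx) (ii cs cc' cB iB x hx)]
    congr 1
    refine intervalIntegral.integral_congr fun t _ => ?_
    simp only [hy', hgA, hgB]
    ring
  · intro x hx
    have hd1 : ∀ x : ℝ, HasDerivAt (fun x : ℝ => -l * Complex.sin (l * x))
        (-l * (l * Complex.cos (l * x))) x := fun x => (hasDerivAt_sin_mul l x).const_mul _
    have hd2 : ∀ x : ℝ, HasDerivAt (fun x : ℝ => l * Complex.cos (l * x))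
        (l * (-l * Complex.sin (l * x))) x := fun x => (hasDerivAt_cos_mul l x).const_mul _
    have k1 : Continuous fun x : ℝ => -l * (l * Complex.cos (l * x)) := by fun_prop
    have k2 : Continuous fun x : ℝ => l * (-l * Complex.sin (l * x)) := by fun_prop
    have h1 := mul_eq_add_integral hd1 k1 iA hAi x hx
    have h2 := mul_eq_add_integral hd2 k2 iB hBi x hx
    have e0 : y' x = y' 0 + ∫ t in (0 : ℝ)..x, (-(l ^ 2) * y t - v t) := by
      simp only [hy']
      rw [h1, h2, add_add_add_comm, ← intervalIntegral.integral_add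
        (ii cs' k1 cA iA x hx) (ii cc' k2 cB iB x hx)]
      congr 1
      refine intervalIntegral.integral_congr fun t _ => ?_
      simp only [hyAB, hgA, hgB]
      have hsc := Complex.sin_sq_add_cos_sq (l * t)
      field_simp
      linear_combination (-(v t)) * hsc
    rw [e0]
    congr 1
    rw [intervalIntegral.integral_of_le hx.1, intervalIntegral.integral_of_le hx.1,
      integral_Ioc_eq_integral_Ioo, integral_Ioc_eq_integral_Ioo]
    refine integral_congr_ae ?_
    refine ae_mono (Measure.restrict_mono (Set.Ioo_subset_Ioo le_rfl hx.2) le_rfl) ?_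
    subst hh
    filter_upwards [hu, Lp.coeFn_neg (v + (l ^ 2) • u), Lp.coeFn_add v ((l ^ 2) • u),
      Lp.coeFn_smul (l ^ 2) u] with t h1 h2 h3 h4
    rw [h2, Pi.neg_apply, h3, Pi.add_apply, h4, Pi.smul_apply, h1, smul_eq_mul]
    ring
  · rw [hper, hyAB 0]
    simp [hA0]
  · have : y' 0 = l * b := by
      simp [hy', hB0]
    rw [this, ← hper']

theorem Delta0_ne_zero_imp {l : ℂ} (h : Delta0 l ≠ 0) (n : ℤ) : 4 * (n : ℂ) ^ 2 ≠ l ^ 2 := by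
  intro he
  apply h
  have h1 : (2 * (n : ℂ) - l) * (2 * n + l) = 0 := by linear_combination he
  have h2 : Complex.cos (l * Real.pi) = 1 := by
    rcases mul_eq_zero.1 h1 with h2 | h2
    · rw [Complex.cos_eq_one_iff]
      exact ⟨n, by linear_combination (Real.pi : ℂ) * h2⟩
    · rw [Complex.cos_eq_one_iff]
      exact ⟨-n, by push_cast; linear_combination -(Real.pi : ℂ) * h2⟩
  rw [Delta0, h2, sub_self, mul_zero]

/-- The periodic solution `u` of `-u'' - l²u = v` is built by variation of parameters. Its Fourier
coefficients show that `u = (L0 - l²)⁻¹v`, so `Q = 1 + α⟨u, v⟩`, and expanding this pairing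
reproduces `W`, `N`, `F`, `F*` and `G`. -/
theorem DeltaDet_eq_mul_Q (α : ℝ) (v : L2) {l : ℂ} (h0 : Delta0 l ≠ 0) :
    DeltaDet α v l = Delta0 l * Q α v (l ^ 2) := by
  have hl : l ≠ 0 := by
    rintro rfl
    simp [Delta0] at h0
  have hπ := Real.pi_pos.le
  have iv := intervalIntegrable_coe v
  have ivb := intervalIntegrable_conj iv
  have cc := continuous_cos_mul l
  have cs := continuous_sin_mul l
  have icv := IntervalIntegrable.continuous_mul cc iv
  have isv := IntervalIntegrable.continuous_mul cs iv
  have icb := IntervalIntegrable.continuous_mul cc ivb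
  have isb := IntervalIntegrable.continuous_mul cs ivb
  set Cf : ℝ → ℂ := fun x => ∫ t in (0 : ℝ)..x, Complex.cos (l * t) * v t with hCf
  set Sf : ℝ → ℂ := fun x => ∫ t in (0 : ℝ)..x, Complex.sin (l * t) * v t with hSf
  set Vf : ℝ → ℂ := fun x => ∫ t in (0 : ℝ)..x, Complex.cos (l * t) * (starRingEnd ℂ) (v t) with hVf
  have cCf : ContinuousOn Cf (Set.uIcc 0 Real.pi) :=
    intervalIntegral.continuousOn_primitive_interval' icv Set.left_mem_uIcc
  have cSf : ContinuousOn Sf (Set.uIcc 0 Real.pi) :=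
    intervalIntegral.continuousOn_primitive_interval' isv Set.left_mem_uIcc
  have cVf : ContinuousOn Vf (Set.uIcc 0 Real.pi) :=
    intervalIntegral.continuousOn_primitive_interval' icb Set.left_mem_uIcc
  set c := Complex.cos (l * Real.pi) with hc
  set s := Complex.sin (l * Real.pi) with hs
  have hcs : s ^ 2 + c ^ 2 = 1 := Complex.sin_sq_add_cos_sq _
  have hD : Delta0 l = 2 * (1 - c) := rfl
  have hc1 : 1 - c ≠ 0 := fun h => h0 (by rw [hD, h, mul_zero])
  set Vc := ∫ x in (0 : ℝ)..Real.pi, Complex.cos (l * x) * (starRingEnd ℂ) (v x) with hVc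
  set Vs := ∫ x in (0 : ℝ)..Real.pi, Complex.sin (l * x) * (starRingEnd ℂ) (v x) with hVs
  set I1 := ∫ x in (0 : ℝ)..Real.pi, Complex.cos (l * x) * (starRingEnd ℂ) (v x) * Sf x with hI1
  set I2 := ∫ x in (0 : ℝ)..Real.pi, Complex.sin (l * x) * (starRingEnd ℂ) (v x) * Cf x with hI2
  set I3 := ∫ x in (0 : ℝ)..Real.pi, Complex.cos (l * x) * (starRingEnd ℂ) (v x) * Cf x with hI3
  have hsub : ∀ x : ℝ, Complex.sin (l * (Real.pi - x)) =
      s * Complex.cos (l * x) - c * Complex.sin (l * x) := by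
    intro x
    rw [mul_sub, Complex.sin_sub]
  have hcsub : ∀ x : ℝ, Complex.cos (l * (Real.pi - x)) =
      c * Complex.cos (l * x) + s * Complex.sin (l * x) := by
    intro x
    rw [mul_sub, Complex.cos_sub]
  have eW : W v l = l⁻¹ * Vs + (l⁻¹ * s * Vc - l⁻¹ * c * Vs) := by
    rw [W, hVc, hVs]
    simp only [← intervalIntegral.integral_const_mul]
    rw [← intervalIntegral.integral_sub (icb.const_mul _) (isb.const_mul _)]
    congr 1
    · exact intervalIntegral.integral_congr fun x _ => by ring
    · exact intervalIntegral.integral_congr fun x _ => by simp only [hsub]; ring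
  have eN : N v l = (1 - c) * Cf Real.pi - s * Sf Real.pi := by
    rw [N, hCf, hSf]
    simp only [← intervalIntegral.integral_const_mul]
    rw [← intervalIntegral.integral_sub (icv.const_mul _) (isv.const_mul _)]
    exact intervalIntegral.integral_congr fun x _ => by simp only [hcsub]; ring
  have eF : F v l = l⁻¹ * s * I3 - l⁻¹ * c * I2 := by
    have : F v l = ∫ x in (0 : ℝ)..Real.pi, Complex.sin (l * (Real.pi - x)) / l * Cf x *
      (starRingEnd ℂ) (v x) := rfl
    rw [this, hI3, hI2, ← intervalIntegral.integral_const_mul,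
      ← intervalIntegral.integral_const_mul, ← intervalIntegral.integral_sub ((icb.mul_continuousOn cCf).const_mul _)
      ((isb.mul_continuousOn cCf).const_mul _)]
    exact intervalIntegral.integral_congr fun x _ => by simp only [hsub]; ring
  have eG : Gint v l = l⁻¹ * I2 - l⁻¹ * I1 := by
    rw [Gint, hI1, hI2, ← intervalIntegral.integral_const_mul,
      ← intervalIntegral.integral_const_mul, ← intervalIntegral.integral_sub ((isb.mul_continuousOn cCf).const_mul _)
      ((icb.mul_continuousOn cSf).const_mul _)]
    refine intervalIntegral.integral_congr fun x hx => ?_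
    rw [Set.uIcc_of_le hπ] at hx
    have : ∫ t in (0 : ℝ)..x, Complex.sin (l * (x - t)) / l * v t =
        l⁻¹ * Complex.sin (l * x) * Cf x - l⁻¹ * Complex.cos (l * x) * Sf x := by
      simp only [hCf, hSf, ← intervalIntegral.integral_const_mul]
      rw [← intervalIntegral.integral_sub ((intervalIntegrable_of_mem icv hx).const_mul _)
        ((intervalIntegrable_of_mem isv hx).const_mul _)]
      refine intervalIntegral.integral_congr fun t _ => ?_
      rw [mul_sub, Complex.sin_sub]
      ring
    rw [this]
    ring
  -- In `F*` the inner integral carries `conj v`. Integration by parts moves it back onto `v`, so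
  -- that only `I1`, `I2`, `I3` and full integrals remain.
  have hJ3 : I3 + ∫ x in (0 : ℝ)..Real.pi, Vf x * (Complex.cos (l * x) * v x) = Vc * Cf Real.pi :=
    integral_mul_primitive_add hπ icb icv
  have hJ2 : I1 + ∫ x in (0 : ℝ)..Real.pi, Vf x * (Complex.sin (l * x) * v x) = Vc * Sf Real.pi :=
    integral_mul_primitive_add hπ icb isv
  have eFs : starFun (F v) l =
      l⁻¹ * s * (Vc * Cf Real.pi - I3) - l⁻¹ * c * (Vc * Sf Real.pi - I1) := by
    have hconj : starFun (F v) l = ∫ x in (0 : ℝ)..Real.pi,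
        Complex.sin (l * (Real.pi - x)) / l * Vf x * v x := by
      rw [starFun, F, ← intervalIntegral.intervalIntegral_conj]
      simp only [map_mul, map_div₀, ← intervalIntegral.intervalIntegral_conj, ← Complex.sin_conj,
        ← Complex.cos_conj, map_sub, Complex.conj_conj, Complex.conj_ofReal, hVf]
    rw [← hJ3, ← hJ2, add_sub_cancel_left, add_sub_cancel_left, hconj,
      ← intervalIntegral.integral_const_mul, ← intervalIntegral.integral_const_mul,
      ← intervalIntegral.integral_sub ((icv.continuousOn_mul cVf).const_mul _)
      ((isv.continuousOn_mul cVf).const_mul _)]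
    exact intervalIntegral.integral_congr fun x _ => by simp only [hsub]; ring
  -- `a` and `b` solve the two periodic boundary conditions, a linear system of determinant `(1 -
  -- c)² + s² = 2(1 - c) = Delta0 l`.
  set a := -(Sf Real.pi) / (2 * l) - s * Cf Real.pi / (l * (2 * (1 - c))) with ha
  set b := Cf Real.pi / (2 * l) - s * Sf Real.pi / (l * (2 * (1 - c))) with hb
  set y : ℝ → ℂ := fun x =>
    Complex.cos (l * x) * (a + ∫ t in (0 : ℝ)..x, l⁻¹ * (Complex.sin (l * t) * v t)) +
    Complex.sin (l * x) * (b + ∫ t in (0 : ℝ)..x, -l⁻¹ * (Complex.cos (l * t) * v t)) with hy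
  have hy2 : ∀ x, y x = Complex.cos (l * x) * (a + l⁻¹ * Sf x) +
      Complex.sin (l * x) * (b + -l⁻¹ * Cf x) := by
    intro x
    simp only [hy, intervalIntegral.integral_const_mul, hSf, hCf]
  have cy : ContinuousOn y (Set.Icc 0 Real.pi) := by
    rw [← Set.uIcc_of_le hπ]
    refine ContinuousOn.congr ?_ fun x _ => hy2 x
    exact (cc.continuousOn.mul (continuousOn_const.add (continuousOn_const.mul cSf))).add
      (cs.continuousOn.mul (continuousOn_const.add (continuousOn_const.mul cCf)))
  set u : L2 := (memLp_of_continuousOn cy).toLp with hu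
  have huy : u =ᵐ[volume.restrict (Set.Ioo (0 : ℝ) Real.pi)] y := MemLp.coeFn_toLp _
  have hper := hasPeriodicSecondDeriv_variation hl v u (-(v + (l ^ 2) • u)) (fun _ => rfl) huy rfl
    (by
      change y Real.pi = a
      rw [hy2, ← hc, ← hs, ha, hb]
      field_simp
      linear_combination -Sf Real.pi * hcs) (by
      simp only [intervalIntegral.integral_const_mul]
      change -l * s * (a + l⁻¹ * Sf Real.pi) + l * c * (b + -l⁻¹ * Cf Real.pi) = l * b
      rw [ha, hb]
      field_simp
      linear_combination Cf Real.pi * hcs)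
  have hcoef : ∀ n : ℤ, inner ℂ (expE n) u = (4 * (n : ℂ) ^ 2 - l ^ 2)⁻¹ * inner ℂ (expE n) v := by
    intro n
    have h1 := inner_expE_of_hasPeriodicSecondDeriv hper n
    rw [inner_neg_right, inner_add_right, inner_smul_right] at h1
    have h2 := sub_ne_zero.2 (Delta0_ne_zero_imp h0 n)
    field_simp
    linear_combination h1
  have hvu : inner ℂ v u = a * Vc + b * Vs + l⁻¹ * I1 - l⁻¹ * I2 := by
    rw [inner_eq_integral, integral_congr_Ioo (g := fun x => (starRingEnd ℂ) (v x) * y x)]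
    · simp only [hVc, hVs, hI1, hI2, ← intervalIntegral.integral_const_mul]
      have i1 := icb.const_mul a
      have i2 := isb.const_mul b
      have i3 := (icb.mul_continuousOn cSf).const_mul l⁻¹
      have i4 := (isb.mul_continuousOn cCf).const_mul l⁻¹
      rw [← intervalIntegral.integral_add i1 i2, ← intervalIntegral.integral_add (i1.add i2) i3,
        ← intervalIntegral.integral_sub ((i1.add i2).add i3) i4]
      refine intervalIntegral.integral_congr fun x _ => ?_
      simp only [hy2]
      ring
    · filter_upwards [huy] with x hx
      rw [hx]
  rw [DeltaDet, Q_eq_one_add_inner hcoef, hvu, eW, eN, eF, eFs, eG, hD, ha, hb]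
  rw [← sub_eq_zero]
  -- The two sides of the identity differ by exactly this multiple of `s² + c² - 1`.
  have hzero : -((α : ℂ) * Vc * Sf Real.pi / (l * (1 - c))) * (s ^ 2 + c ^ 2 - 1) = 0 := by
    rw [hcs, sub_self, mul_zero]
  rw [← hzero]
  field_simp
  ring

/-! ### Values of the characteristic function at the even integers -/

theorem summable_coeff (α : ℝ) (v : L2) : Summable fun k : ℕ => α * ‖proj k v‖ ^ 2 :=
  (summable_norm_proj_sq v).mul_left α

theorem Q_eq_tsum_coeff (α : ℝ) (v : L2) (z : ℂ) :
    Q α v z = 1 + ∑' k : ℕ, ((α * ‖proj k v‖ ^ 2 : ℝ) : ℂ) / (z0 k - z) := by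
  rw [Q_eq_tsum, ← tsum_mul_left]
  congr 2
  ext k
  push_cast
  ring

theorem summable_coeff_div (α : ℝ) (v : L2) (z : ℂ) :
    Summable fun k : ℕ => ((α * ‖proj k v‖ ^ 2 : ℝ) : ℂ) / (z0 k - z) := by
  refine Summable.of_norm_bounded
    ((summable_coeff α v).abs.mul_right (∑' k : ℕ, ‖(z0 k - z)⁻¹‖)) fun k => ?_
  rw [div_eq_mul_inv, norm_mul, Complex.norm_real]
  exact mul_le_mul_of_nonneg_left (norm_inv_z0_sub_le z k) (norm_nonneg _)

/-- Summability of the inverse distances bounds each of them, so the eigenvalues other than `z` keep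
a uniform distance from it. -/
theorem exists_dist_z0 (z : ℂ) : ∃ δ > 0, ∀ k, z0 k ≠ z → δ ≤ ‖z0 k - z‖ := by
  set B := ∑' k : ℕ, ‖(z0 k - z)⁻¹‖ with hB
  have hB0 : 0 ≤ B := tsum_nonneg fun _ => norm_nonneg _
  refine ⟨(B + 1)⁻¹, by positivity, fun k hk => ?_⟩
  have h1 := norm_inv_z0_sub_le z k
  rw [norm_inv] at h1
  have h2 : 0 < ‖z0 k - z‖ := norm_pos_iff.2 (sub_ne_zero.2 hk)
  rw [inv_le_comm₀ (by positivity) h2]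
  linarith

theorem continuousAt_tsum_coeff (α : ℝ) (v : L2) (z : ℂ) :
    ContinuousAt (fun w => ∑' k : ℕ,
      if z0 k = z then 0 else ((α * ‖proj k v‖ ^ 2 : ℝ) : ℂ) / (z0 k - w)) z := by
  obtain ⟨δ, hδ, hdist⟩ := exists_dist_z0 z
  refine tendsto_tsum_of_dominated_convergence
    ((summable_coeff α v).abs.mul_right (δ / 2)⁻¹) (fun k => ?_) ?_
  · by_cases hk : z0 k = z
    · simp only [hk, if_true]
      exact tendsto_const_nhds
    · simp only [hk, if_false]
      exact tendsto_const_nhds.div (tendsto_const_nhds.sub tendsto_id) (sub_ne_zero.2 hk)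
  · filter_upwards [Metric.ball_mem_nhds z (half_pos hδ)] with w hw k
    split_ifs with hk
    · rw [norm_zero]
      positivity
    · rw [div_eq_mul_inv, norm_mul, Complex.norm_real, norm_inv]
      refine mul_le_mul_of_nonneg_left (inv_anti₀ (by positivity) ?_) (norm_nonneg _)
      have h1 := hdist k hk
      rw [Metric.mem_ball, dist_eq_norm] at hw
      have h2 : ‖z0 k - z‖ ≤ ‖z0 k - w‖ + ‖w - z‖ := norm_sub_le_norm_sub_add_norm_sub _ _ _
      linarith

theorem Delta0_ne_zero {w : ℂ} (h : ∀ k, z0 k ≠ w ^ 2) : Delta0 w ≠ 0 := by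
  intro h0
  have h1 : Complex.cos (w * Real.pi) = 1 := by
    rw [Delta0] at h0
    linear_combination -(1 / 2) * h0
  obtain ⟨n, hn⟩ := Complex.cos_eq_one_iff.1 h1
  have h2 : w = 2 * n := mul_right_cancel₀ pi_ne_zero' (by linear_combination -hn)
  apply h n.natAbs
  rw [z0_natAbs, h2]
  ring

theorem Delta0_eq_zero {l : ℂ} {k : ℕ} (h : z0 k = l ^ 2) : Delta0 l = 0 := by
  by_contra h0
  exact Delta0_ne_zero_imp h0 k (by rw [← h, z0, Int.cast_natCast])

theorem eventually_z0_ne_sq (l : ℂ) : ∀ᶠ w in 𝓝[≠] l, ∀ k, z0 k ≠ w ^ 2 := by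
  obtain ⟨δ, hδ, hdist⟩ := exists_dist_z0 (l ^ 2)
  have hcont : Tendsto (fun w : ℂ => w ^ 2) (𝓝 l) (𝓝 (l ^ 2)) := (continuous_pow 2).tendsto l
  have h1 := (hcont.eventually (Metric.ball_mem_nhds (l ^ 2) hδ)).filter_mono
    (nhdsWithin_le_nhds (s := {l}ᶜ))
  have h2 : ∀ᶠ w in 𝓝[≠] l, w ≠ -l := by
    by_cases hl : l = -l
    · filter_upwards [self_mem_nhdsWithin] with w hw
      rw [← hl]
      exact hw
    · exact (isOpen_ne.eventually_mem hl).filter_mono nhdsWithin_le_nhds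
  filter_upwards [h1, h2, self_mem_nhdsWithin] with w hw1 hw2 hw3 k hk
  by_cases hkl : z0 k = l ^ 2
  · have : (w - l) * (w + l) = 0 := by linear_combination hkl - hk
    rcases mul_eq_zero.1 this with h | h
    · exact hw3 (sub_eq_zero.1 h)
    · exact hw2 (eq_neg_of_add_eq_zero_left h)
  · have := hdist k hkl
    rw [dist_eq_norm, ← hk] at hw1
    linarith

theorem Delta_eq_of_tendsto {α : ℝ} {v : L2} {l a : ℂ}
    (h : Tendsto (fun w => Delta0 w * Q α v (w ^ 2)) (𝓝[≠] l) (𝓝 a)) : Delta α v l = a := by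
  refine Tendsto.limUnder_eq (h.congr' ?_)
  filter_upwards [eventually_z0_ne_sq l] with w hw
  exact (DeltaDet_eq_mul_Q α v (Delta0_ne_zero hw)).symm

theorem continuous_Delta0 : Continuous Delta0 := by
  unfold Delta0
  fun_prop

theorem tendsto_tsum_coeff_sq (α : ℝ) (v : L2) (l : ℂ) :
    Tendsto (fun w : ℂ => ∑' k : ℕ,
      if z0 k = l ^ 2 then 0 else ((α * ‖proj k v‖ ^ 2 : ℝ) : ℂ) / (z0 k - w ^ 2)) (𝓝[≠] l)
      (𝓝 (∑' k : ℕ,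
      if z0 k = l ^ 2 then 0 else ((α * ‖proj k v‖ ^ 2 : ℝ) : ℂ) / (z0 k - l ^ 2))) :=
  ((continuousAt_tsum_coeff α v (l ^ 2)).tendsto.comp ((continuous_pow 2).tendsto l)).mono_left
    nhdsWithin_le_nhds

theorem Delta_eq_of_not_isPole {α : ℝ} {v : L2} {l : ℂ} (h : ¬ IsPole α v (l ^ 2)) :
    Delta α v l = Delta0 l * Q α v (l ^ 2) := by
  have hQ : ∀ w : ℂ, Q α v w = 1 + ∑' k : ℕ,
      if z0 k = l ^ 2 then 0 else ((α * ‖proj k v‖ ^ 2 : ℝ) : ℂ) / (z0 k - w) := by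
    intro w
    rw [Q_eq_tsum_coeff]
    congr 2
    ext k
    split_ifs with hk
    · have : α * ‖proj k v‖ ^ 2 = 0 := by
        by_contra hne
        exact h ⟨k, hk.symm, hne⟩
      rw [this, Complex.ofReal_zero, zero_div]
    · rfl
  refine Delta_eq_of_tendsto ?_
  simp only [hQ]
  exact ((continuous_Delta0.tendsto l).mono_left nhdsWithin_le_nhds).mul
    ((tendsto_tsum_coeff_sq α v l).const_add 1)

theorem Q_sq_eq_of_eq_z0 (α : ℝ) (v : L2) {l : ℂ} {p : ℕ} (hp : z0 p = l ^ 2) (w : ℂ) :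
    Q α v w = 1 + ((α * ‖proj p v‖ ^ 2 : ℝ) : ℂ) / (z0 p - w) + ∑' k : ℕ,
      if z0 k = l ^ 2 then 0 else ((α * ‖proj k v‖ ^ 2 : ℝ) : ℂ) / (z0 k - w) := by
  rw [Q_eq_tsum_coeff, add_assoc, (summable_coeff_div α v w).tsum_eq_add_tsum_ite p]
  congr 3
  ext k
  simp only [← hp, z0_injective.eq_iff]

/-- At a nonzero even integer `Delta0` vanishes to second order, but `z0 p - w²` only to first
order. At `l = 0` both orders are two, and the limit is not zero. -/
theorem tendsto_Delta0_div_sub {l : ℂ} {p : ℕ} (hp : z0 p = l ^ 2) (hl : l ≠ 0) :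
    Tendsto (fun w => Delta0 w / (z0 p - w ^ 2)) (𝓝[≠] l) (𝓝 0) := by
  have hcos : Complex.cos (l * Real.pi) = 1 := by
    have := Delta0_eq_zero hp
    rw [Delta0] at this
    linear_combination -(1 / 2) * this
  have hsin : Complex.sin (l * Real.pi) = 0 := by
    have := Complex.sin_sq_add_cos_sq (l * Real.pi)
    rw [hcos, one_pow, add_eq_right] at this
    exact pow_eq_zero_iff (two_ne_zero) |>.1 this
  have hder : HasDerivAt Delta0 0 l := by
    have h1 : HasDerivAt (fun w : ℂ => w * Real.pi) (Real.pi : ℂ) l := by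
      simpa using (hasDerivAt_id l).mul_const (Real.pi : ℂ)
    have h2 := (h1.ccos.const_sub 1).const_mul 2
    exact h2.congr_deriv (by rw [hsin]; simp)
  have h1 := hasDerivAt_iff_tendsto_slope.1 hder
  have h2 : Tendsto (fun w : ℂ => -(w + l)⁻¹) (𝓝[≠] l) (𝓝 (-(l + l)⁻¹)) := by
    refine Tendsto.mono_left ?_ nhdsWithin_le_nhds
    exact ((tendsto_id.add_const l).inv₀ (by rw [← two_mul]; exact mul_ne_zero two_ne_zero hl)).neg
  have h3 := h1.mul h2
  rw [zero_mul] at h3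
  refine h3.congr fun w => ?_
  rw [slope_def_field, Delta0_eq_zero hp, sub_zero, hp, div_eq_mul_inv, div_eq_mul_inv, mul_assoc,
    mul_neg, ← mul_inv, ← inv_neg]
  congr 2
  ring

theorem tendsto_Delta0_div_sq :
    Tendsto (fun w : ℂ => Delta0 w / (z0 0 - w ^ 2)) (𝓝[≠] 0) (𝓝 (-(Real.pi : ℂ) ^ 2)) := by
  have h1 : HasDerivAt (fun w : ℂ => w * (Real.pi / 2)) ((Real.pi : ℂ) / 2) 0 := by
    simpa using (hasDerivAt_id (0 : ℂ)).mul_const ((Real.pi : ℂ) / 2)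
  have h2 := hasDerivAt_iff_tendsto_slope.1 h1.csin
  have h3 := ((h2.pow 2).const_mul (-4))
  simp only [zero_mul, Complex.cos_zero, one_mul] at h3
  have e : (-4 : ℂ) * ((Real.pi : ℂ) / 2) ^ 2 = -(Real.pi : ℂ) ^ 2 := by ring
  rw [e] at h3
  refine h3.congr fun w => ?_
  have e2 : Delta0 w = 4 * Complex.sin (w * (Real.pi / 2)) ^ 2 := by
    rw [Delta0, show w * (Real.pi : ℂ) = 2 * (w * (Real.pi / 2)) by ring, Complex.cos_two_mul,
      Complex.cos_sq']
    ring
  rw [slope_def_field, e2]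
  simp only [zero_mul, Complex.sin_zero, sub_zero, z0, Nat.cast_zero, ne_eq, OfNat.ofNat_ne_zero,
    not_false_eq_true, zero_pow, mul_zero, zero_sub]
  rw [div_neg, div_pow]
  ring

/-- Since `Delta0` tends to 0, only the summand of `Q` that is singular at `l²` can contribute to
the limit. -/
theorem tendsto_Delta0_mul_Q {α : ℝ} {v : L2} {l a : ℂ} {p : ℕ} (hp : z0 p = l ^ 2)
    (h : Tendsto (fun w => Delta0 w / (z0 p - w ^ 2)) (𝓝[≠] l) (𝓝 a)) :
    Delta α v l = a * (α * ‖proj p v‖ ^ 2 : ℝ) := by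
  refine Delta_eq_of_tendsto ?_
  have h1 : Tendsto Delta0 (𝓝[≠] l) (𝓝 0) := by
    have := continuous_Delta0.tendsto l
    rw [Delta0_eq_zero hp] at this
    exact this.mono_left nhdsWithin_le_nhds
  have h2 := (h1.mul ((tendsto_tsum_coeff_sq α v l).const_add 1)).add
    (h.mul_const ((α * ‖proj p v‖ ^ 2 : ℝ) : ℂ))
  rw [zero_mul, zero_add] at h2
  refine h2.congr fun w => ?_
  rw [Q_sq_eq_of_eq_z0 α v hp (w ^ 2)]
  ring

theorem Delta_eq_zero_of_ne_zero {α : ℝ} {v : L2} {l : ℂ} {p : ℕ} (hp : z0 p = l ^ 2)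
    (hl : l ≠ 0) : Delta α v l = 0 := by
  rw [tendsto_Delta0_mul_Q hp (tendsto_Delta0_div_sub hp hl), zero_mul]

theorem Delta_zero (α : ℝ) (v : L2) :
    Delta α v 0 = -(Real.pi : ℂ) ^ 2 * (α * ‖proj 0 v‖ ^ 2 : ℝ) :=
  tendsto_Delta0_mul_Q (by simp [z0]) tendsto_Delta0_div_sq

/-! ### Canonical products over zeros and poles -/

/-- The constant relating `a - w` to the elementary factor `fac a w`. -/
def leadFac {K : Type*} [Field K] [DecidableEq K] (a : K) : K := if a = 0 then -1 else a

theorem leadFac_ne_zero {K : Type*} [Field K] [DecidableEq K] (a : K) : leadFac a ≠ 0 := by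
  unfold leadFac
  split_ifs with h
  · exact neg_ne_zero.2 one_ne_zero
  · exact h

theorem ofReal_leadFac (a : ℝ) : ((leadFac a : ℝ) : ℂ) = leadFac (a : ℂ) := by
  unfold leadFac
  by_cases h : a = 0
  · simp [h]
  · simp [h]

theorem sub_eq_leadFac_mul_fac (a w : ℂ) : a - w = leadFac a * fac a w := by
  unfold leadFac fac
  split_ifs with h
  · rw [h]
    ring
  · field_simp

theorem fac_eq_zero_iff {a w : ℂ} : fac a w = 0 ↔ a = w := by
  rw [← sub_eq_zero (a := a), sub_eq_leadFac_mul_fac, mul_eq_zero]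
  simp [leadFac_ne_zero]

section Products

variable {ι : Type*}

theorem eventually_cofinite_ne {K : Type*} {a : ι → K} (ha : Function.Injective a) (x : K) :
    ∀ᶠ k in cofinite, a k ≠ x := by
  have : {k | ¬ a k ≠ x}.Finite := by
    refine Set.Subsingleton.finite fun i hi j hj => ha ?_
    simp only [ne_eq, not_not, Set.mem_ofPred_eq] at hi hj
    rw [hi, hj]
  exact this

theorem summable_fac_sub_one {a : ι → ℂ} (ha : Function.Injective a)
    (hs : Summable fun k => ‖(a k)⁻¹‖) (w : ℂ) : Summable fun k => ‖fac (a k) w - 1‖ := by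
  refine Summable.of_norm_bounded_eventually (hs.mul_left ‖w‖) ?_
  filter_upwards [eventually_cofinite_ne ha 0] with k hk
  rw [fac, if_neg hk, norm_norm, sub_sub_cancel_left, norm_neg, div_eq_mul_inv, norm_mul]

theorem multipliable_fac {a : ι → ℂ} (ha : Function.Injective a)
    (hs : Summable fun k => ‖(a k)⁻¹‖) (w : ℂ) : Multipliable fun k => fac (a k) w := by
  simpa using multipliable_one_add_of_summable (summable_fac_sub_one ha hs w)

theorem tprod_fac_ne_zero {a : ι → ℂ} (ha : Function.Injective a)
    (hs : Summable fun k => ‖(a k)⁻¹‖) {w : ℂ} (hw : ∀ k, a k ≠ w) :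
    ∏' k, fac (a k) w ≠ 0 := by
  have := tprod_one_add_ne_zero_of_summable (f := fun k => fac (a k) w - 1)
    (fun k => by
      rw [add_sub_cancel, Ne, fac_eq_zero_iff]
      exact hw k) (summable_fac_sub_one ha hs w)
  simpa using this

theorem hasProd_of_hasProd_ne {M : Type*} [CommMonoid M] [TopologicalSpace M] [ContinuousMul M]
    {f : ι → M} {b : M} (p : ι)
    (h : HasProd (fun k : {k // k ≠ p} => f k) b) : HasProd f (f p * b) := by
  have h1 : HasProd (f ∘ ((↑) : ({p} : Set ι) → ι)) (f p) := hasProd_unique _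
  exact h1.mul_isCompl isCompl_compl h

theorem summable_leadFac_div {s m : ι → ℝ} (hs : Function.Injective s)
    (hsum : Summable fun k => |s k|⁻¹) (hm : Function.Injective m) {M : ℝ}
    (hM : ∀ k, |m k - s k| ≤ M) : Summable fun k => ‖leadFac (m k) / leadFac (s k) - 1‖ := by
  refine Summable.of_norm_bounded_eventually (hsum.mul_left M) ?_
  filter_upwards [eventually_cofinite_ne hs 0, eventually_cofinite_ne hm 0] with k h1 h2
  rw [leadFac, leadFac, if_neg h1, if_neg h2, norm_norm, div_sub_one h1, norm_div,
    div_eq_mul_inv]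
  exact mul_le_mul_of_nonneg_right (hM k) (by positivity)

/-- Splitting of the matched product into the separate canonical products over the zeros and
over the poles. -/
theorem _root_.IsSecularLimit.exists_const {s c m : ι → ℝ} (h : IsSecularLimit s c m)
    (hs : Function.Injective s) (hsum : Summable fun k => |s k|⁻¹) :
    ∃ C : ℝ, C ≠ 0 ∧ (Summable fun k => ‖(m k : ℂ)⁻¹‖) ∧
      (∀ z : ℂ, (∀ k, z ≠ s k) → 1 + ∑' k, (c k : ℂ) / (s k - z) =
        C * ((∏' k, fac (m k) z) / ∏' k, fac (s k) z)) ∧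
      ∀ p, (c p : ℂ) = leadFac (s p : ℂ) * C *
        ((∏' k, fac (m k) (s p)) / ∏' k : {k // k ≠ p}, fac (s k) (s p)) := by
  obtain ⟨M, hM⟩ := h.bounded
  have hms : Summable fun k => ‖(m k : ℂ)⁻¹‖ :=
    summable_norm_inv_of_norm_sub_le hs hsum (M := M) fun k => by
      rw [← Complex.ofReal_sub, Complex.norm_real]
      exact hM k
  have hss : Summable fun k => ‖(s k : ℂ)⁻¹‖ := by
    simpa using summable_norm_inv_sub hs hsum 0
  have hsc : Function.Injective fun k => (s k : ℂ) := Complex.ofReal_injective.comp hs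
  have hmc : Function.Injective fun k => (m k : ℂ) := Complex.ofReal_injective.comp h.injective
  have hr := summable_leadFac_div hs hsum h.injective hM
  -- Each matched factor splits into a part free of `z` and a quotient of elementary factors. The
  -- `z`-free parts converge to `C`, since for all but finitely many `k` they differ from 1 by `(m k
  -- - s k)/s k`.
  have hterm : ∀ (z : ℂ) k, ((m k : ℂ) - z) / (s k - z) =
      ((leadFac (m k) / leadFac (s k) : ℝ) : ℂ) * (fac (m k) z / fac (s k) z) := by
    intro z k
    rw [sub_eq_leadFac_mul_fac, sub_eq_leadFac_mul_fac (s k : ℂ), Complex.ofReal_div,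
      ofReal_leadFac, ofReal_leadFac, mul_div_mul_comm]
  -- Needed for the whole index set, which gives `C`, and for the set without `p`, which enters the
  -- residue.
  have hrC : ∀ {κ : Type _} (e : κ → ι), Function.Injective e → ∃ C : ℝ, C ≠ 0 ∧
      HasProd (fun k => ((leadFac (m (e k)) / leadFac (s (e k)) : ℝ) : ℂ)) C := by
    intro κ e he
    refine ⟨∏' k, (1 + (leadFac (m (e k)) / leadFac (s (e k)) - 1)),
      tprod_one_add_ne_zero_of_summable (fun k => ?_) (hr.comp_injective he), ?_⟩
    · rw [add_sub_cancel]
      exact div_ne_zero (leadFac_ne_zero _) (leadFac_ne_zero _)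
    · have := (multipliable_one_add_of_summable (hr.comp_injective he)).hasProd.map
        Complex.ofRealHom Complex.continuous_ofReal
      refine this.congr_fun fun k => ?_
      simp
  obtain ⟨C, hC0, hC⟩ := hrC id Function.injective_id
  refine ⟨C, hC0, hms, fun z hz => ?_, fun p => ?_⟩
  · rw [h.eq_tprod z hz]
    simp only [hterm]
    exact (hC.mul ((multipliable_fac hmc hms z).hasProd.div₀ (multipliable_fac hsc hss z).hasProd
      (tprod_fac_ne_zero hsc hss fun k => (hz k).symm))).tprod_eq
  · have he : Function.Injective (Subtype.val : {k // k ≠ p} → ι) := Subtype.val_injective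
    obtain ⟨C', hC'0, hC'⟩ := hrC _ he
    have h1 : (C : ℂ) = leadFac (m p : ℂ) / leadFac (s p : ℂ) * C' := by
      rw [hC.unique (hasProd_of_hasProd_ne p hC')]
      simp only [id_eq]
      rw [Complex.ofReal_div, ofReal_leadFac, ofReal_leadFac]
    have h2 := multipliable_fac (hmc.comp he) (hms.comp_injective he) (s p)
    have h3 := multipliable_fac (hsc.comp he) (hss.comp_injective he) (s p)
    have h4 := tprod_fac_ne_zero (hsc.comp he) (hss.comp_injective he) (w := s p)
      fun k hk => k.2 (hsc hk)
    have h5 := hasProd_of_hasProd_ne (f := fun k => fac (m k) (s p)) p h2.hasProd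
    simp only [Function.comp_def] at h2 h3 h4 h5
    rw [h.residue p]
    simp only [hterm]
    rw [(hC'.mul (h2.hasProd.div₀ h3.hasProd h4)).tprod_eq, h5.tprod_eq, h1,
      sub_eq_leadFac_mul_fac]
    have := leadFac_ne_zero (s p : ℂ)
    field_simp

end Products

/-! ### Lowered and raised points as poles and zeros of `Q` -/

theorem lowered_opL (α : ℝ) (v : L2) : lowered (opL α v) = {z | IsPole α v z} := by
  ext z
  constructor
  · rintro ⟨-, hz⟩
    by_contra h
    by_cases hQ : Q α v z = 0
    · have := mult_opL_of_Q_eq_zero h hQ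
      omega
    · have := mult_opL_of_Q_ne_zero h hQ
      omega
  · intro h
    have h1 := mult_opL_of_isPole h
    obtain ⟨k, rfl, hk⟩ := h
    exact ⟨by rw [spec_L0]; exact ⟨k, rfl⟩, by omega⟩

theorem raised_opL (α : ℝ) (v : L2) :
    raised (opL α v) = {z | ¬ IsPole α v z ∧ Q α v z = 0} := by
  ext z
  constructor
  · rintro ⟨-, hz⟩
    have hP : ¬ IsPole α v z := fun h => by
      have := mult_opL_of_isPole h
      omega
    refine ⟨hP, ?_⟩
    by_contra hQ
    have := mult_opL_of_Q_ne_zero hP hQ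
    omega
  · rintro ⟨hP, hQ⟩
    have h := mult_opL_of_Q_eq_zero hP hQ
    exact ⟨mem_spec_of_mult_ne_zero (by omega), by omega⟩

theorem isPole_iff_of_ne_zero {α : ℝ} (hα : α ≠ 0) (v : L2) (z : ℂ) :
    IsPole α v z ↔ z ∈ spec L0 \ sigma0 v := by
  rw [spec_L0]
  constructor
  · rintro ⟨k, rfl, hk⟩
    refine ⟨⟨k, rfl⟩, ?_⟩
    rintro ⟨j, hj, hv⟩
    rw [z0_injective hj] at hk
    simp [hv] at hk
  · rintro ⟨⟨k, rfl⟩, hk⟩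
    refine ⟨k, rfl, mul_ne_zero hα (pow_ne_zero 2 (norm_ne_zero_iff.2 fun hv => hk ⟨k, rfl, hv⟩))⟩

theorem z0_mem_lowered_iff (α : ℝ) (v : L2) (p : ℕ) :
    z0 p ∈ lowered (opL α v) ↔ α * ‖proj p v‖ ^ 2 ≠ 0 := by
  rw [lowered_opL]
  constructor
  · rintro ⟨k, hk, h⟩
    rwa [z0_injective hk]
  · exact fun h => ⟨p, rfl, h⟩

theorem summable_norm_inv_range {ι : Type*} {a : ι → ℂ} (ha : Function.Injective a)
    (h : Summable fun k => ‖(a k)⁻¹‖) {S : Set ℂ} (hS : S = Set.range a) :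
    Summable fun x : S => ‖(x : ℂ)⁻¹‖ := by
  subst hS
  rw [← (Equiv.ofInjective a ha).summable_iff]
  exact h

theorem tprod_coe_range {ι : Type*} {a : ι → ℂ} (ha : Function.Injective a) {S : Set ℂ}
    (hS : S = Set.range a) (f : ℂ → ℂ) : ∏' x : S, f x = ∏' k, f (a k) := by
  subst hS
  exact tprod_range f ha

/-- The function `Q` as a quotient of canonical products over the raised and the lowered points,
and its residues. -/
theorem exists_Q_eq_tprod (α : ℝ) (v : L2) : ∃ C : ℝ, C ≠ 0 ∧
    (Summable fun x : raised (opL α v) => ‖(x : ℂ)⁻¹‖) ∧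
    (Summable fun x : lowered (opL α v) => ‖(x : ℂ)⁻¹‖) ∧
    (∀ z ∉ lowered (opL α v), Q α v z = C *
      ((∏' m : raised (opL α v), fac (m : ℂ) z) / ∏' s : lowered (opL α v), fac (s : ℂ) z)) ∧
    ∀ p : ℕ, z0 p ∈ lowered (opL α v) → ((α * ‖proj p v‖ ^ 2 : ℝ) : ℂ) = leadFac (z0 p) * C *
      ((∏' m : raised (opL α v), fac (m : ℂ) (z0 p)) /
        ∏' s : ↥(lowered (opL α v) \ {z0 p}), fac (s : ℂ) (z0 p)) := by
  let ι := {k : ℕ // α * ‖proj k v‖ ^ 2 ≠ 0}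
  let s : ι → ℝ := fun k => 4 * ((k : ℕ) : ℝ) ^ 2
  let c : ι → ℝ := fun k => α * ‖proj k v‖ ^ 2
  have hs : Function.Injective s := four_sq_injective.comp Subtype.val_injective
  have hsum : Summable fun k => |s k|⁻¹ :=
    summable_inv_four_sq.comp_injective (i := ((↑) : ι → ℕ)) Subtype.val_injective
  have hcs : Summable c :=
    (summable_coeff α v).comp_injective (i := ((↑) : ι → ℕ)) Subtype.val_injective
  -- The common sign is that of `α`; for `α = 0` the index type is empty.
  have hc : (∀ k, 0 < c k) ∨ ∀ k, c k < 0 := by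
    have hne : ∀ k : ι, ‖proj k v‖ ^ 2 ≠ 0 := fun k => right_ne_zero_of_mul k.2
    rcases lt_trichotomy α 0 with h | h | h
    · right
      intro k
      have := lt_of_le_of_ne (sq_nonneg ‖proj k v‖) (hne k).symm
      exact mul_neg_of_neg_of_pos h this
    · left
      intro k
      exact absurd h (left_ne_zero_of_mul k.2)
    · left
      intro k
      have := lt_of_le_of_ne (sq_nonneg ‖proj k v‖) (hne k).symm
      exact mul_pos h this
  obtain ⟨m, hm⟩ := exists_isSecularLimit hs hsum hc hcs
  obtain ⟨C, hC0, hms, hQC, hres⟩ := hm.exists_const hs hsum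
  have hz0 : ∀ k : ι, z0 k = s k := fun k => z0_eq_ofReal k
  have hsc : Function.Injective fun k => (s k : ℂ) := Complex.ofReal_injective.comp hs
  have hmc : Function.Injective fun k => (m k : ℂ) := Complex.ofReal_injective.comp hm.injective
  have hss : Summable fun k => ‖(s k : ℂ)⁻¹‖ := by
    simpa using summable_norm_inv_sub hs hsum 0
  have hQ : ∀ z, Q α v z = 1 + ∑' k, (c k : ℂ) / (s k - z) := by
    intro z
    rw [Q_eq_tsum_coeff]
    congr 1
    have := tsum_subtype_eq_of_support_subset (s := {k : ℕ | α * ‖proj k v‖ ^ 2 ≠ 0})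
      (f := fun k : ℕ => ((α * ‖proj k v‖ ^ 2 : ℝ) : ℂ) / (z0 k - z)) (by
        intro k hk h0
        apply hk
        simp [h0])
    rw [← this]
    exact tsum_congr fun k => by rw [hz0 k]
  have hP : lowered (opL α v) = Set.range fun k => (s k : ℂ) := by
    rw [lowered_opL]
    ext z
    constructor
    · rintro ⟨k, rfl, hk⟩
      exact ⟨⟨k, hk⟩, (hz0 ⟨k, hk⟩).symm⟩
    · rintro ⟨k, rfl⟩
      exact ⟨k, (hz0 k).symm, k.2⟩
  have hnot : ∀ z ∉ lowered (opL α v), ∀ k, z ≠ s k := fun z hz k hk =>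
    hz (by rw [hP]; exact ⟨k, hk.symm⟩)
  have hR : raised (opL α v) = Set.range fun k => (m k : ℂ) := by
    rw [raised_opL]
    ext z
    constructor
    · rintro ⟨hz, hQz⟩
      have hz' := hnot z (by rw [lowered_opL]; exact hz)
      rw [hQ, hQC z hz'] at hQz
      by_contra hne
      refine mul_ne_zero (Complex.ofReal_ne_zero.2 hC0) (div_ne_zero ?_ ?_) hQz
      · exact tprod_fac_ne_zero hmc hms fun k hk => hne ⟨k, hk⟩
      · exact tprod_fac_ne_zero hsc hss fun k => (hz' k).symm
    · rintro ⟨k, rfl⟩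
      have hz' : ∀ p, (m k : ℂ) ≠ s p := fun p h => hm.ne_pole k p (Complex.ofReal_injective h)
      refine ⟨?_, ?_⟩
      · intro hpole
        have : (m k : ℂ) ∈ lowered (opL α v) := by
          rw [lowered_opL]
          exact hpole
        rw [hP] at this
        obtain ⟨p, hp⟩ := this
        exact hz' p hp.symm
      · change Q α v (m k) = 0
        rw [hQ, hQC _ hz', tprod_of_exists_eq_zero ⟨k, fac_eq_zero_iff.2 rfl⟩, zero_div, mul_zero]
  refine ⟨C, hC0, summable_norm_inv_range hmc hms hR, summable_norm_inv_range hsc hss hP, ?_, ?_⟩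
  · intro z hz
    rw [hQ, hQC z (hnot z hz), tprod_coe_range hmc hR fun a => fac a z,
      tprod_coe_range hsc hP fun a => fac a z]
  · intro p hp
    let q : ι := ⟨p, (z0_mem_lowered_iff α v p).1 hp⟩
    have hq : z0 p = s q := hz0 q
    have hP' : lowered (opL α v) \ {z0 p} = Set.range fun k : {k // k ≠ q} => (s k : ℂ) := by
      rw [hP, hq]
      ext z
      constructor
      · rintro ⟨⟨k, rfl⟩, hk⟩
        exact ⟨⟨k, fun h => hk (by rw [h]; rfl)⟩, rfl⟩
      · rintro ⟨⟨k, hk⟩, rfl⟩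
        exact ⟨⟨k, rfl⟩, fun h => hk (hsc h)⟩
    rw [tprod_coe_range hmc hR fun a => fac a (z0 p),
      tprod_coe_range (hsc.comp Subtype.val_injective) hP' fun a => fac a (z0 p), hq]
    exact hres q

/-! ### Product expansion of the characteristic function and recovery of the constant -/

theorem hasProd_subtype_ite {S : Set ℂ} [DecidablePred (· ∈ S)] {f : ℂ → ℂ} {a : ℂ}
    (h : HasProd (fun x : S => f x) a) : HasProd (fun z => if z ∈ S then f z else 1) a := by
  have h1 : Function.mulSupport (fun z => if z ∈ S then f z else 1) ⊆ S := by
    intro z hz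
    by_contra hS
    exact hz (if_neg hS)
  rw [← hasProd_subtype_iff_of_mulSupport_subset h1]
  exact h.congr_fun fun x => by simp

theorem hasProd_zero_of_eq_zero {ι : Type*} {f : ι → ℂ} {k : ι} (h : f k = 0) : HasProd f 0 := by
  refine tendsto_const_nhds.congr' ?_
  filter_upwards [eventually_ge_atTop {k}] with S hS
  exact (Finset.prod_eq_zero (hS (Finset.mem_singleton_self k)) h).symm

theorem fac_zero_right {a : ℂ} (ha : a ≠ 0) : fac a 0 = 1 := by
  simp [fac, ha]

theorem z0_succ_ne_zero (i : ℕ) : z0 (i + 1) ≠ 0 := by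
  rw [z0]
  have : ((i + 1 : ℕ) : ℂ) ≠ 0 := Nat.cast_ne_zero.2 i.succ_ne_zero
  exact mul_ne_zero (by norm_num) (pow_ne_zero 2 this)

/-- `Δ(0, l) = 4 sin²(πl/2)`, so this is the square of Euler's product. The square supplies the
multiplicity 2 of each nonzero eigenvalue, and the prefactor `l²` is the factor of the simple
eigenvalue 0. -/
theorem hasProd_fac_mult_L0 {l : ℂ} (hl : ∀ k, z0 k ≠ l ^ 2) :
    HasProd (fun z : ℂ => fac z (l ^ 2) ^ mult L0 z) (Delta0 l / (Real.pi : ℂ) ^ 2) := by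
  have h0 : l ≠ 0 := by
    rintro rfl
    exact hl 0 (by simp [z0])
  have hx : l / 2 ∈ Complex.integerComplement := by
    rintro ⟨n, hn⟩
    refine hl n.natAbs ?_
    rw [z0_natAbs]
    have : l = 2 * n := by rw [hn]; ring
    rw [this]
    ring
  have h1 := (multipliable_sineTerm (l / 2)).hasProd
  rw [euler_sineTerm_tprod hx] at h1
  have h2 := (h1.mul h1).congr_fun (g := fun i : ℕ => fac (z0 (i + 1)) (l ^ 2) ^
      mult L0 (z0 (i + 1))) fun i => by
    rw [mult_L0_z0, if_neg i.succ_ne_zero, fac, if_neg (z0_succ_ne_zero i), z0, sq]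
    have : ((i : ℂ) + 1) ≠ 0 := Nat.cast_add_one_ne_zero i
    congr 1 <;>
    · push_cast
      field_simp
      ring
  have h3 := HasProd.zero_mul (f := fun k : ℕ => fac (z0 k) (l ^ 2) ^ mult L0 (z0 k)) h2
  have h4 : Delta0 l / (Real.pi : ℂ) ^ 2 = fac (z0 0) (l ^ 2) ^ mult L0 (z0 0) *
      (Complex.sin (Real.pi * (l / 2)) / (Real.pi * (l / 2)) *
        (Complex.sin (Real.pi * (l / 2)) / (Real.pi * (l / 2)))) := by
    rw [mult_L0_z0, if_pos rfl, pow_one, fac, if_pos (by simp [z0]), Delta0,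
      show l * (Real.pi : ℂ) = 2 * (Real.pi * (l / 2)) by ring, Complex.cos_two_mul,
      Complex.cos_sq']
    field_simp [pi_ne_zero']
    ring
  rw [← h4] at h3
  refine (z0_injective.hasProd_iff fun z hz => ?_).1 h3
  rw [mult_L0_eq_zero fun k hk => hz ⟨k, hk.symm⟩, pow_zero]

/-- The eigenvalues are real, so `|z0 k - iy| ≥ y`: every summand is `O(1/y)` and, for `y ≥ 1`,
dominated by `|α| ‖v_k‖²`. -/
theorem tendsto_Q_I_mul (α : ℝ) (v : L2) :
    Tendsto (fun y : ℝ => Q α v (Complex.I * y)) atTop (𝓝 1) := by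
  have key : Tendsto (fun y : ℝ => ∑' k : ℕ,
      ((α * ‖proj k v‖ ^ 2 : ℝ) : ℂ) / (z0 k - Complex.I * y)) atTop (𝓝 (∑' _ : ℕ, 0)) := by
    have hy : ∀ (k : ℕ) (y : ℝ), 0 < y →
        ‖((α * ‖proj k v‖ ^ 2 : ℝ) : ℂ) / (z0 k - Complex.I * y)‖ ≤
          |α * ‖proj k v‖ ^ 2| * y⁻¹ := by
      intro k y hy
      rw [div_eq_mul_inv, norm_mul, Complex.norm_real, norm_inv]
      refine mul_le_mul_of_nonneg_left (inv_anti₀ hy ?_) (norm_nonneg _)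
      have := Complex.abs_im_le_norm (z0 k - Complex.I * y)
      rw [z0_eq_ofReal] at this ⊢
      rw [Complex.sub_im, Complex.ofReal_im, Complex.mul_im, Complex.I_re, Complex.I_im,
        Complex.ofReal_im, Complex.ofReal_re] at this
      simpa [abs_of_pos hy] using this
    refine tendsto_tsum_of_dominated_convergence (summable_coeff α v).abs (fun k => ?_) ?_
    · refine squeeze_zero_norm' (a := fun y : ℝ => |α * ‖proj k v‖ ^ 2| * y⁻¹) ?_ ?_
      · filter_upwards [eventually_gt_atTop 0] with y hy0 using hy k y hy0
      · have := (tendsto_inv_atTop_zero (𝕜 := ℝ)).const_mul |α * ‖proj k v‖ ^ 2|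
        rwa [mul_zero] at this
    · filter_upwards [eventually_ge_atTop 1] with y hy1 k
      refine (hy k y (by linarith)).trans ?_
      exact mul_le_of_le_one_right (abs_nonneg _) (inv_le_one_of_one_le₀ hy1)
  rw [tsum_zero] at key
  have := key.const_add 1
  rw [add_zero] at this
  exact this.congr fun y => (Q_eq_tsum_coeff α v _).symm

theorem I_mul_notMem_lowered (α : ℝ) (v : L2) {y : ℝ} (hy : 0 < y) :
    Complex.I * y ∉ lowered (opL α v) := by
  rw [lowered_opL]
  rintro ⟨k, hk, -⟩
  rw [z0_eq_ofReal] at hk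
  have := congrArg Complex.im hk
  rw [Complex.ofReal_im] at this
  simp at this
  exact hy.ne' this

theorem mult_opL_le (α : ℝ) (v : L2) {z : ℂ} (h : ¬ IsPole α v z) :
    mult L0 z ≤ mult (opL α v) z := by
  by_cases hQ : Q α v z = 0
  · rw [mult_opL_of_Q_eq_zero h hQ]
    exact Nat.le_succ _
  · exact (mult_opL_of_Q_ne_zero h hQ).ge

theorem zero_notMem_raised {α : ℝ} {v : L2} (h : z0 0 ∈ lowered (opL α v)) {z : ℂ}
    (hz : z ∈ raised (opL α v)) : z ≠ 0 := by
  rintro rfl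
  have h0 : z0 0 = 0 := by simp [z0]
  rw [h0] at h
  exact lt_asymm h.2 hz.2

/-- In the residue at 0 all elementary factors have nonzero base point and equal 1, and `leadFac 0 =
-1`. -/
theorem coeff_zero_eq {α : ℝ} {v : L2} {C : ℝ} (h0 : z0 0 ∈ lowered (opL α v))
    (hres : ((α * ‖proj 0 v‖ ^ 2 : ℝ) : ℂ) = leadFac (z0 0) * C *
      ((∏' m : raised (opL α v), fac (m : ℂ) (z0 0)) /
        ∏' s : ↥(lowered (opL α v) \ {z0 0}), fac (s : ℂ) (z0 0))) :
    α * ‖proj 0 v‖ ^ 2 = -C := by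
  have hz : z0 0 = 0 := by simp [z0]
  have h1 : ∏' m : raised (opL α v), fac (m : ℂ) (z0 0) = 1 := by
    rw [hz]
    exact (tprod_congr fun m => fac_zero_right (zero_notMem_raised h0 m.2)).trans tprod_one
  have h2 : ∏' s : ↥(lowered (opL α v) \ {z0 0}), fac (s : ℂ) (z0 0) = 1 := by
    refine (tprod_congr fun s => ?_).trans tprod_one
    exact (congrArg _ hz).trans (fac_zero_right fun h => s.2.2 (h.trans hz.symm))
  rw [h1, h2, hz, leadFac, if_pos rfl] at hres
  apply Complex.ofReal_injective
  rw [hres]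
  push_cast
  ring

/-- Off the even integers this is the sine product times the quotient for `Q`: raised points gain a
factor and lowered ones lose one. At even integers both sides vanish, except at `l = 0` when 0 is
lowered. -/
theorem hasProd_Delta {α : ℝ} {v : L2} {C : ℝ} (hC0 : C ≠ 0)
    (hR : Summable fun x : raised (opL α v) => ‖(x : ℂ)⁻¹‖)
    (hP : Summable fun x : lowered (opL α v) => ‖(x : ℂ)⁻¹‖)
    (hQC : ∀ z ∉ lowered (opL α v), Q α v z = C *
      ((∏' m : raised (opL α v), fac (m : ℂ) z) / ∏' s : lowered (opL α v), fac (s : ℂ) z))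
    (hzero : z0 0 ∈ lowered (opL α v) → α * ‖proj 0 v‖ ^ 2 = -C) (l : ℂ) :
    HasProd (fun z : spec (opL α v) => fac (z : ℂ) (l ^ 2) ^ mult (opL α v) (z : ℂ))
      (Delta α v l / ((Real.pi ^ 2 * C : ℝ) : ℂ)) := by
  classical
  -- A point of multiplicity 0 has factor 1, so the product may be taken over all of `ℂ`.
  have hsupp : Function.mulSupport (fun z : ℂ => fac z (l ^ 2) ^ mult (opL α v) z) ⊆
      spec (opL α v) := by
    intro z hz
    refine mem_spec_of_mult_ne_zero fun h0 => hz ?_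
    simp only [h0, pow_zero]
  refine (hasProd_subtype_iff_of_mulSupport_subset hsupp).2 ?_
  have hCc : (C : ℂ) ≠ 0 := Complex.ofReal_ne_zero.2 hC0
  by_cases hl : ∀ k, z0 k ≠ l ^ 2
  · have hnp : ¬ IsPole α v (l ^ 2) := fun ⟨k, hk, _⟩ => hl k hk.symm
    have hnl : l ^ 2 ∉ lowered (opL α v) := by
      rw [lowered_opL]
      exact hnp
    have h1 := hasProd_fac_mult_L0 hl
    have h2 := hasProd_subtype_ite (f := fun z => fac z (l ^ 2))
      (multipliable_fac Subtype.val_injective hR (l ^ 2)).hasProd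
    have h3 := hasProd_subtype_ite (f := fun z => fac z (l ^ 2))
      (multipliable_fac Subtype.val_injective hP (l ^ 2)).hasProd
    have h4 : ∏' s : lowered (opL α v), fac (s : ℂ) (l ^ 2) ≠ 0 :=
      tprod_fac_ne_zero Subtype.val_injective hP fun s hs => hnl (hs ▸ s.2)
    have h5 := h1.mul (h2.div₀ h3 h4)
    have e : Delta α v l / ((Real.pi ^ 2 * C : ℝ) : ℂ) = Delta0 l / (Real.pi : ℂ) ^ 2 *
        ((∏' m : raised (opL α v), fac (m : ℂ) (l ^ 2)) /
          ∏' s : lowered (opL α v), fac (s : ℂ) (l ^ 2)) := by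
      rw [Delta_eq_of_not_isPole hnp, hQC _ hnl]
      push_cast
      field_simp [pi_ne_zero']
    rw [e]
    refine h5.congr_fun fun z => ?_
    by_cases hz : IsPole α v z
    · have hzl : z ∈ lowered (opL α v) := by
        rw [lowered_opL]
        exact hz
      have hzr : z ∉ raised (opL α v) := by
        rw [raised_opL]
        exact fun h => h.1 hz
      have hf : fac z (l ^ 2) ≠ 0 := fun h => hnp (fac_eq_zero_iff.1 h ▸ hz)
      rw [if_pos hzl, if_neg hzr, ← mult_opL_of_isPole hz, pow_succ]
      field_simp
      ring
    · have hzl : z ∉ lowered (opL α v) := by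
        rw [lowered_opL]
        exact hz
      rw [if_neg hzl, div_one]
      by_cases hQ : Q α v z = 0
      · have hzr : z ∈ raised (opL α v) := by
          rw [raised_opL]
          exact ⟨hz, hQ⟩
        rw [if_pos hzr, mult_opL_of_Q_eq_zero hz hQ, pow_succ]
      · have hzr : z ∉ raised (opL α v) := by
          rw [raised_opL]
          exact fun h => hQ h.2
        rw [if_neg hzr, mul_one, mult_opL_of_Q_ne_zero hz hQ]
  · push Not at hl
    obtain ⟨k, hk⟩ := hl
    have hL0 := mult_L0_z0 k
    by_cases hp : IsPole α v (l ^ 2)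
    · by_cases hl0 : l = 0
      · subst hl0
        have hz : (0 : ℂ) ^ 2 = 0 := by norm_num
        have hz0' : z0 0 = 0 := by simp [z0]
        rw [hz] at hp ⊢
        have hlow : z0 0 ∈ lowered (opL α v) := by
          rw [lowered_opL, hz0']
          exact hp
        -- The simple eigenvalue 0 has been lowered to multiplicity 0, so every factor at `l = 0` is
        -- 1. This normalisation agrees with the residue `-C` at 0.
        have e : Delta α v 0 / ((Real.pi ^ 2 * C : ℝ) : ℂ) = 1 := by
          rw [Delta_zero, hzero hlow]
          push_cast
          field_simp [pi_ne_zero']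
        rw [e]
        refine (hasProd_one (β := ℂ)).congr_fun fun z => ?_
        by_cases hz1 : z = 0
        · have h1 := mult_opL_of_isPole hp
          rw [← hz0', mult_L0_z0, if_pos rfl, hz0'] at h1
          rw [hz1, show mult (opL α v) 0 = 0 by omega, pow_zero]
        · rw [fac_zero_right hz1, one_pow]
      -- A nonzero lowered point had multiplicity 2 and keeps 1, so its factor still vanishes.
      · rw [Delta_eq_zero_of_ne_zero hk hl0, zero_div]
        refine hasProd_zero_of_eq_zero (k := l ^ 2) ?_
        have h1 := mult_opL_of_isPole hp
        rw [← hk, hL0, if_neg] at h1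
        · rw [fac_eq_zero_iff.2 rfl, ← hk]
          exact zero_pow (by omega)
        · rintro rfl
          apply hl0
          simpa [z0] using hk.symm
    · rw [Delta_eq_of_not_isPole hp, Delta0_eq_zero hk, zero_mul, zero_div]
      refine hasProd_zero_of_eq_zero (k := l ^ 2) ?_
      have h1 := mult_opL_le α v hp
      rw [fac_eq_zero_iff.2 rfl]
      refine zero_pow ?_
      rw [← hk] at h1 ⊢
      rw [hL0] at h1
      split_ifs at h1 <;> omega

theorem tendsto_canonical_quotient {α : ℝ} {v : L2} {C : ℝ} (hC0 : C ≠ 0)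
    (hQC : ∀ z ∉ lowered (opL α v), Q α v z = C *
      ((∏' m : raised (opL α v), fac (m : ℂ) z) / ∏' s : lowered (opL α v), fac (s : ℂ) z)) :
    Tendsto
      (fun y : ℝ =>
        (∏' m : raised (opL α v), fac (m : ℂ) (Complex.I * (y : ℂ))) /
          ((Real.pi : ℂ) ^ 2 *
            ∏' s : lowered (opL α v), fac (s : ℂ) (Complex.I * (y : ℂ))))
      atTop (𝓝 (1 / ((Real.pi ^ 2 * C : ℝ) : ℂ))) := by
  have hCc : (C : ℂ) ≠ 0 := Complex.ofReal_ne_zero.2 hC0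
  refine ((tendsto_Q_I_mul α v).div_const ((Real.pi ^ 2 * C : ℝ) : ℂ)).congr' ?_
  filter_upwards [eventually_gt_atTop 0] with y hy
  rw [hQC _ (I_mul_notMem_lowered α v hy)]
  push_cast
  rw [mul_comm ((Real.pi : ℂ) ^ 2) (C : ℂ), mul_div_mul_left _ _ hCc, div_div, mul_comm]
  ring

/-! ### The formula with raised points matched to lowered points -/

theorem summable_norm_inv_lowered_diff {S : Set ℂ}
    (h : Summable fun x : S => ‖(x : ℂ)⁻¹‖) (a : ℂ) :
    Summable fun x : ↥(S \ {a}) => ‖(x : ℂ)⁻¹‖ :=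
  h.comp_injective (i := Set.inclusion Set.sdiff_subset) (Set.inclusion_injective _)

theorem tprod_coe_insert_range {κ : Type*} {a : κ → ℂ} (ha : Function.Injective a) {b : ℂ}
    (hb : b ∉ Set.range a) {S : Set ℂ} (hS : S = insert b (Set.range a)) {f : ℂ → ℂ} {P : ℂ}
    (h : HasProd (fun k => f (a k)) P) : ∏' x : S, f x = f b * P := by
  subst hS
  have h1 : HasProd (f ∘ ((↑) : ({b} : Set ℂ) → ℂ)) (f b) := hasProd_unique _
  have h2 : HasProd (f ∘ ((↑) : Set.range a → ℂ)) P :=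
    (Equiv.ofInjective a ha).hasProd_iff.1 h
  exact (h1.mul_disjoint (Set.disjoint_singleton_left.2 hb) h2).tprod_eq

/-- The numbers `α ‖v_p‖²` in terms of an enumeration of the raised points by the nonzero lowered
ones. -/
theorem exists_hasProd_matched {α : ℝ} {v : L2} {C : ℝ}
    (hR : Summable fun x : raised (opL α v) => ‖(x : ℂ)⁻¹‖)
    (hP : Summable fun x : lowered (opL α v) => ‖(x : ℂ)⁻¹‖)
    (h0 : z0 0 ∈ lowered (opL α v))
    (m : {k : ℕ // k ≠ 0 ∧ z0 k ∈ lowered (opL α v)} ≃ raised (opL α v))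
    (p : {k : ℕ // k ≠ 0 ∧ z0 k ∈ lowered (opL α v)})
    (hres : ((α * ‖proj p v‖ ^ 2 : ℝ) : ℂ) = leadFac (z0 p) * C *
      ((∏' m : raised (opL α v), fac (m : ℂ) (z0 p)) /
        ∏' s : ↥(lowered (opL α v) \ {z0 p}), fac (s : ℂ) (z0 p))) :
    ∃ P : ℂ,
      HasProd
        (fun k : {k : {k : ℕ // k ≠ 0 ∧ z0 k ∈ lowered (opL α v)} // k ≠ p} =>
          z0 k / (m k : ℂ) * (1 - (z0 k - (m k : ℂ)) / (z0 k - z0 p))) P ∧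
      ((α * ‖proj p v‖ ^ 2 : ℝ) : ℂ) =
        ((Real.pi ^ 2 * C : ℝ) : ℂ) *
          (((m p : ℂ) - z0 p) / ((Real.pi : ℂ) ^ 2 * (m p : ℂ))) * P := by
  let ι := {k : ℕ // k ≠ 0 ∧ z0 k ∈ lowered (opL α v)}
  have hm0 : ∀ k, (m k : ℂ) ≠ 0 := fun k => zero_notMem_raised h0 (m k).2
  have hz0 : ∀ k : ι, z0 k ≠ 0 := fun k h =>
    k.2.1 (z0_injective (h.trans (by simp [z0])))
  have hzi : Function.Injective fun k : ι => z0 k := z0_injective.comp Subtype.val_injective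
  have hmi : Function.Injective fun k : ι => (m k : ℂ) :=
    Subtype.val_injective.comp m.injective
  have hms : Summable fun k : ι => ‖(m k : ℂ)⁻¹‖ := hR.comp_injective m.injective
  have hzs : Summable fun k : ι => ‖(z0 k)⁻¹‖ :=
    hP.comp_injective (i := fun k : ι => (⟨z0 k, k.2.2⟩ : lowered (opL α v)))
      fun i j h => hzi (congrArg Subtype.val h)
  have he : Function.Injective (Subtype.val : {k : ι // k ≠ p} → ι) := Subtype.val_injective
  have h1 := (multipliable_fac (hmi.comp he) (hms.comp_injective he) (z0 p)).hasProd
  have h2 := (multipliable_fac (hzi.comp he) (hzs.comp_injective he) (z0 p)).hasProd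
  have h3 := tprod_fac_ne_zero (hzi.comp he) (hzs.comp_injective he) (w := z0 p)
    fun k hk => k.2 (hzi hk)
  -- The factor is `fac (m k) (z0 p) / fac (z0 k) (z0 p)`. Numerators and denominators converge
  -- unconditionally on their own, so any enumeration is allowed.
  refine ⟨_, (h1.div₀ h2 h3).congr_fun fun k => ?_, ?_⟩
  · have hk : z0 k - z0 p ≠ 0 := sub_ne_zero.2 fun h => k.2 (hzi h)
    simp only [Function.comp_apply]
    rw [fac, fac, if_neg (hm0 k), if_neg (hz0 k)]
    have := hm0 k
    have := hz0 k
    field_simp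
    ring
  · have h4 : ∏' x : raised (opL α v), fac (x : ℂ) (z0 p) = fac (m p) (z0 p) *
        ∏' k : {k : ι // k ≠ p}, fac (m k) (z0 p) := by
      rw [← m.tprod_eq]
      exact (hasProd_of_hasProd_ne (f := fun k : ι => fac (m k) (z0 p)) p h1).tprod_eq
    -- The lowered point 0 has no partner in the enumeration; its factor `z0 p` cancels `leadFac (z0
    -- p)` in the residue.
    have h5 : ∏' s : ↥(lowered (opL α v) \ {z0 p}), fac (s : ℂ) (z0 p) = z0 p *
        ∏' k : {k : ι // k ≠ p}, fac (z0 k) (z0 p) := by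
      have hzpi : Function.Injective fun k : {k : ι // k ≠ p} => z0 (k : ι) := hzi.comp he
      have hr : lowered (opL α v) \ {z0 p} =
          insert 0 (Set.range fun k : {k : ι // k ≠ p} => z0 (k : ι)) := by
        ext z
        constructor
        · rintro ⟨hz, hzp⟩
          have hz' := hz
          rw [lowered_opL] at hz'
          obtain ⟨k, rfl, -⟩ := hz'
          rcases eq_or_ne k 0 with rfl | hk
          · exact Or.inl (by simp [z0])
          · have hkp : (⟨k, hk, hz⟩ : ι) ≠ p := fun h =>
              hzp (Set.mem_singleton_iff.2 (by rw [← h]))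
            exact Or.inr ⟨⟨⟨k, hk, hz⟩, hkp⟩, rfl⟩
        · rintro (rfl | ⟨k, rfl⟩)
          · have h00 : z0 0 = 0 := by simp [z0]
            refine ⟨h00 ▸ h0, fun h => hz0 p ?_⟩
            exact (Set.mem_singleton_iff.1 h).symm
          · exact ⟨(k : ι).2.2, fun h => k.2 (hzi (Set.mem_singleton_iff.1 h))⟩
      rw [tprod_coe_insert_range hzpi (fun ⟨k, hk⟩ => hz0 k hk) hr (f := fun a => fac a (z0 p)) h2,
        fac, if_pos rfl]
      rfl
    rw [hres, h4, h5, leadFac, if_neg (hz0 p), fac, if_neg (hm0 p)]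
    push_cast
    simp only [Function.comp_def] at h3 ⊢
    have := hm0 p
    have := hz0 p
    field_simp [pi_ne_zero']

/-- Off the common spectrum both multiplicities are 0, so equality on the spectrum is equality
everywhere. -/
theorem mult_eq_of_spec_eq {T S : L2 →ₗ.[ℂ] L2}
    (hT : ∀ {z}, mult T z ≠ 0 → z ∈ spec T) (hS : ∀ {z}, mult S z ≠ 0 → z ∈ spec S)
    (h : spec T = spec S) (hm : ∀ z ∈ spec T, mult T z = mult S z) : mult T = mult S := by
  funext z
  by_cases hz : z ∈ spec T
  · exact hm z hz
  · rw [not_ne_iff.1 fun h1 => hz (hT h1), not_ne_iff.1 fun h1 => hz (h ▸ hS h1)]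

end NonlocalPeriodic

end

/-! ### The theorem -/

open NonlocalPeriodic in
theorem theorem3p2 (α : ℝ) (v : L2) :
    -- the sets entering the formulas are read off from the spectrum with multiplicities
    (α ≠ 0 → lowered (opL α v) = spec L0 \ sigma0 v ∧ raised (opL α v) = sigma2 α v) ∧
    -- the product expansion of the characteristic function and the formulas for `α ‖v_p‖²`
    (∃ A : ℝ, A ≠ 0 ∧
      (∀ l : ℂ, HasProd
        (fun z : spec (opL α v) => fac (z : ℂ) (l ^ 2) ^ mult (opL α v) (z : ℂ))
        (Delta α v l / (A : ℂ))) ∧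
      (∀ w : ℂ, Multipliable (fun m : raised (opL α v) => fac (m : ℂ) w)) ∧
      (∀ w : ℂ, Multipliable (fun s : lowered (opL α v) => fac (s : ℂ) w)) ∧
      Tendsto
        (fun y : ℝ =>
          (∏' m : raised (opL α v), fac (m : ℂ) (Complex.I * (y : ℂ))) /
            ((Real.pi : ℂ) ^ 2 *
              ∏' s : lowered (opL α v), fac (s : ℂ) (Complex.I * (y : ℂ))))
        atTop (𝓝 (1 / (A : ℂ))) ∧
      (∀ p : ℕ, z0 p ∉ lowered (opL α v) → α * ‖proj p v‖ ^ 2 = 0) ∧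
      (z0 0 ∈ lowered (opL α v) → α * ‖proj 0 v‖ ^ 2 = -A / Real.pi ^ 2) ∧
      (∀ p : ℕ, p ≠ 0 → z0 p ∈ lowered (opL α v) →
        Multipliable (fun s : ↥(lowered (opL α v) \ {z0 p}) => fac (s : ℂ) (z0 p)) ∧
        ((α * ‖proj p v‖ ^ 2 : ℝ) : ℂ) =
          (A : ℂ) / (Real.pi : ℂ) ^ 2 * z0 p *
            (∏' m : raised (opL α v), fac (m : ℂ) (z0 p)) /
            ∏' s : ↥(lowered (opL α v) \ {z0 p}), fac (s : ℂ) (z0 p)) ∧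
      (z0 0 ∈ lowered (opL α v) →
        ∀ (m : {k : ℕ // k ≠ 0 ∧ z0 k ∈ lowered (opL α v)} ≃ raised (opL α v))
          (p : {k : ℕ // k ≠ 0 ∧ z0 k ∈ lowered (opL α v)}),
          ∃ P : ℂ,
            HasProd
              (fun k : {k : {k : ℕ // k ≠ 0 ∧ z0 k ∈ lowered (opL α v)} // k ≠ p} =>
                z0 k / (m k : ℂ) * (1 - (z0 k - (m k : ℂ)) / (z0 k - z0 p))) P ∧
            ((α * ‖proj p v‖ ^ 2 : ℝ) : ℂ) =
              (A : ℂ) * (((m p : ℂ) - z0 p) / ((Real.pi : ℂ) ^ 2 * (m p : ℂ))) * P)) ∧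
    -- the numbers `α ‖v_p‖²` are determined by the spectrum with multiplicities
    (∀ (α' : ℝ) (v' : L2), spec (opL α v) = spec (opL α' v') →
      (∀ z ∈ spec (opL α v), mult (opL α v) z = mult (opL α' v') z) →
      ∀ p : ℕ, α * ‖proj p v‖ ^ 2 = α' * ‖proj p v'‖ ^ 2) := by
  -- Stated for all pairs, since uniqueness applies it to `(α, v)` and `(α', v')`.
  have key : ∀ (α : ℝ) (v : L2), 
      (∃ A : ℝ, A ≠ 0 ∧
        (∀ l : ℂ, HasProd
          (fun z : spec (opL α v) => fac (z : ℂ) (l ^ 2) ^ mult (opL α v) (z : ℂ))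
          (Delta α v l / (A : ℂ))) ∧
        (∀ w : ℂ, Multipliable (fun m : raised (opL α v) => fac (m : ℂ) w)) ∧
        (∀ w : ℂ, Multipliable (fun s : lowered (opL α v) => fac (s : ℂ) w)) ∧
        Tendsto
          (fun y : ℝ =>
            (∏' m : raised (opL α v), fac (m : ℂ) (Complex.I * (y : ℂ))) /
              ((Real.pi : ℂ) ^ 2 *
                ∏' s : lowered (opL α v), fac (s : ℂ) (Complex.I * (y : ℂ))))
          atTop (𝓝 (1 / (A : ℂ))) ∧
        (∀ p : ℕ, z0 p ∉ lowered (opL α v) → α * ‖proj p v‖ ^ 2 = 0) ∧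
        (z0 0 ∈ lowered (opL α v) → α * ‖proj 0 v‖ ^ 2 = -A / Real.pi ^ 2) ∧
        (∀ p : ℕ, p ≠ 0 → z0 p ∈ lowered (opL α v) →
          Multipliable (fun s : ↥(lowered (opL α v) \ {z0 p}) => fac (s : ℂ) (z0 p)) ∧
          ((α * ‖proj p v‖ ^ 2 : ℝ) : ℂ) =
            (A : ℂ) / (Real.pi : ℂ) ^ 2 * z0 p *
              (∏' m : raised (opL α v), fac (m : ℂ) (z0 p)) /
              ∏' s : ↥(lowered (opL α v) \ {z0 p}), fac (s : ℂ) (z0 p)) ∧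
        (z0 0 ∈ lowered (opL α v) →
          ∀ (m : {k : ℕ // k ≠ 0 ∧ z0 k ∈ lowered (opL α v)} ≃ raised (opL α v))
            (p : {k : ℕ // k ≠ 0 ∧ z0 k ∈ lowered (opL α v)}),
            ∃ P : ℂ,
              HasProd
                (fun k : {k : {k : ℕ // k ≠ 0 ∧ z0 k ∈ lowered (opL α v)} // k ≠ p} =>
                  z0 k / (m k : ℂ) * (1 - (z0 k - (m k : ℂ)) / (z0 k - z0 p))) P ∧
              ((α * ‖proj p v‖ ^ 2 : ℝ) : ℂ) =
                (A : ℂ) * (((m p : ℂ) - z0 p) / ((Real.pi : ℂ) ^ 2 * (m p : ℂ))) * P)) := by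
    intro α v
    obtain ⟨C, hC0, hR, hP, hQC, hres⟩ := exists_Q_eq_tprod α v
    have hpi : (Real.pi : ℂ) ≠ 0 := pi_ne_zero'
    have hdiv : ((Real.pi ^ 2 * C : ℝ) : ℂ) / (Real.pi : ℂ) ^ 2 = C := by
      push_cast
      field_simp
    -- `π²` comes from the sine product and `C` from the factorisation of `Q`.
    refine ⟨Real.pi ^ 2 * C, mul_ne_zero (pow_ne_zero 2 Real.pi_ne_zero) hC0,
      hasProd_Delta hC0 hR hP hQC fun h => coeff_zero_eq h (hres 0 h),
      multipliable_fac Subtype.val_injective hR, multipliable_fac Subtype.val_injective hP,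
      tendsto_canonical_quotient hC0 hQC, fun p hp => ?_, fun h => ?_, fun p hp0 hp => ⟨?_, ?_⟩,
      fun h0 m p => exists_hasProd_matched hR hP h0 m p (hres p p.2.2)⟩
    · exact not_ne_iff.1 fun h => hp ((z0_mem_lowered_iff α v p).2 h)
    · rw [coeff_zero_eq h (hres 0 h)]
      have := Real.pi_ne_zero
      field_simp
    · exact multipliable_fac Subtype.val_injective (summable_norm_inv_lowered_diff hP _) _
    · have hz : z0 p ≠ 0 := fun h => hp0 (z0_injective (h.trans (by simp [z0])))
      rw [hres p hp, hdiv, leadFac, if_neg hz]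
      ring
  refine ⟨fun hα => ⟨?_, ?_⟩, key α v, fun α' v' hs hm p => ?_⟩
  · rw [lowered_opL]
    exact Set.ext (isPole_iff_of_ne_zero hα v)
  · rw [raised_opL]
    exact Set.ext fun z => and_congr_left' (not_congr (isPole_iff_of_ne_zero hα v z))
  · have hmult : mult (opL α v) = mult (opL α' v') :=
      mult_eq_of_spec_eq mem_spec_of_mult_ne_zero mem_spec_of_mult_ne_zero hs hm
    have hl : lowered (opL α v) = lowered (opL α' v') := by
      simp only [lowered, hmult]
    have hr : raised (opL α v) = raised (opL α' v') := by
      simp only [raised, hmult, hs]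
    obtain ⟨A, hA, -, -, -, hlim, hn, hz, hp, -⟩ := key α v
    obtain ⟨B, hB, -, -, -, hlim', hn', hz', hp', -⟩ := key α' v'
    rw [← hl] at hlim' hn' hz' hp'
    rw [← hr] at hlim' hp'
    -- Both constants are reciprocals of the same limit, which involves only the common raised and
    -- lowered sets.
    have hAB : A = B := by
      have := tendsto_nhds_unique hlim hlim'
      rw [one_div, one_div, inv_inj] at this
      exact Complex.ofReal_injective this
    by_cases hmem : z0 p ∈ lowered (opL α v)
    · rcases eq_or_ne p 0 with rfl | h0
      · rw [hz hmem, hz' hmem, hAB]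
      · apply Complex.ofReal_injective
        rw [(hp p h0 hmem).2, (hp' p h0 hmem).2, hAB]
    · rw [hn p hmem, hn' p hmem]
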